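/- **Setting.** Let $(X_i,U_i,\varepsilon_i)$, $i\ge 1$, be i.i.d. and let $Y_i=g(X_i)+\varepsilon_i$, $Z_i=X_i+U_i$, where $X$ has density $f_X$, $U\sim N(0,\sigma_u^2)$ with known $\sigma_u>0$ is independent of $(X,\varepsilon)$, $E(\varepsilon|X)=0$, $0<\tau^2(X)=E(\varepsilon^2|X)<\infty$ and $\mu(X)=E(|\varepsilon|^3|X)<\infty$. Let $\phi(t;m,s)$ be the $N(m,s)$ density. For a bandwidth $h=h_n>0$ and $\lambda\ge 0$ put $r=h^2/(h^2+\lambda\sigma_u^2)$, $$A_j=\frac1n\sum_{i=1}^n(Z_i-x)^j\phi(x;Z_i,h^2+\lambda\sigma_u^2),\qquad B_l=\frac1n\sum_{i=1}^nY_i(Z_i-x)^l\phi(x;Z_i,h^2+\lambda\sigma_u^2),$$ $\tilde S_0=A_0$, $\tilde S_1=rA_1$, $\tilde S_2=r^2A_2+\lambda\sigma_u^2rA_0$, $\tilde T_0=B_0$, $\tilde T_1=rB_1$, and $$\hat g_n(x;\lambda)=\frac{\tilde S_2\tilde T_0-\tilde S_1\tilde T_1}{\tilde S_2\tilde S_0-\tilde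 S_1^2}.$$ **Conditions.** C1: $f_X,g,\tau^2,\mu$ are twice continuously differentiable on $\mathbb R$, and for every $y$ in the support of $X$ and every $\eta\in\{f_X,g,g^2,\tau^2,\tau^4,\mu,\mu^2\}$ the functions $t\mapsto\eta'(t+y)$ and $t\mapsto\eta''(t+y)$ belong to $L_2(\phi(t;0,\sigma_u^2)\,dt)$. C2: $h\to0$ and $nh\to\infty$ as $n\to\infty$. **Notation.** With $\phi_\lambda(t)=\phi(t;x,(1+\lambda)\sigma_u^2)$ let $f_{j,\lambda}(x)=\int t^jf_X\phi_\lambda\,dt$, $g_{j,\lambda}(x)=\int t^jgf_X\phi_\lambda\,dt$, $G_{j,\lambda}(x)=\int t^jg^2f_X\phi_\lambda\,dt$, $H_{j,\lambda}(x)=\int t^j\tau^2f_X\phi_\lambda\,dt$, let $c_{0\lambda}=-g_{0,\lambda}/f_{0,\lambda}^2$, $d_{0\lambda}=1/f_{0,\lambda}$, and $$B(x;\lambda)=\frac{f_{0,\lambda}g_{0,\lambda}''-f_{0,\lambda}''g_{0,\lambda}}{2f_{0,\lambda}^2}+\frac{(f_{1,\lambda}-xf_{0,\lambda})(g_{0,\lambda}f_{1,\lambda}-f_{0,\lambda}g_{1,\lambda})}{(\lambda+1)^2\sigma_u^4f_{0,\lambda}^3},$$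 where all functions are evaluated at $x$ and primes are derivatives in $x$. **Theorem.** Assume C1 and C2 and fix $x\in\mathbb R$. (i) Let $\lambda>0$; if $\lambda\ge2$, assume in addition that $E[Y^2\phi^2(x;Z,b^2+\lambda\sigma_u^2)]<\infty$ for some $b>0$. Then there is a deterministic sequence $\rho_n=o(h^2)$ such that $$\sqrt n\Big\{\hat g_n(x;\lambda)-\frac{g_{0,\lambda}(x)}{f_{0,\lambda}(x)}-h^2B(x;\lambda)+\rho_n\Big\}\Longrightarrow N(0,\Delta_{\lambda,\lambda}(x)),$$ where $\Delta_{\lambda,\lambda}(x)\ge0$ is $$c_{0\lambda}^2\Big[\frac{f_{0,\lambda/2}}{2\sqrt{\pi\lambda\sigma_u^2}}-f_{0,\lambda}^2\Big]+d_{0\lambda}^2\Big[\frac{G_{0,\lambda/2}+H_{0,\lambda/2}}{2\sqrt{\pi\lambda\sigma_u^2}}-g_{0,\lambda}^2\Big]+2c_{0\lambda}d_{0\lambda}\Big[\frac{g_{0,\lambda/2}}{2\sqrt{\pi\lambda\sigma_u^2}}-g_{0,\lambda}f_{0,\lambda}\Big].$$ (ii) For $\lambda=0$ there is a deterministic sequence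 $\rho_n=o(h^2)$ such that $$\sqrt{nh}\Big\{\hat g_n(x;0)-\frac{g_{0,0}(x)}{f_{0,0}(x)}-h^2B(x;0)+\rho_n\Big\}\Longrightarrow N(0,\Delta_{0,0}(x)),\qquad \Delta_{0,0}(x)=\frac1{2\sqrt\pi}\Big[\frac{G_{0,0}(x)+H_{0,0}(x)}{f_{0,0}^2(x)}-\frac{g_{0,0}^2(x)}{f_{0,0}^3(x)}\Big]\ge0.$$ -/

import Mathlib

open MeasureTheory ProbabilityTheory Filter Asymptotics Topology

namespace EXEstimation

noncomputable section

/-- The normal density with mean `m` and variance `s` at the point `t`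
(used for `s > 0` only). -/
def phi (t m s : ℝ) : ℝ := gaussianPDFReal m s.toNNReal t

/-! ### The model -/

/-- The errors-in-variables regression model `Y = g(X) + ε`, `Z = X + U`, sampled independently.
`X` has density `fX`, the measurement error `U` is `N(0, σ²)` and independent of `(X, ε)`, and
given `X = t` the regression error `ε` has mean `0`, variance `τ²(t) ∈ (0, ∞)` and third absolute
moment `μ₃(t) < ∞`; these conditional moments are those of the regular conditional distribution
of `ε` given `X`, so that no unconditional moment of `ε` is presupposed. -/
structure Model {Ω : Type*} [MeasurableSpace Ω] (P : Measure Ω) [IsProbabilityMeasure P]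
    (X U ε : ℕ → Ω → ℝ) (fX τsq μ₃ : ℝ → ℝ) (σ : ℝ) : Prop where
  measurable_X : ∀ i, Measurable (X i)
  measurable_U : ∀ i, Measurable (U i)
  measurable_ε : ∀ i, Measurable (ε i)
  indep : iIndepFun (fun i ω => (X i ω, U i ω, ε i ω)) P
  ident : ∀ i, IdentDistrib (fun ω => (X i ω, U i ω, ε i ω)) (fun ω => (X 0 ω, U 0 ω, ε 0 ω)) P P
  density_nonneg : ∀ t, 0 ≤ fX t
  law_X : P.map (X 0) = volume.withDensity (fun t => ENNReal.ofReal (fX t))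
  law_U : P.map (U 0) = gaussianReal 0 (σ ^ 2).toNNReal
  indep_U : IndepFun (U 0) (fun ω => (X 0 ω, ε 0 ω)) P
  error : ∀ᵐ t ∂(P.map (X 0)),
    Integrable (fun e => |e| ^ 3) (condDistrib (ε 0) (X 0) P t) ∧
    ∫ e, e ∂(condDistrib (ε 0) (X 0) P t) = 0 ∧
    ∫ e, e ^ 2 ∂(condDistrib (ε 0) (X 0) P t) = τsq t ∧
    ∫ e, |e| ^ 3 ∂(condDistrib (ε 0) (X 0) P t) = μ₃ t ∧
    0 < τsq t

/-- The integrability part of the regularity condition on a function `η`: for each `x` in the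
support `S`, `η'(· + x)` and `η''(· + x)` belong to `L²` of `N(0, σ²)`. -/
def DerivL2 (S : Set ℝ) (σ : ℝ) (η : ℝ → ℝ) : Prop :=
  ∀ x ∈ S,
    MemLp (fun t => deriv η (t + x)) 2 (gaussianReal 0 (σ ^ 2).toNNReal) ∧
    MemLp (fun t => iteratedDeriv 2 η (t + x)) 2 (gaussianReal 0 (σ ^ 2).toNNReal)

/-- Smoothness of the design density, the regression function and the conditional moments of the
error; `S` is the support of `X`. -/
structure CondC1 (S : Set ℝ) (fX g τsq μ₃ : ℝ → ℝ) (σ : ℝ) : Prop where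
  smooth_fX : ContDiff ℝ 2 fX
  smooth_g : ContDiff ℝ 2 g
  smooth_τsq : ContDiff ℝ 2 τsq
  smooth_μ₃ : ContDiff ℝ 2 μ₃
  l2_fX : DerivL2 S σ fX
  l2_g : DerivL2 S σ g
  l2_g_sq : DerivL2 S σ (fun t => g t ^ 2)
  l2_τsq : DerivL2 S σ τsq
  l2_τsq_sq : DerivL2 S σ (fun t => τsq t ^ 2)
  l2_μ₃ : DerivL2 S σ μ₃
  l2_μ₃_sq : DerivL2 S σ (fun t => μ₃ t ^ 2)

/-- The bandwidth condition: `h > 0`, `h → 0` and `n h → ∞`. -/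
structure CondC2 (h : ℕ → ℝ) : Prop where
  pos : ∀ n, 0 < h n
  tendsto_zero : Tendsto h atTop (𝓝 0)
  tendsto_mul : Tendsto (fun n : ℕ => (n : ℝ) * h n) atTop atTop

/-! ### The estimator

`σ` is the standard deviation of the measurement error, `lam` the extrapolation variable, `b` the
bandwidth, `x` the point of estimation, `n` the sample size, and `Z`, `Y` are the data. -/

/-- `A_{nj}(x) = n⁻¹ ∑ (Z_i - x)^j φ(x; Z_i, b² + λσ²)`. -/
def An (σ lam b x : ℝ) (n : ℕ) (Z : ℕ → ℝ) (j : ℕ) : ℝ :=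
  (n : ℝ)⁻¹ * ∑ i ∈ Finset.range n, (Z i - x) ^ j * phi x (Z i) (b ^ 2 + lam * σ ^ 2)

/-- `B_{nl}(x) = n⁻¹ ∑ Y_i (Z_i - x)^l φ(x; Z_i, b² + λσ²)`. -/
def Bn (σ lam b x : ℝ) (n : ℕ) (Z Y : ℕ → ℝ) (l : ℕ) : ℝ :=
  (n : ℝ)⁻¹ * ∑ i ∈ Finset.range n, Y i * (Z i - x) ^ l * phi x (Z i) (b ^ 2 + lam * σ ^ 2)

/-- `r(λ, b) = b² / (b² + λσ²)`. -/
def ratio (σ lam b : ℝ) : ℝ := b ^ 2 / (b ^ 2 + lam * σ ^ 2)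

/-- `S0`, `S1`, `S2` are the conditional expectations, given the data, of the local linear sums
`n⁻¹ ∑ (Z_i + √λ V_i - x)^j K_b(Z_i + √λ V_i - x)`, `j = 0, 1, 2`, in closed form, for the standard
normal kernel `K` and independent pseudo-errors `V_i` distributed as `N(0, σ²)`. -/
def S0 (σ lam b x : ℝ) (n : ℕ) (Z : ℕ → ℝ) : ℝ := An σ lam b x n Z 0

/-- See `S0`: the case `j = 1`. -/
def S1 (σ lam b x : ℝ) (n : ℕ) (Z : ℕ → ℝ) : ℝ := ratio σ lam b * An σ lam b x n Z 1

/-- See `S0`: the case `j = 2`. -/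
def S2 (σ lam b x : ℝ) (n : ℕ) (Z : ℕ → ℝ) : ℝ :=
  ratio σ lam b ^ 2 * An σ lam b x n Z 2 + lam * σ ^ 2 * ratio σ lam b * An σ lam b x n Z 0

/-- The same conditional expectations with the responses `Y_i` as additional factors,
`l = 0, 1`. -/
def T0 (σ lam b x : ℝ) (n : ℕ) (Z Y : ℕ → ℝ) : ℝ := Bn σ lam b x n Z Y 0

/-- See `T0`: the case `l = 1`. -/
def T1 (σ lam b x : ℝ) (n : ℕ) (Z Y : ℕ → ℝ) : ℝ := ratio σ lam b * Bn σ lam b x n Z Y 1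

/-- The estimator `ĝ_n(x; λ)`: the intercept of the local linear least squares problem in which
the weighted sums are replaced by their conditional expectations given the data. -/
def ghat (σ lam b x : ℝ) (n : ℕ) (Z Y : ℕ → ℝ) : ℝ :=
  (S2 σ lam b x n Z * T0 σ lam b x n Z Y - S1 σ lam b x n Z * T1 σ lam b x n Z Y) /
    (S2 σ lam b x n Z * S0 σ lam b x n Z - S1 σ lam b x n Z ^ 2)

/-! ### The limit quantities -/

/-- `f_{j,λ}(x) = ∫ t^j f_X(t) φ(t; x, (1+λ)σ²) dt`. -/
def fSm (fX : ℝ → ℝ) (σ : ℝ) (j : ℕ) (lam x : ℝ) : ℝ :=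
  ∫ t, t ^ j * fX t * phi t x ((1 + lam) * σ ^ 2)

/-- `g_{j,λ}(x) = ∫ t^j g(t) f_X(t) φ(t; x, (1+λ)σ²) dt`. -/
def gSm (fX g : ℝ → ℝ) (σ : ℝ) (j : ℕ) (lam x : ℝ) : ℝ :=
  ∫ t, t ^ j * g t * fX t * phi t x ((1 + lam) * σ ^ 2)

/-- `G_{j,λ}(x) = ∫ t^j g(t)² f_X(t) φ(t; x, (1+λ)σ²) dt`. -/
def GSm (fX g : ℝ → ℝ) (σ : ℝ) (j : ℕ) (lam x : ℝ) : ℝ :=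
  ∫ t, t ^ j * g t ^ 2 * fX t * phi t x ((1 + lam) * σ ^ 2)

/-- `H_{j,λ}(x) = ∫ t^j τ²(t) f_X(t) φ(t; x, (1+λ)σ²) dt`. -/
def HSm (fX τsq : ℝ → ℝ) (σ : ℝ) (j : ℕ) (lam x : ℝ) : ℝ :=
  ∫ t, t ^ j * τsq t * fX t * phi t x ((1 + lam) * σ ^ 2)

/-- The asymptotic bias coefficient `B(x; λ)`. -/
def bias (fX g : ℝ → ℝ) (σ lam x : ℝ) : ℝ :=
  (fSm fX σ 0 lam x * iteratedDeriv 2 (fun y => gSm fX g σ 0 lam y) x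
      - iteratedDeriv 2 (fun y => fSm fX σ 0 lam y) x * gSm fX g σ 0 lam x)
    / (2 * fSm fX σ 0 lam x ^ 2)
  + (fSm fX σ 1 lam x - x * fSm fX σ 0 lam x)
      * (gSm fX g σ 0 lam x * fSm fX σ 1 lam x - fSm fX σ 0 lam x * gSm fX g σ 1 lam x)
    / ((lam + 1) ^ 2 * σ ^ 4 * fSm fX σ 0 lam x ^ 3)

/-- `c_{0λ}(x) = - g_{0,λ}(x) / f_{0,λ}(x)²`. -/
def c0 (fX g : ℝ → ℝ) (σ lam x : ℝ) : ℝ := -(gSm fX g σ 0 lam x / fSm fX σ 0 lam x ^ 2)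

/-- `d_{0λ}(x) = 1 / f_{0,λ}(x)`. -/
def d0 (fX : ℝ → ℝ) (σ lam x : ℝ) : ℝ := 1 / fSm fX σ 0 lam x

/-- The asymptotic variance `Δ_{λ,λ}(x)` for `λ > 0`. -/
def DeltaPos (fX g τsq : ℝ → ℝ) (σ lam x : ℝ) : ℝ :=
  c0 fX g σ lam x ^ 2 *
      (fSm fX σ 0 (lam / 2) x / (2 * √(Real.pi * lam * σ ^ 2)) - fSm fX σ 0 lam x ^ 2)
  + d0 fX σ lam x ^ 2 *
      ((GSm fX g σ 0 (lam / 2) x + HSm fX τsq σ 0 (lam / 2) x) / (2 * √(Real.pi * lam * σ ^ 2))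
        - gSm fX g σ 0 lam x ^ 2)
  + 2 * c0 fX g σ lam x * d0 fX σ lam x *
      (gSm fX g σ 0 (lam / 2) x / (2 * √(Real.pi * lam * σ ^ 2))
        - gSm fX g σ 0 lam x * fSm fX σ 0 lam x)

/-- The asymptotic variance `Δ_{0,0}(x)` of the naive estimator. -/
def DeltaZero (fX g τsq : ℝ → ℝ) (σ x : ℝ) : ℝ :=
  1 / (2 * √Real.pi) *
    ((GSm fX g σ 0 0 x + HSm fX τsq σ 0 0 x) / fSm fX σ 0 0 x ^ 2
      - gSm fX g σ 0 0 x ^ 2 / fSm fX σ 0 0 x ^ 3)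

/-- The centred estimator `ĝ_n(x;λ) - g_{0,λ}(x)/f_{0,λ}(x) - h_n² B(x;λ) + ρ_n`, where the data
are `Z_i = X_i + U_i` and `Y_i = g(X_i) + ε_i`. -/
def centred {Ω : Type*} (X U ε : ℕ → Ω → ℝ) (fX g : ℝ → ℝ) (σ lam x : ℝ) (h ρ : ℕ → ℝ)
    (n : ℕ) (ω : Ω) : ℝ :=
  ghat σ lam (h n) x n (fun i => X i ω + U i ω) (fun i => g (X i ω) + ε i ω)
    - gSm fX g σ 0 lam x / fSm fX σ 0 lam x - h n ^ 2 * bias fX g σ lam x + ρ n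

end

end EXEstimation

open EXEstimation

namespace EXEstimation

/-! ### The Gaussian kernel -/

/-! The algebra. Put `s = h² + λσ²`. The local linear weights are combinations of the kernel `φ(·;
x, s)` and its derivatives `φ₁`, `φ₂` in the centre. Once a common factor `h²` is cancelled, the
estimator is `(qB - h²ατ) / (qA - h²α²)`. Here `A`, `α`, `q` are the empirical means of `φ`, `φ₁`,
`φ + h²φ₂` at the `Z_i`, and `B`, `τ` are those of `Yφ`, `Yφ₁` (`ghat_eq`).

The bias. Averaging over the normal error `U` adds `σ²` to the variance of the kernel and commutes
with differentiation in the centre. All five expectations are therefore Gaussian smoothings of the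
law of `X`, weighted by `1` or `g`, at variance `S + h²` with `S = (1+λ)σ²`. The ratio `D_n` formed
from them is `meanRatio` at `u = h²`. By the heat equation `∂_s φ = φ₂ / 2` it is differentiable at
`u = 0`, and its derivative is `B(x; λ)`. Hence `D_n = g₀/f₀ + h²B + o(h²)`. With the remainder
taken as `ρ_n`, the centred estimator is exactly `ĝ_n - D_n`.

The stochastic part. The rate is `√(n κ_n)` with `κ = 1` if `λ > 0` and `κ = h` if `λ = 0`. The
summands, with `φ₁` scaled by `h`, have second moments `O(1/√s)`, so the normalized deviations of
the means are bounded in mean square and thus bounded off events of small probability. Where they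
are bounded, the ratio can be linearized (`tendsto_ratio_sub_linear`): the deviations of `q`, `α`,
`τ` carry coefficients tending to zero, and what remains is `1/f₀` times the centred empirical mean
of `(Y - D_n) φ(Z; x, s)`. This is `Model.tendstoInDistribution_centred`.

The limit law. For `λ > 0` the kernel does not degenerate, the summands converge in `L²`, and the
classical central limit theorem applies. For `λ = 0` the kernel concentrates at `x`. Third absolute
moments are then `O(h⁻²)` and Lyapunov's condition holds because `nh → ∞`.

Moments. A derivative in `L²` of `N(0, σ²)` forces growth of at most `(1+|w|) exp(w²/(4σ²))`. So
`g²` and `τ²` can be integrated against normal densities of variance below `2σ²`. The second moment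
of `Yφ` needs variance slightly above `(1 + λ/2)σ²`, whence the extra assumption when `λ ≥ 2`. -/

lemma phi_eq {s : ℝ} (hs : 0 < s) (t m : ℝ) :
    phi t m s = (√(2 * Real.pi * s))⁻¹ * Real.exp (-(t - m) ^ 2 / (2 * s)) := by
  rw [phi, gaussianPDFReal, Real.coe_toNNReal _ hs.le]

lemma phi_nonneg (t m s : ℝ) : 0 ≤ phi t m s := gaussianPDFReal_nonneg _ _ _

lemma phi_pos {s : ℝ} (hs : 0 < s) (t m : ℝ) : 0 < phi t m s :=
  gaussianPDFReal_pos _ _ _ (by simpa using hs)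

lemma phi_comm (t m s : ℝ) : phi t m s = phi m t s := by
  simp only [phi, gaussianPDFReal]
  rw [show (t - m) ^ 2 = (m - t) ^ 2 by ring]

@[fun_prop]
lemma measurable_phi_left (m s : ℝ) : Measurable fun t => phi t m s :=
  measurable_gaussianPDFReal _ _

lemma phi_le {s : ℝ} (hs : 0 < s) (t m : ℝ) : phi t m s ≤ (√(2 * Real.pi * s))⁻¹ := by
  rw [phi_eq hs]
  refine mul_le_of_le_one_right (by positivity) (Real.exp_le_one_iff.2 ?_)
  rw [neg_div]
  exact neg_nonpos.2 (by positivity)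

/-- Halving the variance is what brings `λ/2` into the asymptotic variance: after averaging over `U`
the kernel has variance `λσ²/2 + σ² = (1 + λ/2)σ²`. -/
lemma phi_sq {s : ℝ} (hs : 0 < s) (t m : ℝ) :
    phi t m s ^ 2 = (2 * √(Real.pi * s))⁻¹ * phi t m (s / 2) := by
  rw [phi_eq hs, phi_eq (half_pos hs), mul_pow, ← Real.exp_nat_mul, inv_pow,
    Real.sq_sqrt (by positivity), ← mul_assoc, ← mul_inv,
    show 2 * Real.pi * (s / 2) = Real.pi * s by ring,
    mul_assoc 2 √(Real.pi * s), Real.mul_self_sqrt (by positivity)]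
  congr 2
  · ring
  · push_cast
    field_simp

/-- The cube of a normal density is a multiple of the normal density with a third of the
variance. -/
lemma phi_cube {s : ℝ} (hs : 0 < s) (t m : ℝ) :
    phi t m s ^ 3 = (√3 * (2 * Real.pi * s))⁻¹ * phi t m (s / 3) := by
  have h3 : √(2 * Real.pi * s) = √3 * √(2 * Real.pi * (s / 3)) := by
    rw [← Real.sqrt_mul (by norm_num)]
    congr 1
    ring
  rw [phi_eq hs, phi_eq (by positivity : 0 < s / 3), mul_pow, ← Real.exp_nat_mul, inv_pow,
    ← mul_assoc, ← mul_inv]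
  congr 2
  · rw [pow_succ, Real.sq_sqrt (by positivity), h3]
    ring
  · push_cast
    field_simp

/-- Widening a normal density costs a factor depending only on the variances. -/
lemma phi_le_phi_of_le {s s' : ℝ} (hs : 0 < s) (h : s ≤ s') (t m : ℝ) :
    phi t m s ≤ √(s' / s) * phi t m s' := by
  have hs' : 0 < s' := hs.trans_le h
  have e : √(s' / s) * (√(2 * Real.pi * s'))⁻¹ = (√(2 * Real.pi * s))⁻¹ := by
    rw [Real.sqrt_div' _ hs.le, Real.sqrt_mul (by positivity) s', Real.sqrt_mul (by positivity) s]
    have h1 := (Real.sqrt_pos.2 hs').ne'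
    have h2 := (Real.sqrt_pos.2 hs).ne'
    field_simp
  rw [phi_eq hs, phi_eq hs', ← mul_assoc, e]
  gcongr _ * Real.exp ?_
  rw [neg_div, neg_div, neg_le_neg_iff]
  gcongr

/-- Domination of `(1 + (t - y)²) φ(t; y, s)` by a wider normal density, locally uniformly in the
parameters. -/
lemma exists_phi_bound {s₁ s₂ s' : ℝ} (h₁ : 0 < s₁) (h₁₂ : s₁ ≤ s₂) (h₂ : s₂ < s') (x : ℝ) :
    ∃ C, 0 ≤ C ∧ ∀ s, s₁ ≤ s → s ≤ s₂ → ∀ y, |y - x| ≤ 1 → ∀ t,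
      (1 + (t - y) ^ 2) * phi t y s ≤ C * phi t x s' := by
  have h₂' : 0 < s₂ := h₁.trans_le h₁₂
  have hs' : 0 < s' := h₂'.trans h₂
  -- The gap between the exponents at variances `s₂` and `s'` is `2c w²`. One half absorbs the
  -- factor `1 + w²`, the other the cross term created by moving the centre from `y` to `x`.
  set c : ℝ := (1 / s₂ - 1 / s') / 4 with hc
  have hc0 : 0 < c := by
    have : 1 / s' < 1 / s₂ := one_div_lt_one_div_of_lt h₂' h₂
    simp only [hc]; linarith
  set K : ℝ := (1 + 1 / c) * (√(2 * Real.pi * s₁))⁻¹ *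
    Real.exp (1 / (2 * s') + 1 / (4 * s' ^ 2 * c)) * √(2 * Real.pi * s') with hK
  refine ⟨K, by positivity, fun s hs1 hs2 y hy t => ?_⟩
  have hs : 0 < s := h₁.trans_le hs1
  rw [phi_eq hs, phi_eq hs']
  set w := t - y
  have e1 : 1 + w ^ 2 ≤ (1 + 1 / c) * Real.exp (c * w ^ 2) := by
    have := Real.add_one_le_exp (c * w ^ 2)
    have h3 : (1 + 1 / c) * (c * w ^ 2 + 1) ≤ (1 + 1 / c) * Real.exp (c * w ^ 2) := by gcongr
    have h4 : (1 + 1 / c) * (c * w ^ 2 + 1) = 1 + w ^ 2 + (c * w ^ 2 + 1 / c) := by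
      field_simp; ring
    have : 0 ≤ c * w ^ 2 + 1 / c := by positivity
    linarith
  have e2 : (√(2 * Real.pi * s))⁻¹ ≤ (√(2 * Real.pi * s₁))⁻¹ := by gcongr
  have e3 : c * w ^ 2 + -w ^ 2 / (2 * s) ≤
      (1 / (2 * s') + 1 / (4 * s' ^ 2 * c)) + -(t - x) ^ 2 / (2 * s') := by
    have a1 : -w ^ 2 / (2 * s) ≤ -w ^ 2 / (2 * s₂) := by
      rw [neg_div, neg_div, neg_le_neg_iff]; gcongr
    have a2 : t - x = w + (y - x) := by simp only [w]; ring
    have a3 : (y - x) ^ 2 ≤ 1 := by rw [← sq_abs]; nlinarith [abs_nonneg (y - x)]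
    have a4 : w ^ 2 / (2 * s₂) = 2 * c * w ^ 2 + w ^ 2 / (2 * s') := by
      simp only [hc]; field_simp; ring
    set d := y - x
    have a5 : 0 ≤ (2 * s' * c * w - d) ^ 2 / (4 * s' ^ 2 * c) := by positivity
    have a6 : (2 * s' * c * w - d) ^ 2 / (4 * s' ^ 2 * c) =
      c * w ^ 2 - 2 * w * d / (2 * s') + d ^ 2 / (4 * s' ^ 2 * c) := by
      field_simp; ring
    have a7 : d ^ 2 / (4 * s' ^ 2 * c) ≤ 1 / (4 * s' ^ 2 * c) := by gcongr
    have a8 : d ^ 2 / (2 * s') ≤ 1 / (2 * s') := by gcongr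
    have a9 : (t - x) ^ 2 / (2 * s') =
      w ^ 2 / (2 * s') + 2 * w * d / (2 * s') + d ^ 2 / (2 * s') := by rw [a2]; ring
    rw [neg_div] at a1 ⊢
    rw [neg_div] at a1 ⊢
    linarith
  have hsq : √(2 * Real.pi * s') ≠ 0 := (Real.sqrt_pos.2 (by positivity)).ne'
  calc (1 + w ^ 2) * ((√(2 * Real.pi * s))⁻¹ * Real.exp (-w ^ 2 / (2 * s)))
      ≤ ((1 + 1 / c) * Real.exp (c * w ^ 2)) *
        ((√(2 * Real.pi * s₁))⁻¹ * Real.exp (-w ^ 2 / (2 * s))) := by gcongr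
    _ = (1 + 1 / c) * (√(2 * Real.pi * s₁))⁻¹ * Real.exp (c * w ^ 2 + -w ^ 2 / (2 * s)) := by
        rw [Real.exp_add]; ring
    _ ≤ (1 + 1 / c) * (√(2 * Real.pi * s₁))⁻¹ * Real.exp
        ((1 / (2 * s') + 1 / (4 * s' ^ 2 * c)) + -(t - x) ^ 2 / (2 * s')) := by gcongr
    _ = K * ((√(2 * Real.pi * s'))⁻¹ * Real.exp (-(t - x) ^ 2 / (2 * s'))) := by
        rw [hK, Real.exp_add]
        field_simp

/-- The first derivative of `φ(t; ·, s)` at `y`. -/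
noncomputable def phi₁ (t y s : ℝ) : ℝ := (t - y) / s * phi t y s

/-- The second derivative of `φ(t; ·, s)` at `y`. -/
noncomputable def phi₂ (t y s : ℝ) : ℝ := ((t - y) ^ 2 / s ^ 2 - 1 / s) * phi t y s

@[fun_prop]
lemma measurable_phi₁_left (m s : ℝ) : Measurable fun t => phi₁ t m s := by
  unfold phi₁; fun_prop

@[fun_prop]
lemma measurable_phi₂_left (m s : ℝ) : Measurable fun t => phi₂ t m s := by
  unfold phi₂; fun_prop

lemma hasDerivAt_phi_mean {s : ℝ} (hs : 0 < s) (t y : ℝ) :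
    HasDerivAt (fun y => phi t y s) (phi₁ t y s) y := by
  have e : (fun y => phi t y s) =
      fun y => (√(2 * Real.pi * s))⁻¹ * Real.exp (-(t - y) ^ 2 / (2 * s)) := by
    ext y; exact phi_eq hs t y
  rw [phi₁, e, phi_eq hs]
  have h1 : HasDerivAt (fun y => -(t - y) ^ 2 / (2 * s)) ((t - y) / s) y := by
    have := ((((hasDerivAt_id y).const_sub t).pow 2).neg).div_const (2 * s)
    refine this.congr_deriv ?_
    simp; field_simp
  refine (h1.exp.const_mul _).congr_deriv ?_
  ring

lemma hasDerivAt_phi₁_mean {s : ℝ} (hs : 0 < s) (t y : ℝ) :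
    HasDerivAt (fun y => phi₁ t y s) (phi₂ t y s) y := by
  have := (((hasDerivAt_id y).const_sub t).div_const s).mul (hasDerivAt_phi_mean hs t y)
  refine this.congr_deriv ?_
  simp only [phi₁, phi₂, id]
  ring

/-- The heat equation. It turns the effect of the bandwidth on the variance of the kernel into the
second derivatives in the bias. -/
lemma hasDerivAt_phi_var {s : ℝ} (hs : 0 < s) (t y : ℝ) :
    HasDerivAt (fun s => phi t y s) (phi₂ t y s / 2) s := by
  have e : (fun s => phi t y s) =ᶠ[𝓝 s]
      fun s => (√(2 * Real.pi * s))⁻¹ * Real.exp (-(t - y) ^ 2 / (2 * s)) := by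
    filter_upwards [lt_mem_nhds hs] with s hs
    exact phi_eq hs t y
  refine HasDerivAt.congr_of_eventuallyEq ?_ e
  rw [phi₂, phi_eq hs]
  have hq : 0 < 2 * Real.pi * s := by positivity
  have hq' : √(2 * Real.pi * s) ≠ 0 := (Real.sqrt_pos.2 hq).ne'
  have h1 : HasDerivAt (fun s => -(t - y) ^ 2 / (2 * s)) ((t - y) ^ 2 / (2 * s ^ 2)) s := by
    have := ((hasDerivAt_id s).const_mul 2).inv (by simpa using hs.ne')
    have := this.const_mul (-(t - y) ^ 2)
    refine (this.congr_deriv ?_)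
    simp only [id]
    field_simp
  have h2 : HasDerivAt (fun s => (√(2 * Real.pi * s))⁻¹)
      (-(√(2 * Real.pi * s))⁻¹ / (2 * s)) s := by
    have := ((((hasDerivAt_id s).const_mul (2 * Real.pi))).sqrt hq.ne').inv hq'
    refine this.congr_deriv ?_
    simp only [id]
    have hsq := Real.sq_sqrt hq.le
    rw [hsq]
    field_simp
  refine (h2.mul h1.exp).congr_deriv ?_
  field_simp
  ring

lemma abs_phi₁_le {s : ℝ} (hs : 0 < s) (t y : ℝ) :
    |phi₁ t y s| ≤ 1 / s * ((1 + (t - y) ^ 2) * phi t y s) := by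
  rw [phi₁, abs_mul, abs_of_nonneg (phi_nonneg _ _ _), abs_div, abs_of_pos hs]
  have : |t - y| ≤ 1 + (t - y) ^ 2 := by
    rw [← sq_abs]; nlinarith [sq_nonneg (|t - y| - 1)]
  have := phi_nonneg t y s
  rw [← mul_assoc]
  gcongr
  rw [div_eq_mul_one_div, mul_comm]
  gcongr

lemma abs_phi₂_le {s : ℝ} (hs : 0 < s) (t y : ℝ) :
    |phi₂ t y s| ≤ (1 / s ^ 2 + 1 / s) * ((1 + (t - y) ^ 2) * phi t y s) := by
  rw [phi₂, abs_mul, abs_of_nonneg (phi_nonneg _ _ _), ← mul_assoc]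
  have := phi_nonneg t y s
  gcongr
  rw [abs_le]
  have h1 : 0 ≤ 1 / s := by positivity
  have h2 : 0 ≤ 1 / s ^ 2 := by positivity
  have h3 := sq_nonneg (t - y)
  rw [show (t - y) ^ 2 / s ^ 2 = 1 / s ^ 2 * (t - y) ^ 2 by ring]
  constructor <;> nlinarith [mul_nonneg h1 h3, mul_nonneg h2 h3]

/-! ### Smoothing by the law of the measurement error -/

/-- Completing the square in `u`. The product factors into a convolved density, free of `u`, and a
normal density in `u`, as a joint density does into a marginal and a conditional one. -/
lemma phi_add_mul_gaussianPDFReal {s σ : ℝ} (hs : 0 < s) (hσ : 0 < σ) (t u x : ℝ) :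
    phi (t + u) x s * gaussianPDFReal 0 (σ ^ 2).toNNReal u =
      phi t x (s + σ ^ 2) * gaussianPDFReal ((x - t) * σ ^ 2 / (s + σ ^ 2))
        (s * σ ^ 2 / (s + σ ^ 2)).toNNReal u := by
  have hS : 0 < s + σ ^ 2 := by positivity
  have hv : 0 < s * σ ^ 2 / (s + σ ^ 2) := by positivity
  change _ * phi u 0 (σ ^ 2) = _ * phi u _ (s * σ ^ 2 / (s + σ ^ 2))
  rw [phi_eq hs, phi_eq hS, phi_eq hv, phi_eq (by positivity)]
  have e1 : √(2 * Real.pi * s) * √(2 * Real.pi * σ ^ 2) =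
      √(2 * Real.pi * (s + σ ^ 2)) * √(2 * Real.pi * (s * σ ^ 2 / (s + σ ^ 2))) := by
    rw [← Real.sqrt_mul (by positivity), ← Real.sqrt_mul (by positivity)]
    congr 1
    field_simp
  have e2 : -(t + u - x) ^ 2 / (2 * s) + -(u - 0) ^ 2 / (2 * σ ^ 2) =
      -(t - x) ^ 2 / (2 * (s + σ ^ 2)) +
      -(u - (x - t) * σ ^ 2 / (s + σ ^ 2)) ^ 2 / (2 * (s * σ ^ 2 / (s + σ ^ 2))) := by
    field_simp
    ring
  rw [mul_mul_mul_comm, ← Real.exp_add, ← mul_inv, e1, e2, mul_inv, Real.exp_add]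
  ring

lemma integral_mul_phi_add {s σ : ℝ} (hs : 0 < s) (hσ : 0 < σ) (t x : ℝ) (f : ℝ → ℝ) :
    ∫ u, f u * phi (t + u) x s ∂(gaussianReal 0 (σ ^ 2).toNNReal) =
      phi t x (s + σ ^ 2) * ∫ u, f u ∂(gaussianReal ((x - t) * σ ^ 2 / (s + σ ^ 2))
        (s * σ ^ 2 / (s + σ ^ 2)).toNNReal) := by
  have hS : 0 < s + σ ^ 2 := by positivity
  have hv : 0 < s * σ ^ 2 / (s + σ ^ 2) := by positivity
  rw [integral_gaussianReal_eq_integral_smul (by simpa using hσ.ne'),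
    integral_gaussianReal_eq_integral_smul (by simpa using hv), ← integral_const_mul]
  refine integral_congr_ae (ae_of_all _ fun u => ?_)
  simp only [smul_eq_mul]
  linear_combination f u * phi_add_mul_gaussianPDFReal hs hσ t u x

lemma integral_phi_add {s σ : ℝ} (hs : 0 < s) (hσ : 0 < σ) (t x : ℝ) :
    ∫ u, phi (t + u) x s ∂(gaussianReal 0 (σ ^ 2).toNNReal) = phi t x (s + σ ^ 2) := by
  simpa using integral_mul_phi_add hs hσ t x (fun _ => 1)

/-- Convolution commutes with differentiation in the centre. Since `φ₁` is a linear polynomial times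
`φ`, only the mean of the conditional normal law is needed and no differentiation under the
integral. -/
lemma integral_phi₁_add {s σ : ℝ} (hs : 0 < s) (hσ : 0 < σ) (t x : ℝ) :
    ∫ u, phi₁ (t + u) x s ∂(gaussianReal 0 (σ ^ 2).toNNReal) = phi₁ t x (s + σ ^ 2) := by
  have hS : 0 < s + σ ^ 2 := by positivity
  simp only [phi₁]
  rw [integral_mul_phi_add hs hσ, integral_div, mul_comm]
  have : ∀ u : ℝ, t + u - x = (t - x) + u := fun u => by ring
  simp_rw [this]
  have i1 : Integrable (fun u : ℝ => u) (gaussianReal ((x - t) * σ ^ 2 / (s + σ ^ 2))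
      (s * σ ^ 2 / (s + σ ^ 2)).toNNReal) := (memLp_id_gaussianReal 1).integrable le_rfl
  rw [integral_add (integrable_const _) i1, integral_id_gaussianReal]
  simp only [integral_const, probReal_univ, smul_eq_mul, one_mul]
  congr 1
  field_simp
  ring

/-- As for `φ₁`, with a quadratic polynomial: the second moment `v + m²` of the conditional normal
law enters as well. -/
lemma integral_phi₂_add {s σ : ℝ} (hs : 0 < s) (hσ : 0 < σ) (t x : ℝ) :
    ∫ u, phi₂ (t + u) x s ∂(gaussianReal 0 (σ ^ 2).toNNReal) = phi₂ t x (s + σ ^ 2) := by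
  have hS : 0 < s + σ ^ 2 := by positivity
  have hv : 0 < s * σ ^ 2 / (s + σ ^ 2) := by positivity
  simp only [phi₂]
  rw [integral_mul_phi_add hs hσ, mul_comm]
  set m := (x - t) * σ ^ 2 / (s + σ ^ 2) with hm
  set v := s * σ ^ 2 / (s + σ ^ 2) with hv'
  have i1 : Integrable (fun u : ℝ => u) (gaussianReal m v.toNNReal) :=
    (memLp_id_gaussianReal 1).integrable le_rfl
  have i2 : Integrable (fun u : ℝ => u ^ 2) (gaussianReal m v.toNNReal) :=
    (memLp_id_gaussianReal 2).integrable_sq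
  have h1 : ∫ u, u ∂(gaussianReal m v.toNNReal) = m := integral_id_gaussianReal
  have h2 : ∫ u, u ^ 2 ∂(gaussianReal m v.toNNReal) = v + m ^ 2 := by
    have := variance_eq_sub (memLp_id_gaussianReal (μ := m) (v := v.toNNReal) 2)
    rw [variance_id_gaussianReal, Real.coe_toNNReal _ hv.le] at this
    simp only [Pi.pow_apply, id] at this
    rw [h1] at this
    linarith
  have : ∀ u : ℝ, (t + u - x) ^ 2 / s ^ 2 - 1 / s =
      ((t - x) ^ 2 / s ^ 2 - 1 / s) + (2 * (t - x) / s ^ 2 * u + 1 / s ^ 2 * u ^ 2) :=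
    fun u => by ring
  simp_rw [this]
  have i3 : Integrable (fun u => 2 * (t - x) / s ^ 2 * u + 1 / s ^ 2 * u ^ 2)
      (gaussianReal m v.toNNReal) := (i1.const_mul _).add (i2.const_mul _)
  rw [integral_add (integrable_const _) i3, integral_add (i1.const_mul _) (i2.const_mul _), integral_const_mul, integral_const_mul, h1, h2]
  simp only [integral_const, probReal_univ, smul_eq_mul, one_mul]
  congr 1
  rw [hm, hv']
  field_simp
  ring

/-! ### The weights of the local linear fit -/

/-- Domination of the quadratic weight of the local linear fit. -/
lemma sq_mul_phi_le {s b : ℝ} (hb : 0 < b) (hs : b ^ 2 ≤ s) (z x : ℝ) :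
    b ^ 2 * (z - x) ^ 2 / s ^ 2 * phi z x s ≤ 6 * phi z x (s + b ^ 2) := by
  have hb2 : 0 < b ^ 2 := by positivity
  have hs0 : 0 < s := hb2.trans_le hs
  have hs' : 0 < s + b ^ 2 := by positivity
  -- `y` is the difference of the exponents at variances `s` and `s + b²`. The quadratic weight is
  -- at most `4y` because `s + b² ≤ 2s`, and `y e^{-y} ≤ 1` absorbs it.
  set y : ℝ := b ^ 2 * (z - x) ^ 2 / (2 * (s * (s + b ^ 2))) with hy
  have hy0 : 0 ≤ y := by positivity
  have e1 : phi z x s = √((s + b ^ 2) / s) * Real.exp (-y) * phi z x (s + b ^ 2) := by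
    rw [phi_eq hs0, phi_eq hs', Real.sqrt_div' _ hs0.le, Real.sqrt_mul (by positivity) s,
      Real.sqrt_mul (by positivity) (s + b ^ 2)]
    have h1 := (Real.sqrt_pos.2 hs').ne'
    have h2 := (Real.sqrt_pos.2 hs0).ne'
    have h3 : Real.exp (-(z - x) ^ 2 / (2 * s)) =
        Real.exp (-y) * Real.exp (-(z - x) ^ 2 / (2 * (s + b ^ 2))) := by
      rw [← Real.exp_add]
      congr 1
      rw [hy]
      field_simp
      ring
    rw [h3]
    field_simp
  have h2 : √((s + b ^ 2) / s) ≤ 3 / 2 := by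
    rw [Real.sqrt_le_left (by norm_num), div_le_iff₀ hs0]
    linarith
  have h3 : y * Real.exp (-y) ≤ 1 := by
    rw [Real.exp_neg, ← div_eq_mul_inv, div_le_one (Real.exp_pos _)]
    linarith [Real.add_one_le_exp y]
  have h4 : b ^ 2 * (z - x) ^ 2 / s ^ 2 ≤ 4 * y := by
    rw [hy, ← mul_div_assoc, div_le_div_iff₀ (by positivity) (by positivity)]
    have : 0 ≤ b ^ 2 * (z - x) ^ 2 * (s * (s - b ^ 2)) := by
      have : 0 ≤ s - b ^ 2 := by linarith
      positivity
    nlinarith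
  have hp := phi_nonneg z x (s + b ^ 2)
  calc b ^ 2 * (z - x) ^ 2 / s ^ 2 * phi z x s
      ≤ 4 * y * phi z x s := by gcongr; exact phi_nonneg _ _ _
    _ = 4 * (√((s + b ^ 2) / s) * (y * Real.exp (-y))) * phi z x (s + b ^ 2) := by rw [e1]; ring
    _ ≤ 4 * (3 / 2 * 1) * phi z x (s + b ^ 2) := by gcongr
    _ = _ := by ring

lemma phi_le_two_mul {s b : ℝ} (hb : 0 < b) (hs : b ^ 2 ≤ s) (z x : ℝ) :
    phi z x s ≤ 2 * phi z x (s + b ^ 2) := by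
  have hs0 : 0 < s := (by positivity : 0 < b ^ 2).trans_le hs
  refine (phi_le_phi_of_le hs0 (le_add_of_nonneg_right (sq_nonneg b)) z x).trans ?_
  refine mul_le_mul_of_nonneg_right ?_ (phi_nonneg _ _ _)
  rw [Real.sqrt_le_left (by norm_num), div_le_iff₀ hs0]
  linarith

/-- The constant does not depend on `b`, even in the degenerate case `s = b²` (that is, `λ = 0`).
This is why `φ₁` is always carried with a factor `h`. The `8` is `6 + 2`, from `a ≤ 1 + a²` and the
two preceding bounds. -/
lemma abs_mul_phi₁_le {s b : ℝ} (hb : 0 < b) (hs : b ^ 2 ≤ s) (z x : ℝ) :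
    |b * phi₁ z x s| ≤ 8 * phi z x (s + b ^ 2) := by
  have hs0 : 0 < s := (by positivity : 0 < b ^ 2).trans_le hs
  have h1 := sq_mul_phi_le hb hs z x
  have h2 := phi_le_two_mul hb hs z x
  have h3 := phi_nonneg z x s
  have e : b * phi₁ z x s = b * (z - x) / s * phi z x s := by rw [phi₁]; ring
  rw [e, abs_mul, abs_of_nonneg h3]
  have h4 : |b * (z - x) / s| ≤ 1 + b ^ 2 * (z - x) ^ 2 / s ^ 2 := by
    rw [← mul_pow, ← div_pow, ← sq_abs (b * (z - x) / s)]
    nlinarith [sq_nonneg (|b * (z - x) / s| - 1)]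
  nlinarith

lemma abs_phi_add_mul_phi₂_le {s b : ℝ} (hb : 0 < b) (hs : b ^ 2 ≤ s) (z x : ℝ) :
    |phi z x s + b ^ 2 * phi₂ z x s| ≤ 8 * phi z x (s + b ^ 2) := by
  have hs0 : 0 < s := (by positivity : 0 < b ^ 2).trans_le hs
  have h1 := sq_mul_phi_le hb hs z x
  have h2 := phi_le_two_mul hb hs z x
  have h3 := phi_nonneg z x s
  have e : phi z x s + b ^ 2 * phi₂ z x s =
      b ^ 2 * (z - x) ^ 2 / s ^ 2 * phi z x s + (1 - b ^ 2 / s) * phi z x s := by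
    rw [phi₂]; ring
  have h5 : b ^ 2 / s ≤ 1 := (div_le_one hs0).2 hs
  have h6 : 0 ≤ b ^ 2 / s := by positivity
  have h7 : 0 ≤ (1 - b ^ 2 / s) * phi z x s := mul_nonneg (by linarith) h3
  have h8 : (1 - b ^ 2 / s) * phi z x s ≤ 1 * phi z x s := by gcongr; linarith
  have h9 : 0 ≤ b ^ 2 * (z - x) ^ 2 / s ^ 2 * phi z x s := by positivity
  rw [e, abs_of_nonneg (by positivity)]
  linarith

/-! ### Gaussian smoothing of a weighted measure -/

/-- `∫ w(t) φ(t; y, s) dν(t)`. -/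
noncomputable def smooth (ν : Measure ℝ) (w : ℝ → ℝ) (y s : ℝ) : ℝ := ∫ t, w t * phi t y s ∂ν

/-- `∫ w(t) ∂_y φ(t; y, s) dν(t)`. -/
noncomputable def smooth₁ (ν : Measure ℝ) (w : ℝ → ℝ) (y s : ℝ) : ℝ := ∫ t, w t * phi₁ t y s ∂ν

/-- `∫ w(t) ∂_y² φ(t; y, s) dν(t)`. -/
noncomputable def smooth₂ (ν : Measure ℝ) (w : ℝ → ℝ) (y s : ℝ) : ℝ := ∫ t, w t * phi₂ t y s ∂ν

section smooth

variable {ν : Measure ℝ} {w : ℝ → ℝ} {x s s' : ℝ}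

/-- All smoothing integrands with parameters near `(x, s)` are dominated by one integrable
function. -/
lemma exists_smooth_bound (hi : Integrable (fun t => w t * phi t x s') ν)
    {s₁ s₂ : ℝ} (h₁ : 0 < s₁) (h₁₂ : s₁ ≤ s₂) (h₂ : s₂ < s') :
    ∃ F : ℝ → ℝ, Integrable F ν ∧ ∀ s, s₁ ≤ s → s ≤ s₂ → ∀ y, |y - x| ≤ 1 → ∀ t,
      |w t * phi t y s| ≤ F t ∧ |w t * phi₁ t y s| ≤ F t ∧ |w t * phi₂ t y s| ≤ F t := by
  obtain ⟨C, hC, h⟩ := exists_phi_bound h₁ h₁₂ h₂ x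
  set K := 1 + 1 / s₁ + 1 / s₁ ^ 2 with hK
  refine ⟨fun t => K * C * |w t * phi t x s'|, hi.abs.const_mul _, fun s hs1 hs2 y hy t => ?_⟩
  have hs := h₁.trans_le hs1
  have hb := h s hs1 hs2 y hy t
  have hp := phi_nonneg t y s
  have hp' := phi_nonneg t x s'
  have k1 : 1 / s ≤ 1 / s₁ := by gcongr
  have k2 : 1 / s ^ 2 ≤ 1 / s₁ ^ 2 := by gcongr
  have k3 : 0 ≤ 1 / s₁ := by positivity
  have k4 : 0 ≤ 1 / s₁ ^ 2 := by positivity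
  have key : ∀ (a c : ℝ), |a| ≤ c * ((1 + (t - y) ^ 2) * phi t y s) → c ≤ K →
      |w t * a| ≤ K * C * |w t * phi t x s'| := by
    intro a c h1 h2
    have h3 : |a| ≤ K * (C * phi t x s') := h1.trans (by
      have : 0 ≤ (1 + (t - y) ^ 2) * phi t y s := by positivity
      have hK0 : 0 ≤ K := by positivity
      exact mul_le_mul h2 hb this hK0)
    rw [abs_mul, abs_mul, abs_of_nonneg hp']
    calc |w t| * |a| ≤ |w t| * (K * (C * phi t x s')) := by gcongr
      _ = _ := by ring
  refine ⟨key _ 1 ?_ (by simp only [hK]; linarith),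
    key _ (1 / s) (abs_phi₁_le hs t y) (by simp only [hK]; linarith),
    key _ (1 / s ^ 2 + 1 / s) (abs_phi₂_le hs t y) (by simp only [hK]; linarith)⟩
  rw [abs_of_nonneg hp, one_mul]
  nlinarith [sq_nonneg (t - y)]

lemma integrable_smooth (hw : Measurable w) (hi : Integrable (fun t => w t * phi t x s') ν)
    (h₁ : 0 < s) (h₂ : s < s') {y : ℝ} (hy : |y - x| ≤ 1) :
    Integrable (fun t => w t * phi t y s) ν ∧ Integrable (fun t => w t * phi₁ t y s) ν ∧
      Integrable (fun t => w t * phi₂ t y s) ν := by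
  obtain ⟨F, hF, h⟩ := exists_smooth_bound hi h₁ le_rfl h₂
  have := h s le_rfl le_rfl y hy
  exact ⟨hF.mono' (by fun_prop) (ae_of_all _ fun t => (this t).1),
    hF.mono' (by fun_prop) (ae_of_all _ fun t => (this t).2.1),
    hF.mono' (by fun_prop) (ae_of_all _ fun t => (this t).2.2)⟩

/-- Integrability at one strictly larger variance `s'` suffices: it dominates the integrands for all
nearby variances, so the heat equation passes under the integral. -/
lemma hasDerivAt_smooth_var (hw : Measurable w) (hi : Integrable (fun t => w t * phi t x s') ν)
    (h₁ : 0 < s) (h₂ : s < s') :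
    HasDerivAt (fun s => smooth ν w x s) (smooth₂ ν w x s / 2) s := by
  obtain ⟨F, hF, h⟩ := exists_smooth_bound (s₁ := s / 2) (s₂ := (s + s') / 2) hi
    (by linarith) (by linarith) (by linarith)
  have hx : |x - x| ≤ 1 := by simp
  have := (hasDerivAt_integral_of_dominated_loc_of_deriv_le (μ := ν)
    (F := fun s t => w t * phi t x s) (F' := fun s t => w t * (phi₂ t x s / 2)) (x₀ := s)
    (s := Set.Ioo (s / 2) ((s + s') / 2)) (bound := F)
    (Ioo_mem_nhds (by linarith) (by linarith)) (Eventually.of_forall fun s => by fun_prop)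
    (integrable_smooth hw hi h₁ h₂ hx).1 (by fun_prop)
    (ae_of_all _ fun t s hs => ?_) hF (ae_of_all _ fun t s hs => ?_)).2
  · refine this.congr_deriv ?_
    rw [smooth₂, ← integral_div]
    congr with t
    ring
  · have := (h s hs.1.le hs.2.le x hx t).2.2
    rw [Real.norm_eq_abs, ← mul_div_assoc, abs_div, abs_two]
    linarith [abs_nonneg (w t * phi₂ t x s)]
  · exact (hasDerivAt_phi_var (by linarith [hs.1]) t x).const_mul (w t)

lemma continuousAt_phi₁_var (h₁ : 0 < s) (t x : ℝ) : ContinuousAt (fun s => phi₁ t x s) s := by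
  unfold phi₁
  exact (continuousAt_const.div continuousAt_id h₁.ne').mul (hasDerivAt_phi_var h₁ t x).continuousAt

lemma continuousAt_phi₂_var (h₁ : 0 < s) (t x : ℝ) : ContinuousAt (fun s => phi₂ t x s) s := by
  unfold phi₂
  exact ((continuousAt_const.div (continuousAt_id.pow 2) (pow_ne_zero 2 h₁.ne')).sub
    (continuousAt_const.div continuousAt_id h₁.ne')).mul
      (hasDerivAt_phi_var h₁ t x).continuousAt

lemma continuousAt_smooth₁_var (hw : Measurable w)
    (hi : Integrable (fun t => w t * phi t x s') ν) (h₁ : 0 < s) (h₂ : s < s') :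
    ContinuousAt (fun s => smooth₁ ν w x s) s := by
  obtain ⟨F, hF, h⟩ := exists_smooth_bound (s₁ := s / 2) (s₂ := (s + s') / 2) hi
    (by linarith) (by linarith) (by linarith)
  refine tendsto_integral_filter_of_dominated_convergence F
    (Eventually.of_forall fun s => by fun_prop) ?_ hF
    (ae_of_all _ fun t => tendsto_const_nhds.mul (continuousAt_phi₁_var h₁ t x))
  filter_upwards [Ioo_mem_nhds (by linarith : s / 2 < s) (by linarith : s < (s + s') / 2)]
    with u hu
  exact ae_of_all _ fun t => (h u hu.1.le hu.2.le x (by simp) t).2.1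

lemma continuousAt_smooth₂_var (hw : Measurable w)
    (hi : Integrable (fun t => w t * phi t x s') ν) (h₁ : 0 < s) (h₂ : s < s') :
    ContinuousAt (fun s => smooth₂ ν w x s) s := by
  obtain ⟨F, hF, h⟩ := exists_smooth_bound (s₁ := s / 2) (s₂ := (s + s') / 2) hi
    (by linarith) (by linarith) (by linarith)
  refine tendsto_integral_filter_of_dominated_convergence F
    (Eventually.of_forall fun s => by fun_prop) ?_ hF
    (ae_of_all _ fun t => tendsto_const_nhds.mul (continuousAt_phi₂_var h₁ t x))
  filter_upwards [Ioo_mem_nhds (by linarith : s / 2 < s) (by linarith : s < (s + s') / 2)]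
    with u hu
  exact ae_of_all _ fun t => (h u hu.1.le hu.2.le x (by simp) t).2.2

lemma hasDerivAt_smooth_mean (hw : Measurable w) (hi : Integrable (fun t => w t * phi t x s') ν)
    (h₁ : 0 < s) (h₂ : s < s') {y : ℝ} (hy : |y - x| < 1) :
    HasDerivAt (fun y => smooth ν w y s) (smooth₁ ν w y s) y := by
  obtain ⟨F, hF, h⟩ := exists_smooth_bound hi h₁ le_rfl h₂
  refine (hasDerivAt_integral_of_dominated_loc_of_deriv_le (μ := ν)
    (F := fun y t => w t * phi t y s) (F' := fun y t => w t * phi₁ t y s) (x₀ := y)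
    (s := Metric.ball x 1) (bound := F)
    (Metric.isOpen_ball.mem_nhds hy) (Eventually.of_forall fun s => by fun_prop)
    (integrable_smooth hw hi h₁ h₂ hy.le).1 (by fun_prop)
    (ae_of_all _ fun t y hy => ?_) hF (ae_of_all _ fun t y hy => ?_)).2
  · exact (h s le_rfl le_rfl y (le_of_lt hy) t).2.1
  · exact (hasDerivAt_phi_mean h₁ t y).const_mul (w t)

lemma hasDerivAt_smooth₁_mean (hw : Measurable w) (hi : Integrable (fun t => w t * phi t x s') ν)
    (h₁ : 0 < s) (h₂ : s < s') :
    HasDerivAt (fun y => smooth₁ ν w y s) (smooth₂ ν w x s) x := by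
  obtain ⟨F, hF, h⟩ := exists_smooth_bound hi h₁ le_rfl h₂
  refine (hasDerivAt_integral_of_dominated_loc_of_deriv_le (μ := ν)
    (F := fun y t => w t * phi₁ t y s) (F' := fun y t => w t * phi₂ t y s) (x₀ := x)
    (s := Metric.ball x 1) (bound := F)
    (Metric.ball_mem_nhds x one_pos) (Eventually.of_forall fun s => by fun_prop)
    (integrable_smooth hw hi h₁ h₂ (by simp)).2.1 (by fun_prop)
    (ae_of_all _ fun t y hy => ?_) hF (ae_of_all _ fun t y hy => ?_)).2
  · exact (h s le_rfl le_rfl y (le_of_lt hy) t).2.2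
  · exact (hasDerivAt_phi₁_mean h₁ t y).const_mul (w t)

lemma iteratedDeriv_two_smooth (hw : Measurable w)
    (hi : Integrable (fun t => w t * phi t x s') ν) (h₁ : 0 < s) (h₂ : s < s') :
    iteratedDeriv 2 (fun y => smooth ν w y s) x = smooth₂ ν w x s := by
  rw [iteratedDeriv_succ, iteratedDeriv_one]
  refine (hasDerivAt_smooth₁_mean hw hi h₁ h₂).deriv.symm ▸ Filter.EventuallyEq.deriv_eq ?_
  filter_upwards [Metric.ball_mem_nhds x one_pos] with y hy
  exact (hasDerivAt_smooth_mean hw hi h₁ h₂ hy).deriv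

/-- Without weight every smoothing integral with respect to a finite measure exists. -/
lemma integrable_one_mul_phi [IsFiniteMeasure ν] (h : 0 < s) (y : ℝ) :
    Integrable (fun t => (1 : ℝ) * phi t y s) ν := by
  refine Integrable.of_bound (by fun_prop) (√(2 * Real.pi * s))⁻¹ (ae_of_all _ fun t => ?_)
  rw [one_mul, Real.norm_eq_abs, abs_of_nonneg (phi_nonneg _ _ _)]
  exact phi_le h t y

/-- Supplies `f_{0,λ}(x) > 0`, hence every nonzero denominator, without any positivity of `f_X` at
`x`. -/
lemma smooth_one_pos [IsProbabilityMeasure ν] (h : 0 < s) (y : ℝ) :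
    0 < smooth ν (fun _ => 1) y s := by
  refine (integral_pos_iff_support_of_nonneg (fun t => ?_) (integrable_one_mul_phi h y)).2 ?_
  · simpa using phi_nonneg t y s
  · have : Function.support (fun t => (1 : ℝ) * phi t y s) = Set.univ := by
      ext t; simpa using (phi_pos h t y).ne'
    rw [this]
    simp

end smooth

/-! ### Moments in the model -/

section model

variable {Ω : Type*} [MeasurableSpace Ω] {P : Measure Ω} [IsProbabilityMeasure P]
  {X U ε : ℕ → Ω → ℝ} {fX g τsq μ₃ : ℝ → ℝ} {σ : ℝ}

lemma Model.map_prod (m : Model P X U ε fX τsq μ₃ σ) :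
    P.map (fun ω => ((X 0 ω, ε 0 ω), U 0 ω)) =
      (P.map (fun ω => (X 0 ω, ε 0 ω))).prod (gaussianReal 0 (σ ^ 2).toNNReal) := by
  have h := (indepFun_iff_map_prod_eq_prod_map_map
    ((m.measurable_X 0).prodMk (m.measurable_ε 0)).aemeasurable
    (m.measurable_U 0).aemeasurable).1 m.indep_U.symm
  rw [h, m.law_U]

lemma Model.lintegral_error (m : Model P X U ε fX τsq μ₃ σ) {F : (ℝ × ℝ) × ℝ → ENNReal}
    (hF : Measurable F) :
    ∫⁻ ω, F ((X 0 ω, ε 0 ω), U 0 ω) ∂P =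
      ∫⁻ ω, ∫⁻ u, F ((X 0 ω, ε 0 ω), u) ∂(gaussianReal 0 (σ ^ 2).toNNReal) ∂P := by
  have hm := (m.measurable_X 0).prodMk (m.measurable_ε 0)
  rw [← lintegral_map (g := fun ω => ((X 0 ω, ε 0 ω), U 0 ω)) hF (hm.prodMk (m.measurable_U 0)),
    m.map_prod, lintegral_prod _ hF.aemeasurable,
    lintegral_map hF.lintegral_prod_right' hm]

lemma Model.integral_error (m : Model P X U ε fX τsq μ₃ σ) {F : (ℝ × ℝ) × ℝ → ℝ}
    (hF : Measurable F) (hi : Integrable (fun ω => F ((X 0 ω, ε 0 ω), U 0 ω)) P) :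
    Integrable (fun ω => ∫ u, F ((X 0 ω, ε 0 ω), u) ∂(gaussianReal 0 (σ ^ 2).toNNReal)) P ∧
    ∫ ω, F ((X 0 ω, ε 0 ω), U 0 ω) ∂P =
      ∫ ω, ∫ u, F ((X 0 ω, ε 0 ω), u) ∂(gaussianReal 0 (σ ^ 2).toNNReal) ∂P := by
  have hm := (m.measurable_X 0).prodMk (m.measurable_ε 0)
  have hm' := hm.prodMk (m.measurable_U 0)
  have hi' : Integrable F ((P.map (fun ω => (X 0 ω, ε 0 ω))).prod
      (gaussianReal 0 (σ ^ 2).toNNReal)) := by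
    rw [← m.map_prod]
    exact (integrable_map_measure hF.aestronglyMeasurable hm'.aemeasurable).2 hi
  refine ⟨?_, ?_⟩
  · have := hi'.integral_prod_left
    exact (integrable_map_measure this.aestronglyMeasurable hm.aemeasurable).1 this
  · rw [← integral_map (φ := fun ω => ((X 0 ω, ε 0 ω), U 0 ω)) hm'.aemeasurable
      hF.aestronglyMeasurable, m.map_prod, integral_prod _ hi',
      integral_map hm.aemeasurable hi'.integral_prod_left.aestronglyMeasurable]

/-- Disintegration of the joint law of `(X, ε)` along `X`; this is how the conditional moments of
the model enter unconditional expectations. -/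
lemma Model.lintegral_cond (m : Model P X U ε fX τsq μ₃ σ) {F : ℝ × ℝ → ENNReal}
    (hF : Measurable F) :
    ∫⁻ ω, F (X 0 ω, ε 0 ω) ∂P =
      ∫⁻ t, ∫⁻ e, F (t, e) ∂(condDistrib (ε 0) (X 0) P t) ∂(P.map (X 0)) := by
  have hm := (m.measurable_X 0).prodMk (m.measurable_ε 0)
  rw [← lintegral_map (g := fun ω => (X 0 ω, ε 0 ω)) hF hm,
    ← compProd_map_condDistrib (m.measurable_ε 0).aemeasurable,
    Measure.lintegral_compProd hF]

lemma Model.integral_cond (m : Model P X U ε fX τsq μ₃ σ) {F : ℝ × ℝ → ℝ}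
    (hF : Measurable F) (hi : Integrable (fun ω => F (X 0 ω, ε 0 ω)) P) :
    Integrable (fun t => ∫ e, F (t, e) ∂(condDistrib (ε 0) (X 0) P t)) (P.map (X 0)) ∧
    ∫ ω, F (X 0 ω, ε 0 ω) ∂P =
      ∫ t, ∫ e, F (t, e) ∂(condDistrib (ε 0) (X 0) P t) ∂(P.map (X 0)) := by
  have hm := (m.measurable_X 0).prodMk (m.measurable_ε 0)
  have hi' : Integrable F ((P.map (X 0)) ⊗ₘ (condDistrib (ε 0) (X 0) P)) := by
    rw [compProd_map_condDistrib (m.measurable_ε 0).aemeasurable]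
    exact (integrable_map_measure hF.aestronglyMeasurable hm.aemeasurable).2 hi
  refine ⟨?_, ?_⟩
  · have h1 := hi'
    rw [Measure.compProd] at h1
    exact h1.integral_compProd
  rw [← integral_map (φ := fun ω => (X 0 ω, ε 0 ω)) hm.aemeasurable hF.aestronglyMeasurable,
    ← compProd_map_condDistrib (m.measurable_ε 0).aemeasurable, Measure.integral_compProd hi']

/-- The conditional moments of the response given `X = t`. -/
lemma Model.response_moments (m : Model P X U ε fX τsq μ₃ σ) (g : ℝ → ℝ) :
    ∀ᵐ t ∂(P.map (X 0)),
      ∫ e, (g t + e) ∂(condDistrib (ε 0) (X 0) P t) = g t ∧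
      ∫⁻ e, ENNReal.ofReal ((g t + e) ^ 2) ∂(condDistrib (ε 0) (X 0) P t) =
        ENNReal.ofReal (g t ^ 2 + τsq t) ∧
      ∫⁻ e, ENNReal.ofReal (|g t + e| ^ 3) ∂(condDistrib (ε 0) (X 0) P t) ≤
        ENNReal.ofReal (4 * (|g t| ^ 3 + μ₃ t)) ∧ 0 < τsq t ∧ 0 ≤ μ₃ t := by
  filter_upwards [m.error] with t ⟨h3, hm1, hm2, hm3, hpos⟩
  set κ := condDistrib (ε 0) (X 0) P t
  have i0 : Integrable (fun e : ℝ => 1 + |e| ^ 3) κ := (integrable_const _).add h3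
  have i1 : Integrable (fun e : ℝ => e) κ := i0.mono' (by fun_prop) (ae_of_all _ fun e => by
    rw [Real.norm_eq_abs]
    have := abs_nonneg e
    nlinarith [sq_nonneg (|e| - 1), mul_nonneg this (sq_nonneg (|e| - 1))])
  have i2 : Integrable (fun e : ℝ => e ^ 2) κ := i0.mono' (by fun_prop) (ae_of_all _ fun e => by
    rw [Real.norm_eq_abs, abs_pow]
    have := abs_nonneg e
    nlinarith [sq_nonneg (|e| - 1), mul_nonneg this (sq_nonneg (|e| - 1))])
  have i3 : Integrable (fun e : ℝ => 2 * g t * e) κ := i1.const_mul _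
  have e2 : ∀ e : ℝ, (g t + e) ^ 2 = g t ^ 2 + (2 * g t * e + e ^ 2) := fun e => by ring
  have i4 : Integrable (fun e : ℝ => 2 * g t * e + e ^ 2) κ := i3.add i2
  refine ⟨?_, ?_, ?_, hpos, ?_⟩
  · rw [integral_add (integrable_const _) i1, hm1]; simp
  · simp_rw [e2]
    have i5 : Integrable (fun e : ℝ => g t ^ 2 + (2 * g t * e + e ^ 2)) κ :=
      (integrable_const _).add i4
    rw [← ofReal_integral_eq_lintegral_ofReal i5
      (ae_of_all _ fun e => by simp only [Pi.zero_apply]; rw [← e2]; positivity)]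
    congr 1
    rw [integral_add (integrable_const _) i4, integral_add i3 i2, integral_const_mul, hm1, hm2]
    simp
  · have i5 : Integrable (fun e : ℝ => 4 * (|g t| ^ 3 + |e| ^ 3)) κ :=
      ((integrable_const _).add h3).const_mul _
    calc ∫⁻ e, ENNReal.ofReal (|g t + e| ^ 3) ∂κ
        ≤ ∫⁻ e, ENNReal.ofReal (4 * (|g t| ^ 3 + |e| ^ 3)) ∂κ := by
          refine lintegral_mono fun e => ENNReal.ofReal_le_ofReal ?_
          have h1 : |g t + e| ^ 3 ≤ (|g t| + |e|) ^ 3 := by gcongr; exact abs_add_le _ _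
          have h2 := abs_nonneg (g t)
          have h3 := abs_nonneg e
          nlinarith [mul_nonneg (add_nonneg h2 h3) (sq_nonneg (|g t| - |e|))]
      _ = _ := by
          rw [← ofReal_integral_eq_lintegral_ofReal i5
            (ae_of_all _ fun e => by simp only [Pi.zero_apply]; positivity),
            integral_const_mul, integral_add (integrable_const _) h3, hm3]
          simp
  · rw [← hm3]; exact integral_nonneg fun e => by positivity

/-- Integration against a function of `Z` alone. -/
lemma Model.integral_Z (m : Model P X U ε fX τsq μ₃ σ) {p : ℝ → ℝ} (hp : Measurable p)
    (hi : Integrable (fun ω => p (X 0 ω + U 0 ω)) P) :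
    ∫ ω, p (X 0 ω + U 0 ω) ∂P =
      ∫ t, ∫ u, p (t + u) ∂(gaussianReal 0 (σ ^ 2).toNNReal) ∂(P.map (X 0)) := by
  rw [(m.integral_error (F := fun q => p (q.1.1 + q.2)) (by fun_prop) hi).2]
  rw [integral_map (m.measurable_X 0).aemeasurable]
  exact (Measurable.stronglyMeasurable (by fun_prop :
    Measurable fun q : ℝ × ℝ => p (q.1 + q.2))).integral_prod_right.aestronglyMeasurable

/-- First moment of the response against a function of `Z`: the regression error drops out. -/
lemma Model.integral_Y_mul (m : Model P X U ε fX τsq μ₃ σ) (hg : Measurable g) {p : ℝ → ℝ}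
    (hp : Measurable p)
    (hi : Integrable (fun ω => (g (X 0 ω) + ε 0 ω) * p (X 0 ω + U 0 ω)) P) :
    Integrable (fun t => g t * ∫ u, p (t + u) ∂(gaussianReal 0 (σ ^ 2).toNNReal)) (P.map (X 0)) ∧
    ∫ ω, (g (X 0 ω) + ε 0 ω) * p (X 0 ω + U 0 ω) ∂P =
      ∫ t, g t * ∫ u, p (t + u) ∂(gaussianReal 0 (σ ^ 2).toNNReal) ∂(P.map (X 0)) := by
  have hp' : Measurable fun t => ∫ u, p (t + u) ∂(gaussianReal 0 (σ ^ 2).toNNReal) :=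
    (Measurable.stronglyMeasurable (by fun_prop :
      Measurable fun q : ℝ × ℝ => p (q.1 + q.2))).integral_prod_right.measurable
  obtain ⟨h1, h2⟩ := m.integral_error
    (F := fun q => (g q.1.1 + q.1.2) * p (q.1.1 + q.2)) (by fun_prop) hi
  simp only [integral_const_mul] at h1 h2
  obtain ⟨h3, h4⟩ := m.integral_cond (F := fun q => (g q.1 + q.2) *
    ∫ u, p (q.1 + u) ∂(gaussianReal 0 (σ ^ 2).toNNReal))
    ((by fun_prop : Measurable fun q : ℝ × ℝ => g q.1 + q.2).mul (hp'.comp measurable_fst)) h1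
  have key : (fun t => ∫ e, (g t + e) * ∫ u, p (t + u) ∂(gaussianReal 0 (σ ^ 2).toNNReal)
      ∂(condDistrib (ε 0) (X 0) P t)) =ᵐ[P.map (X 0)]
      fun t => g t * ∫ u, p (t + u) ∂(gaussianReal 0 (σ ^ 2).toNNReal) := by
    filter_upwards [m.response_moments g] with t ht
    rw [integral_mul_const, ht.1]
  exact ⟨h3.congr key, by rw [h2, h4, integral_congr_ae key]⟩

lemma lintegral_phi_add {s : ℝ} (hs : 0 < s) (hσ : 0 < σ) (t x : ℝ) :
    ∫⁻ u, ENNReal.ofReal (phi (t + u) x s) ∂(gaussianReal 0 (σ ^ 2).toNNReal) =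
      ENNReal.ofReal (phi t x (s + σ ^ 2)) := by
  rw [← integral_phi_add hs hσ, ofReal_integral_eq_lintegral_ofReal]
  · refine Integrable.of_bound (Measurable.aestronglyMeasurable (by fun_prop))
      (√(2 * Real.pi * s))⁻¹ (ae_of_all _ fun u => ?_)
    rw [Real.norm_eq_abs, abs_of_nonneg (phi_nonneg _ _ _)]
    exact phi_le hs _ _
  · exact ae_of_all _ fun u => phi_nonneg _ _ _

/-- Fubini in `U`, then disintegration in `ε`. Working in `[0, ∞]` needs no prior moment of `Y`, so
finiteness can be transferred in both directions. -/
lemma Model.lintegral_phi (m : Model P X U ε fX τsq μ₃ σ) (hσ : 0 < σ)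
    {H : ℝ × ℝ → ENNReal} (hH : Measurable H) {s : ℝ} (hs : 0 < s) (x : ℝ) :
    ∫⁻ ω, H (X 0 ω, ε 0 ω) * ENNReal.ofReal (phi (X 0 ω + U 0 ω) x s) ∂P =
      ∫⁻ t, (∫⁻ e, H (t, e) ∂(condDistrib (ε 0) (X 0) P t)) *
        ENNReal.ofReal (phi t x (s + σ ^ 2)) ∂(P.map (X 0)) := by
  rw [m.lintegral_error (F := fun q => H q.1 * ENNReal.ofReal (phi (q.1.1 + q.2) x s))
    (by fun_prop)]
  have h1 : ∀ ω, ∫⁻ u, H (X 0 ω, ε 0 ω) * ENNReal.ofReal (phi (X 0 ω + u) x s)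
      ∂(gaussianReal 0 (σ ^ 2).toNNReal) =
      H (X 0 ω, ε 0 ω) * ENNReal.ofReal (phi (X 0 ω) x (s + σ ^ 2)) := fun ω => by
    rw [lintegral_const_mul _ (by fun_prop), lintegral_phi_add hs hσ]
  simp_rw [h1]
  rw [m.lintegral_cond (F := fun q => H q * ENNReal.ofReal (phi q.1 x (s + σ ^ 2)))
    (by fun_prop)]
  refine lintegral_congr fun t => ?_
  dsimp only
  exact lintegral_mul_const _ (f := fun e => H (t, e)) (by fun_prop)

/-- Second moment of the response against a normal density at `Z`. -/
lemma Model.lintegral_Y_sq (m : Model P X U ε fX τsq μ₃ σ) (hσ : 0 < σ) (hg : Measurable g)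
    {s : ℝ} (hs : 0 < s) (x : ℝ) :
    ∫⁻ ω, ENNReal.ofReal ((g (X 0 ω) + ε 0 ω) ^ 2 * phi (X 0 ω + U 0 ω) x s) ∂P =
      ∫⁻ t, ENNReal.ofReal ((g t ^ 2 + τsq t) * phi t x (s + σ ^ 2)) ∂(P.map (X 0)) := by
  simp_rw [fun ω => ENNReal.ofReal_mul (q := phi (X 0 ω + U 0 ω) x s)
    (sq_nonneg (g (X 0 ω) + ε 0 ω))]
  rw [m.lintegral_phi hσ (H := fun q => ENNReal.ofReal ((g q.1 + q.2) ^ 2)) (by fun_prop) hs]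
  refine lintegral_congr_ae ?_
  filter_upwards [m.response_moments g] with t ht
  rw [ht.2.1, ENNReal.ofReal_mul (add_nonneg (sq_nonneg _) ht.2.2.2.1.le)]

lemma Model.ae_τsq_nonneg (m : Model P X U ε fX τsq μ₃ σ) : ∀ᵐ t ∂(P.map (X 0)), 0 ≤ τsq t := by
  filter_upwards [m.error] with t ht using ht.2.2.2.2.le

lemma Model.ae_moment_nonneg (m : Model P X U ε fX τsq μ₃ σ) (x s : ℝ) :
    ∀ᵐ t ∂(P.map (X 0)), 0 ≤ (g t ^ 2 + τsq t) * phi t x s := by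
  filter_upwards [m.ae_τsq_nonneg] with t ht
  exact mul_nonneg (by positivity) (phi_nonneg _ _ _)

lemma Model.measurable_Y (m : Model P X U ε fX τsq μ₃ σ) (hg : Measurable g) (i : ℕ) :
    Measurable fun ω => g (X i ω) + ε i ω :=
  (hg.comp (m.measurable_X i)).add (m.measurable_ε i)

lemma Model.measurable_Z (m : Model P X U ε fX τsq μ₃ σ) (i : ℕ) :
    Measurable fun ω => X i ω + U i ω :=
  (m.measurable_X i).add (m.measurable_U i)

lemma Model.integrable_Y_sq_iff (m : Model P X U ε fX τsq μ₃ σ) (hσ : 0 < σ) (hg : Measurable g)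
    (hτ : Measurable τsq) {s : ℝ} (hs : 0 < s) (x : ℝ) :
    Integrable (fun ω => (g (X 0 ω) + ε 0 ω) ^ 2 * phi (X 0 ω + U 0 ω) x s) P ↔
      Integrable (fun t => (g t ^ 2 + τsq t) * phi t x (s + σ ^ 2)) (P.map (X 0)) := by
  have h1 := m.measurable_Y hg 0
  have h2 := m.measurable_Z 0
  have h3 : Measurable fun ω => (g (X 0 ω) + ε 0 ω) ^ 2 * phi (X 0 ω + U 0 ω) x s :=
    (h1.pow_const 2).mul ((measurable_phi_left x s).comp h2)
  have h4 : Measurable fun t => (g t ^ 2 + τsq t) * phi t x (s + σ ^ 2) := by fun_prop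
  rw [← lintegral_ofReal_ne_top_iff_integrable h3.aestronglyMeasurable
      (ae_of_all _ fun ω => mul_nonneg (sq_nonneg _) (phi_nonneg _ _ _)),
    ← lintegral_ofReal_ne_top_iff_integrable h4.aestronglyMeasurable (m.ae_moment_nonneg x _),
    m.lintegral_Y_sq hσ hg hs]

lemma Model.integral_Y_sq (m : Model P X U ε fX τsq μ₃ σ) (hσ : 0 < σ) (hg : Measurable g)
    (hτ : Measurable τsq) {s : ℝ} (hs : 0 < s) (x : ℝ) :
    ∫ ω, (g (X 0 ω) + ε 0 ω) ^ 2 * phi (X 0 ω + U 0 ω) x s ∂P =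
      smooth (P.map (X 0)) (fun t => g t ^ 2 + τsq t) x (s + σ ^ 2) := by
  have h1 := m.measurable_Y hg 0
  have h2 := m.measurable_Z 0
  have h3 : Measurable fun ω => (g (X 0 ω) + ε 0 ω) ^ 2 * phi (X 0 ω + U 0 ω) x s :=
    (h1.pow_const 2).mul ((measurable_phi_left x s).comp h2)
  have h4 : Measurable fun t => (g t ^ 2 + τsq t) * phi t x (s + σ ^ 2) := by fun_prop
  rw [smooth, integral_eq_lintegral_of_nonneg_ae
      (ae_of_all _ fun ω => mul_nonneg (sq_nonneg _) (phi_nonneg _ _ _)) h3.aestronglyMeasurable,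
    integral_eq_lintegral_of_nonneg_ae (m.ae_moment_nonneg x _) h4.aestronglyMeasurable,
    m.lintegral_Y_sq hσ hg hs]

/-- Third absolute moment of the response against a normal density at `Z`. -/
lemma Model.lintegral_Y_cube_le (m : Model P X U ε fX τsq μ₃ σ) (hσ : 0 < σ) (hg : Measurable g)
    {s : ℝ} (hs : 0 < s) (x : ℝ) :
    ∫⁻ ω, ENNReal.ofReal (|g (X 0 ω) + ε 0 ω| ^ 3 * phi (X 0 ω + U 0 ω) x s) ∂P ≤
      ∫⁻ t, ENNReal.ofReal (4 * (|g t| ^ 3 + μ₃ t) * phi t x (s + σ ^ 2)) ∂(P.map (X 0)) := by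
  simp_rw [fun ω => ENNReal.ofReal_mul (q := phi (X 0 ω + U 0 ω) x s)
    (by positivity : 0 ≤ |g (X 0 ω) + ε 0 ω| ^ 3)]
  rw [m.lintegral_phi hσ (H := fun q => ENNReal.ofReal (|g q.1 + q.2| ^ 3)) (by fun_prop) hs]
  refine lintegral_mono_ae ?_
  filter_upwards [m.response_moments g] with t ht
  have := ht.2.2.2.2
  rw [ENNReal.ofReal_mul (by positivity)]
  gcongr
  exact ht.2.2.1

/-! ### Expectations of the weighted responses -/

lemma Model.integrable_of_abs_le (m : Model P X U ε fX τsq μ₃ σ) {p : ℝ → ℝ} (hp : Measurable p)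
    {C : ℝ} (hC : ∀ z, |p z| ≤ C) : Integrable (fun ω => p (X 0 ω + U 0 ω)) P :=
  Integrable.of_bound (hp.comp (m.measurable_Z 0)).aestronglyMeasurable C
    (ae_of_all _ fun _ => hC _)

end model

/-! ### Growth of functions with square integrable derivative -/

/-- A function whose derivative is square integrable for a normal law of variance `σ²` grows at
most like `(1 + |w|) exp(w² / (4σ²))`. -/
lemma exists_growth_bound {η : ℝ → ℝ} {σ y : ℝ} (hσ : 0 < σ) (hη : ContDiff ℝ 1 η)
    (hL : MemLp (fun t => deriv η (t + y)) 2 (gaussianReal 0 (σ ^ 2).toNNReal)) :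
    ∃ C, 0 ≤ C ∧ ∀ t, |η t| ≤ C * ((1 + |t - y|) * Real.exp ((t - y) ^ 2 / (4 * σ ^ 2))) := by
  have hσ2 : 0 < σ ^ 2 := by positivity
  have hd : Differentiable ℝ η := hη.differentiable one_ne_zero
  have hc : Continuous (deriv η) := hη.continuous_deriv le_rfl
  set v : ℝ → ℝ := fun r => deriv η (r + y) with hv
  have hvc : Continuous v := hc.comp (continuous_add_const y)
  have hvi : Integrable (fun r => v r ^ 2 * phi r 0 (σ ^ 2)) := by
    have h1 := hL.integrable_sq
    rw [gaussianReal_of_var_ne_zero _ (by simpa using hσ.ne'),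
      integrable_withDensity_iff (by fun_prop) (ae_of_all _ fun _ => gaussianPDF_lt_top)] at h1
    simp only [toReal_gaussianPDF] at h1
    exact h1
  set K := ∫ r, v r ^ 2 * phi r 0 (σ ^ 2) with hK
  have hK0 : 0 ≤ K := integral_nonneg fun r => mul_nonneg (sq_nonneg _) (phi_nonneg _ _ _)
  set N := √(2 * Real.pi * σ ^ 2) with hN
  have hN0 : 0 < N := Real.sqrt_pos.2 (by positivity)
  refine ⟨|η y| + K + N, by positivity, fun t => ?_⟩
  set w := t - y with hw
  set c := Real.exp (w ^ 2 / (4 * σ ^ 2)) with hcdef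
  have hc1 : 1 ≤ c := Real.one_le_exp (by positivity)
  have hftc : η t - η y = ∫ r in (0 : ℝ)..w, v r := by
    have := intervalIntegral.integral_deriv_eq_sub' (a := y) (b := t) η rfl
      (fun r _ => hd r) hc.continuousOn
    rw [← this, hv, intervalIntegral.integral_comp_add_right (fun r => deriv η r), hw]
    simp
  have hbound : |η t - η y| ≤ c * (K + N * |w|) := by
    rw [hftc]
    have hi2 : IntegrableOn (fun r => c * (v r ^ 2 * phi r 0 (σ ^ 2)) + c * N) (Set.uIoc 0 w) :=
      ((hvi.const_mul c).integrableOn).add (integrableOn_const (by simp [Set.uIoc]))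
    have h1 : |∫ r in (0 : ℝ)..w, v r| ≤ ∫ r in Set.uIoc 0 w, |v r| := by
      simpa using intervalIntegral.norm_integral_le_integral_norm_uIoc (f := v) (a := 0) (b := w)
        (μ := volume)
    have h2 : ∫ r in Set.uIoc 0 w, |v r| ≤
        ∫ r in Set.uIoc 0 w, (c * (v r ^ 2 * phi r 0 (σ ^ 2)) + c * N) := by
      refine setIntegral_mono_on ?_ hi2 measurableSet_uIoc fun r hr => ?_
      · exact ((hvc.abs).intervalIntegrable 0 w).def'
      · have hr' : r ^ 2 ≤ w ^ 2 := by
          rw [Set.mem_uIoc] at hr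
          rcases hr with h | h <;> nlinarith
        -- For `|r| ≤ |w|` the density at `r` is at least its value `N⁻¹ c⁻²` at `w`.
        have hp : N⁻¹ ≤ c ^ 2 * phi r 0 (σ ^ 2) := by
          rw [phi_eq hσ2, ← hN, mul_comm, mul_assoc]
          refine le_mul_of_one_le_right (by positivity) ?_
          rw [hcdef, ← Real.exp_nat_mul, ← Real.exp_add]
          refine Real.one_le_exp ?_
          have : (2 : ℕ) * (w ^ 2 / (4 * σ ^ 2)) = w ^ 2 / (2 * σ ^ 2) := by
            push_cast; field_simp; ring
          rw [this, sub_zero, neg_div, ← sub_eq_neg_add, ← sub_div]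
          have : 0 ≤ w ^ 2 - r ^ 2 := by linarith
          positivity
        have hpc : 1 ≤ N * c ^ 2 * phi r 0 (σ ^ 2) := by
          have := mul_le_mul_of_nonneg_left hp hN0.le
          rwa [mul_inv_cancel₀ hN0.ne', ← mul_assoc] at this
        have hp0 := phi_nonneg r 0 (σ ^ 2)
        set p := phi r 0 (σ ^ 2)
        have h3 : |v r| * 1 ≤ |v r| * (N * c ^ 2 * p) := by gcongr
        -- A pointwise substitute for Cauchy–Schwarz: either `|v| ≤ cN`, or `|v| ≤ |v| N c² p ≤ c v²
        -- p`. In both cases the sum of the two bounds dominates, and it has an integral controlled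
        -- by `K` and `|w|`.
        by_cases h4 : |v r| ≤ c * N
        · have : 0 ≤ c * (v r ^ 2 * p) := by positivity
          linarith
        · have h5 : c * N ≤ |v r| := (not_le.1 h4).le
          have h6 : |v r| * (N * c ^ 2 * p) ≤ c * (v r ^ 2 * p) := by
            rw [← sq_abs (v r)]
            have : |v r| * (c * N) * (c * p) ≤ |v r| * |v r| * (c * p) := by gcongr
            linarith
          have : 0 ≤ c * N := by positivity
          linarith
    have h3 : ∫ r in Set.uIoc 0 w, (c * (v r ^ 2 * phi r 0 (σ ^ 2)) + c * N) ≤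
        c * (K + N * |w|) := by
      rw [integral_add (hvi.const_mul c).integrableOn (integrableOn_const (by simp [Set.uIoc])),
        integral_const_mul]
      have h4 : ∫ r in Set.uIoc 0 w, v r ^ 2 * phi r 0 (σ ^ 2) ≤ K :=
        setIntegral_le_integral hvi
          (ae_of_all _ fun r => mul_nonneg (sq_nonneg _) (phi_nonneg _ _ _))
      have h5 : ∫ _ in Set.uIoc 0 w, c * N = |w| * (c * N) := by
        rw [setIntegral_const, Set.uIoc, Real.volume_real_Ioc, smul_eq_mul, max_sub_min_eq_abs,
          sub_zero, max_eq_left (abs_nonneg _)]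
      rw [h5]
      nlinarith
    linarith
  have h0 : |η t| ≤ |η y| + |η t - η y| := by
    have := abs_add_le (η y) (η t - η y)
    rwa [add_sub_cancel] at this
  have hw0 := abs_nonneg w
  have h6 : |η y| * 1 ≤ |η y| * ((1 + |w|) * c) := by
    gcongr
    nlinarith
  have h7 : K * 1 ≤ K * (1 + |w|) := by gcongr; linarith
  have h8 : c * (K + N * |w|) ≤ c * ((K + N) * (1 + |w|)) := by
    gcongr; nlinarith
  nlinarith

/-- A function growing like `(1 + |w|)³ exp(a w²)` is bounded after multiplication with a normal
density of small variance. -/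
lemma exists_growth_mul_phi_le {a s : ℝ} (hs : 0 < s) (has : 2 * a * s < 1) (x y : ℝ) :
    ∃ C, ∀ t, (1 + |t - y|) ^ 3 * Real.exp (a * (t - y) ^ 2) * phi t x s ≤ C := by
  set q : ℝ := 1 / (2 * s) with hq
  have hqa : a < q := by
    rw [hq, lt_div_iff₀ (by positivity)]; linarith
  -- The spare Gaussian decay is `q - a = 4δ`: `2δ` absorbs the cubic factor and `2δ` the cross term
  -- from the different centres `y` and `x`.
  set δ : ℝ := (q - a) / 4 with hδ
  have hδ0 : 0 < δ := by simp only [hδ]; linarith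
  set d : ℝ := y - x with hd
  refine ⟨4 * (1 + 1 / δ) ^ 2 * (√(2 * Real.pi * s))⁻¹ * Real.exp (q ^ 2 * d ^ 2 / (2 * δ)),
    fun t => ?_⟩
  set w := t - y with hw
  have h1 : (1 + |w|) ^ 3 ≤ 4 * (1 + 1 / δ) ^ 2 * Real.exp (2 * δ * w ^ 2) := by
    have hw0 := abs_nonneg w
    have h2 : 1 + w ^ 2 ≤ (1 + 1 / δ) * Real.exp (δ * w ^ 2) := by
      have h3 := Real.add_one_le_exp (δ * w ^ 2)
      have h4 : (1 + 1 / δ) * (δ * w ^ 2 + 1) ≤ (1 + 1 / δ) * Real.exp (δ * w ^ 2) := by gcongr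
      have h5 : (1 + 1 / δ) * (δ * w ^ 2 + 1) = 1 + w ^ 2 + (δ * w ^ 2 + 1 / δ) := by
        field_simp; ring
      have : 0 ≤ δ * w ^ 2 + 1 / δ := by positivity
      linarith
    have h3 : (1 + |w|) ^ 2 ≤ 2 * (1 + w ^ 2) := by
      rw [← sq_abs w]; nlinarith [sq_nonneg (1 - |w|)]
    calc (1 + |w|) ^ 3 ≤ (1 + |w|) ^ 4 := pow_le_pow_right₀ (by linarith) (by norm_num)
      _ = ((1 + |w|) ^ 2) ^ 2 := by ring
      _ ≤ (2 * ((1 + 1 / δ) * Real.exp (δ * w ^ 2))) ^ 2 := by gcongr; linarith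
      _ = _ := by
        rw [mul_pow, mul_pow, ← Real.exp_nat_mul]
        push_cast
        ring_nf
  have h2 : 2 * δ * w ^ 2 + a * w ^ 2 + -(t - x) ^ 2 / (2 * s) ≤ q ^ 2 * d ^ 2 / (2 * δ) := by
    have e1 : t - x = w + d := by simp only [hw, hd]; ring
    have e2 : -(t - x) ^ 2 / (2 * s) = -q * (w + d) ^ 2 := by rw [e1, hq]; ring
    have e3 : a = q - 4 * δ := by simp only [hδ]; ring
    have hq0 : 0 < q := by positivity
    rw [e2, le_div_iff₀ (by positivity), e3]
    nlinarith [sq_nonneg (2 * δ * w + q * d), mul_nonneg hδ0.le (mul_nonneg hq0.le (sq_nonneg d))]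
  calc (1 + |w|) ^ 3 * Real.exp (a * w ^ 2) * phi t x s
      ≤ (4 * (1 + 1 / δ) ^ 2 * Real.exp (2 * δ * w ^ 2)) * Real.exp (a * w ^ 2) * phi t x s := by
        have := phi_nonneg t x s
        gcongr
    _ = 4 * (1 + 1 / δ) ^ 2 * (√(2 * Real.pi * s))⁻¹ *
        Real.exp (2 * δ * w ^ 2 + a * w ^ 2 + -(t - x) ^ 2 / (2 * s)) := by
        rw [phi_eq hs, Real.exp_add, Real.exp_add]; ring
    _ ≤ _ := by gcongr

/-- The integrand is bounded, which is enough because `ν` is finite; no decay of the design density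
is used. -/
lemma integrable_mul_phi_of_growth {ν : Measure ℝ} [IsFiniteMeasure ν] {w : ℝ → ℝ}
    (hw : Measurable w) {a s C y : ℝ} (hC : 0 ≤ C)
    (h : ∀ t, |w t| ≤ C * ((1 + |t - y|) ^ 3 * Real.exp (a * (t - y) ^ 2)))
    (hs : 0 < s) (has : 2 * a * s < 1) (x : ℝ) : Integrable (fun t => w t * phi t x s) ν := by
  obtain ⟨K, hK⟩ := exists_growth_mul_phi_le hs has x y
  refine Integrable.of_bound (by fun_prop) (C * K) (ae_of_all _ fun t => ?_)
  have hp := phi_nonneg t x s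
  rw [Real.norm_eq_abs, abs_mul, abs_of_nonneg hp]
  calc |w t| * phi t x s
      ≤ C * ((1 + |t - y|) ^ 3 * Real.exp (a * (t - y) ^ 2)) * phi t x s := by
        gcongr; exact h t
    _ = C * ((1 + |t - y|) ^ 3 * Real.exp (a * (t - y) ^ 2) * phi t x s) := by ring
    _ ≤ C * K := by gcongr; exact hK t

/-! ### Moments guaranteed by the smoothness condition. -/

section growth

variable {ν : Measure ℝ} {fX g τsq μ₃ : ℝ → ℝ} {σ : ℝ}

/-- The growth bound for a function satisfying the integrability condition. -/
lemma DerivL2.exists_bound {η : ℝ → ℝ} {y : ℝ} (h : DerivL2 ν.support σ η) (hη : ContDiff ℝ 2 η)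
    (hσ : 0 < σ) (hy : y ∈ ν.support) :
    ∃ C, 0 ≤ C ∧ ∀ t, |η t| ≤ C * ((1 + |t - y|) * Real.exp ((t - y) ^ 2 / (4 * σ ^ 2))) :=
  exists_growth_bound hσ (hη.of_le (by norm_num)) (h y hy).1

lemma DerivL2.exists_cubic_bound {η : ℝ → ℝ} {y : ℝ} (h : DerivL2 ν.support σ η)
    (hη : ContDiff ℝ 2 η) (hσ : 0 < σ) (hy : y ∈ ν.support) :
    ∃ C, 0 ≤ C ∧ ∀ t, |η t| ≤ C * ((1 + |t - y|) ^ 3 *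
      Real.exp (1 / (4 * σ ^ 2) * (t - y) ^ 2)) := by
  obtain ⟨C, hC, h⟩ := h.exists_bound hη hσ hy
  refine ⟨C, hC, fun t => (h t).trans ?_⟩
  have := abs_nonneg (t - y)
  rw [one_div_mul_eq_div]
  gcongr
  exact le_self_pow₀ (by linarith) (by norm_num)

/-- The threshold `2σ²` is where `exp(-t²/(2s))` stops beating the growth rate `exp(t²/(4σ²))` of
`g²` and `τ²`. The bound on `g²` comes from the condition on `(g²)'`; squaring the one for `g` would
only reach `σ²`. -/
lemma CondC1.integrable_second_moment [IsProbabilityMeasure ν]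
    (hC : CondC1 ν.support fX g τsq μ₃ σ) (hσ : 0 < σ) {s : ℝ} (hs : 0 < s) (hs' : s < 2 * σ ^ 2) (x : ℝ) :
    Integrable (fun t => (g t ^ 2 + τsq t) * phi t x s) ν := by
  obtain ⟨y, hy⟩ := Measure.nonempty_support (IsProbabilityMeasure.ne_zero ν)
  obtain ⟨C₁, h₁, b₁⟩ := hC.l2_g_sq.exists_cubic_bound (hC.smooth_g.pow 2) hσ hy
  obtain ⟨C₂, h₂, b₂⟩ := hC.l2_τsq.exists_cubic_bound hC.smooth_τsq hσ hy
  have has : 2 * (1 / (4 * σ ^ 2)) * s < 1 := by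
    rw [show 2 * (1 / (4 * σ ^ 2)) * s = s / (2 * σ ^ 2) by field_simp; norm_num]
    exact (div_lt_one (by positivity)).2 hs'
  have i1 := integrable_mul_phi_of_growth (ν := ν) (hC.smooth_g.continuous.measurable.pow_const 2)
    h₁ b₁ hs has x
  have i2 := integrable_mul_phi_of_growth (ν := ν) hC.smooth_τsq.continuous.measurable
    h₂ b₂ hs has x
  refine (i1.add i2).congr (ae_of_all _ fun t => ?_)
  simp only [Pi.add_apply]
  ring

/-- Writing `|g|³ = (g²)^{3/2}` gives growth rate `exp(3t²/(8σ²))`, and this lowers the threshold to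
`4σ²/3`. It still exceeds `σ²`, which is what the case `λ = 0` requires. -/
lemma CondC1.integrable_third_moment [IsProbabilityMeasure ν]
    (hC : CondC1 ν.support fX g τsq μ₃ σ) (hσ : 0 < σ) {s : ℝ} (hs : 0 < s) (hs' : s < 4 / 3 * σ ^ 2) (x : ℝ) :
    Integrable (fun t => 4 * (|g t| ^ 3 + μ₃ t) * phi t x s) ν := by
  obtain ⟨y, hy⟩ := Measure.nonempty_support (IsProbabilityMeasure.ne_zero ν)
  obtain ⟨C₁, h₁, b₁⟩ := hC.l2_g_sq.exists_bound (hC.smooth_g.pow 2) hσ hy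
  obtain ⟨C₂, h₂, b₂⟩ := hC.l2_μ₃.exists_cubic_bound hC.smooth_μ₃ hσ hy
  have hσ2 : 0 < σ ^ 2 := by positivity
  have has : 2 * (1 / (4 * σ ^ 2)) * s < 1 := by
    rw [show 2 * (1 / (4 * σ ^ 2)) * s = s / (2 * σ ^ 2) by field_simp; norm_num]
    exact (div_lt_one (by positivity)).2 (by linarith)
  have has' : 2 * (3 / (8 * σ ^ 2)) * s < 1 := by
    rw [show 2 * (3 / (8 * σ ^ 2)) * s = s / (4 / 3 * σ ^ 2) by field_simp; norm_num]
    exact (div_lt_one (by positivity)).2 hs'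
  have b₃ : ∀ t, |(|g t| ^ 3)| ≤ (C₁ + 1) ^ 3 * ((1 + |t - y|) ^ 3 *
      Real.exp (3 / (8 * σ ^ 2) * (t - y) ^ 2)) := by
    intro t
    set c := Real.exp ((t - y) ^ 2 / (8 * σ ^ 2)) with hc
    have e1 : Real.exp ((t - y) ^ 2 / (4 * σ ^ 2)) = c ^ 2 := by
      rw [hc, ← Real.exp_nat_mul]; congr 1; push_cast; field_simp; ring
    have e2 : Real.exp (3 / (8 * σ ^ 2) * (t - y) ^ 2) = c ^ 3 := by
      rw [hc, ← Real.exp_nat_mul]; congr 1; push_cast; ring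
    have hb := b₁ t
    rw [abs_of_nonneg (sq_nonneg _), e1] at hb
    have hw := abs_nonneg (t - y)
    have hc0 : 0 < c := Real.exp_pos _
    have h4 : |g t| ≤ (C₁ + 1) * (1 + |t - y|) * c := by
      refine abs_le_of_sq_le_sq ?_ (by positivity)
      calc g t ^ 2 ≤ C₁ * ((1 + |t - y|) * c ^ 2) := hb
        _ ≤ (C₁ + 1) ^ 2 * ((1 + |t - y|) ^ 2 * c ^ 2) := by
          gcongr
          · nlinarith
          · exact le_self_pow₀ (by linarith) (by norm_num)
        _ = _ := by ring
    rw [abs_of_nonneg (by positivity), e2]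
    calc |g t| ^ 3 ≤ ((C₁ + 1) * (1 + |t - y|) * c) ^ 3 := by gcongr
      _ = _ := by ring
  have i1 := integrable_mul_phi_of_growth (ν := ν)
    (hC.smooth_g.continuous.measurable.abs.pow_const 3) (by positivity) b₃ hs has' x
  have i2 := integrable_mul_phi_of_growth (ν := ν) hC.smooth_μ₃.continuous.measurable
    h₂ b₂ hs has x
  refine ((i1.add i2).const_mul 4).congr (ae_of_all _ fun t => ?_)
  simp only [Pi.add_apply]
  ring

end growth

/-! ### Limit theorems for independent identically distributed data -/

/-- Taylor's bound serves for `|y| ≤ 1`; for `|y| ≥ 1` each term separately is at most a multiple of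
`|y|³`. -/
lemma norm_exp_mul_I_sub_taylor_le (y : ℝ) :
    ‖Complex.exp (y * Complex.I) - (1 + y * Complex.I - y ^ 2 / 2)‖ ≤ 4 * |y| ^ 3 := by
  have hn : ‖(y : ℂ) * Complex.I‖ = |y| := by simp
  rcases le_total |y| 1 with h | h
  · have := Complex.exp_bound (x := y * Complex.I) (by rwa [hn]) (n := 3) (by norm_num)
    rw [hn] at this
    have e : ∑ m ∈ Finset.range 3, ((y : ℂ) * Complex.I) ^ m / (m.factorial : ℂ) =
        1 + y * Complex.I - y ^ 2 / 2 := by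
      simp [Finset.sum_range_succ, mul_pow, Nat.factorial]
      ring
    rw [e] at this
    refine this.trans ?_
    norm_num [Nat.factorial]
    have : 0 ≤ |y| ^ 3 := by positivity
    linarith
  · have h1 : ‖Complex.exp (y * Complex.I)‖ = 1 := Complex.norm_exp_ofReal_mul_I y
    have h2 : ‖(1 : ℂ) + y * Complex.I - y ^ 2 / 2‖ ≤ 1 + |y| + |y| ^ 2 / 2 := by
      refine (norm_sub_le _ _).trans (add_le_add ((norm_add_le _ _).trans ?_) ?_)
      · simp
      · simp
    have h3 : |y| ≤ |y| ^ 3 := le_self_pow₀ h (by norm_num)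
    have h4 : |y| ^ 2 ≤ |y| ^ 3 := pow_le_pow_right₀ h (by norm_num)
    have := norm_sub_le (Complex.exp (y * Complex.I)) (1 + y * Complex.I - y ^ 2 / 2)
    nlinarith

section limit

variable {Ω : Type*} [MeasurableSpace Ω] {P : Measure Ω} [IsProbabilityMeasure P]

lemma integrable_pow_of_integrable_cube {ξ : Ω → ℝ} (hξ : AEMeasurable ξ P)
    (h : Integrable (fun ω => |ξ ω| ^ 3) P) :
    Integrable ξ P ∧ Integrable (fun ω => ξ ω ^ 2) P := by
  have i0 : Integrable (fun ω => 1 + |ξ ω| ^ 3) P := (integrable_const _).add h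
  have key : ∀ a : ℝ, 0 ≤ a → a ≤ 1 + a ^ 3 ∧ a ^ 2 ≤ 1 + a ^ 3 := fun a ha => by
    constructor <;> nlinarith [sq_nonneg (a - 1), mul_nonneg ha (sq_nonneg (a - 1))]
  refine ⟨i0.mono' hξ.aestronglyMeasurable (ae_of_all _ fun ω => ?_),
    i0.mono' (hξ.pow_const 2).aestronglyMeasurable (ae_of_all _ fun ω => ?_)⟩
  · exact (key _ (abs_nonneg _)).1
  · rw [Real.norm_eq_abs, abs_pow]
    exact (key _ (abs_nonneg _)).2

/-- Third-order expansion of the characteristic function of a centred variable. -/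
lemma norm_charFun_sub_taylor_le {ξ : Ω → ℝ} (hξ : AEMeasurable ξ P)
    (h3 : Integrable (fun ω => |ξ ω| ^ 3) P) (h0 : ∫ ω, ξ ω ∂P = 0) (t : ℝ) :
    ‖charFun (P.map ξ) t - (1 - (t ^ 2 * ∫ ω, ξ ω ^ 2 ∂P : ℝ) / 2)‖ ≤
      4 * |t| ^ 3 * ∫ ω, |ξ ω| ^ 3 ∂P := by
  obtain ⟨i1, i2⟩ := integrable_pow_of_integrable_cube hξ h3
  have hc : charFun (P.map ξ) t = ∫ ω, Complex.exp ((t * ξ ω : ℝ) * Complex.I) ∂P := by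
    rw [charFun_apply_real, integral_map hξ (by fun_prop)]
    simp
  have iT : Integrable (fun ω => (1 + (t * ξ ω : ℝ) * Complex.I - (t * ξ ω : ℝ) ^ 2 / 2 : ℂ)) P := by
    refine ((integrable_const _).add ((i1.const_mul t).ofReal.mul_const _)).sub ?_
    have : Integrable (fun ω => ((t ^ 2 * ξ ω ^ 2 / 2 : ℝ) : ℂ)) P :=
      ((i2.const_mul (t ^ 2)).div_const 2).ofReal
    refine this.congr (ae_of_all _ fun ω => ?_)
    push_cast
    ring
  have hT : ∫ ω, (1 + (t * ξ ω : ℝ) * Complex.I - (t * ξ ω : ℝ) ^ 2 / 2 : ℂ) ∂P =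
      1 - (t ^ 2 * ∫ ω, ξ ω ^ 2 ∂P : ℝ) / 2 := by
    have e : ∀ ω, (1 + (t * ξ ω : ℝ) * Complex.I - (t * ξ ω : ℝ) ^ 2 / 2 : ℂ) =
        (1 - ((t ^ 2 / 2 * ξ ω ^ 2 : ℝ) : ℂ)) + ((t * ξ ω : ℝ) : ℂ) * Complex.I := fun ω => by
      push_cast; ring
    simp_rw [e]
    have j1 : Integrable (fun ω => ((t ^ 2 / 2 * ξ ω ^ 2 : ℝ) : ℂ)) P :=
      (i2.const_mul (t ^ 2 / 2)).ofReal
    have j2 : Integrable (fun ω => ((t * ξ ω : ℝ) : ℂ) * Complex.I) P :=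
      ((i1.const_mul t).ofReal.mul_const _)
    have j3 : Integrable (fun ω => 1 - ((t ^ 2 / 2 * ξ ω ^ 2 : ℝ) : ℂ)) P :=
      (integrable_const _).sub j1
    rw [integral_add j3 j2, integral_sub (integrable_const _) j1, integral_mul_const,
      integral_complex_ofReal, integral_complex_ofReal, integral_const_mul, integral_const_mul, h0]
    simp
    ring
  have iE : Integrable (fun ω => Complex.exp ((t * ξ ω : ℝ) * Complex.I)) P := by
    refine Integrable.of_bound (C := 1) ?_ (ae_of_all _ fun ω => ?_)
    · exact (Complex.measurable_exp.comp_aemeasurable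
        ((Complex.measurable_ofReal.comp_aemeasurable (hξ.const_mul t)).mul_const
          _)).aestronglyMeasurable
    · exact (Complex.norm_exp_ofReal_mul_I _).le
  rw [hc, ← hT, ← integral_sub iE iT, ← integral_const_mul]
  refine norm_integral_le_of_norm_le (h3.const_mul _) (ae_of_all _ fun ω => ?_)
  refine (norm_exp_mul_I_sub_taylor_le (t * ξ ω)).trans (le_of_eq ?_)
  rw [abs_mul, mul_pow, mul_assoc]

/-- **Lyapunov's central limit theorem** for triangular arrays with independent identically
distributed rows. -/
theorem tendstoInDistribution_sum_of_lyapunov {ξ : ℕ → ℕ → Ω → ℝ} {v : ℝ}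
    (hm : ∀ n i, AEMeasurable (ξ n i) P) (hindep : ∀ n, iIndepFun (ξ n) P)
    (hident : ∀ n i, IdentDistrib (ξ n i) (ξ n 0) P P)
    (h3 : ∀ᶠ n in atTop, Integrable (fun ω => |ξ n 0 ω| ^ 3) P)
    (h0 : ∀ᶠ n in atTop, ∫ ω, ξ n 0 ω ∂P = 0)
    (hv : Tendsto (fun n : ℕ => (n : ℝ) * ∫ ω, ξ n 0 ω ^ 2 ∂P) atTop (𝓝 v)) (hv0 : 0 ≤ v)
    (hL : Tendsto (fun n : ℕ => (n : ℝ) * ∫ ω, |ξ n 0 ω| ^ 3 ∂P) atTop (𝓝 0)) :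
    TendstoInDistribution (fun n ω => ∑ i ∈ Finset.range n, ξ n i ω) atTop id (fun _ => P)
      (gaussianReal 0 v.toNNReal) := by
  refine ⟨fun n => Finset.aemeasurable_fun_sum _ fun _ _ => hm _ _, aemeasurable_id, ?_⟩
  refine ProbabilityMeasure.tendsto_iff_tendsto_charFun.2 fun t => ?_
  have e : ∀ n, charFun (P.map (fun ω => ∑ i ∈ Finset.range n, ξ n i ω)) t =
      (1 + (charFun (P.map (ξ n 0)) t - 1)) ^ n := fun n => by
    rw [((hindep n).restrict _).charFun_map_fun_finsetSum_eq_prod (fun _ _ => hm _ _)]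
    simp [fun i => (hident n i).map_eq]
  simp only [ProbabilityMeasure.coe_mk, Measure.map_id, charFun_gaussianReal]
  simp_rw [e]
  -- It suffices that `n (χ_n(t) - 1) → -t² v / 2` for the characteristic function `χ_n` of one
  -- summand. The second moments give this limit and the third moments control the error.
  refine Complex.tendsto_one_add_pow_exp_of_tendsto ?_
  have hlim : Tendsto (fun n : ℕ => ((-(t ^ 2 / 2 * ((n : ℝ) * ∫ ω, ξ n 0 ω ^ 2 ∂P)) : ℝ) : ℂ))
      atTop (𝓝 ((-(t ^ 2 / 2 * v) : ℝ) : ℂ)) :=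
    (Complex.continuous_ofReal.tendsto _).comp ((hv.const_mul _).neg)
  have hzero : Tendsto (fun n : ℕ => (n : ℂ) * (charFun (P.map (ξ n 0)) t - 1) -
      ((-(t ^ 2 / 2 * ((n : ℝ) * ∫ ω, ξ n 0 ω ^ 2 ∂P)) : ℝ) : ℂ)) atTop (𝓝 0) := by
    refine squeeze_zero_norm' (a := fun n : ℕ => 4 * |t| ^ 3 *
      ((n : ℝ) * ∫ ω, |ξ n 0 ω| ^ 3 ∂P)) ?_ (by simpa using hL.const_mul (4 * |t| ^ 3))
    filter_upwards [h3, h0] with n h3 h0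
    have := norm_charFun_sub_taylor_le (hm n 0) h3 h0 t
    have e2 : (n : ℂ) * (charFun (P.map (ξ n 0)) t - 1) -
        ((-(t ^ 2 / 2 * ((n : ℝ) * ∫ ω, ξ n 0 ω ^ 2 ∂P)) : ℝ) : ℂ) =
        n * (charFun (P.map (ξ n 0)) t - (1 - (t ^ 2 * ∫ ω, ξ n 0 ω ^ 2 ∂P : ℝ) / 2)) := by
      push_cast; ring
    rw [e2, norm_mul, Complex.norm_natCast]
    calc (n : ℝ) * _ ≤ n * (4 * |t| ^ 3 * ∫ ω, |ξ n 0 ω| ^ 3 ∂P) := by gcongr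
      _ = _ := by ring
  have := hzero.add hlim
  simp only [sub_add_cancel, zero_add] at this
  convert this using 2
  rw [Real.coe_toNNReal _ hv0]
  push_cast
  ring

variable {E : Type*} [MeasurableSpace E] {W : ℕ → Ω → E}

/-- The empirical mean of `p` over the first `n` data. -/
noncomputable def empMean (W : ℕ → Ω → E) (p : E → ℝ) (n : ℕ) (ω : Ω) : ℝ :=
  (n : ℝ)⁻¹ * ∑ i ∈ Finset.range n, p (W i ω)

lemma measurable_empMean (hW : ∀ i, Measurable (W i)) {p : E → ℝ} (hp : Measurable p) (n : ℕ) :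
    Measurable (empMean W p n) :=
  (Finset.measurable_fun_sum _ fun i _ => hp.comp (hW i)).const_mul _

/-- Mean square deviation of an empirical mean. -/
lemma integral_sq_empMean_sub_le (hind : iIndepFun W P) (hid : ∀ i, IdentDistrib (W i) (W 0) P P)
    {p : E → ℝ} (hp : Measurable p) (h2 : MemLp (fun ω => p (W 0 ω)) 2 P) {n : ℕ} (hn : 0 < n) :
    Integrable (fun ω => (empMean W p n ω - ∫ ω, p (W 0 ω) ∂P) ^ 2) P ∧
    ∫ ω, (empMean W p n ω - ∫ ω, p (W 0 ω) ∂P) ^ 2 ∂P ≤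
      (n : ℝ)⁻¹ * ∫ ω, p (W 0 ω) ^ 2 ∂P := by
  have hn' : (n : ℝ) ≠ 0 := by positivity
  have hid' : ∀ i, IdentDistrib (fun ω => p (W i ω)) (fun ω => p (W 0 ω)) P P :=
    fun i => (hid i).comp hp
  have hL : ∀ i, MemLp (fun ω => p (W i ω)) 2 P := fun i => (hid' i).symm.memLp_snd h2
  have hsum : MemLp (fun ω => ∑ i ∈ Finset.range n, p (W i ω)) 2 P :=
    memLp_finsetSum _ fun i _ => hL i
  have hmean : MemLp (empMean W p n) 2 P := hsum.const_mul _
  have hE : ∫ ω, empMean W p n ω ∂P = ∫ ω, p (W 0 ω) ∂P := by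
    simp only [empMean]
    rw [integral_const_mul, integral_finsetSum _ fun i _ => (hL i).integrable one_le_two]
    simp only [fun i => (hid' i).integral_eq, Finset.sum_const, Finset.card_range, nsmul_eq_mul]
    field_simp
  have hvar : ∫ ω, (empMean W p n ω - ∫ ω, p (W 0 ω) ∂P) ^ 2 ∂P = Var[empMean W p n; P] := by
    rw [variance_eq_integral hmean.aestronglyMeasurable.aemeasurable, hE]
  refine ⟨(hmean.sub (memLp_const _)).integrable_sq, ?_⟩
  have hind' : iIndepFun (fun i ω => p (W i ω)) P := hind.comp (fun _ => p) (fun _ => hp)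
  have hv2 : Var[∑ i ∈ Finset.range n, fun ω => p (W i ω); P] =
      n * Var[fun ω => p (W 0 ω); P] := by
    rw [IndepFun.variance_sum (fun i _ => hL i) fun i _ j _ hij => hind'.indepFun hij]
    simp [fun i => (hid' i).variance_eq]
  have hv3 : Var[empMean W p n; P] = (n : ℝ)⁻¹ * Var[fun ω => p (W 0 ω); P] := by
    have e : empMean W p n = fun ω => (n : ℝ)⁻¹ * (∑ i ∈ Finset.range n, fun ω => p (W i ω)) ω := by
      ext ω; simp [empMean]
    rw [e, variance_const_mul, hv2]
    field_simp
  rw [hvar, hv3]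
  gcongr
  exact variance_le_expectation_sq h2.aestronglyMeasurable

/-- A central limit theorem for empirical means of functions converging in mean square. -/
theorem tendstoInDistribution_sqrt_mul_empMean (hW : ∀ i, Measurable (W i))
    (hind : iIndepFun W P) (hid : ∀ i, IdentDistrib (W i) (W 0) P P)
    {p : ℕ → E → ℝ} {q : E → ℝ} (hp : ∀ n, Measurable (p n)) (hq : Measurable q)
    (hp2 : ∀ᶠ n in atTop, MemLp (fun ω => p n (W 0 ω)) 2 P)
    (hq2 : MemLp (fun ω => q (W 0 ω)) 2 P)
    (hlim : Tendsto (fun n => ∫ ω, (p n (W 0 ω) - q (W 0 ω)) ^ 2 ∂P) atTop (𝓝 0)) :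
    TendstoInDistribution
      (fun (n : ℕ) ω => √(n : ℝ) * (empMean W (p n) n ω - ∫ ω, p n (W 0 ω) ∂P)) atTop id (fun _ => P)
      (gaussianReal 0 (Var[fun ω => q (W 0 ω); P]).toNNReal) := by
  have hclt := tendstoInDistribution_inv_sqrt_mul_sum_sub (P := P)
    (P' := gaussianReal 0 (Var[fun ω => q (W 0 ω); P]).toNNReal) (Y := id)
    (X := fun i ω => q (W i ω)) HasLaw.id hq2 (hind.comp (fun _ => q) fun _ => hq)
    (fun i => (hid i).comp hq)
  refine tendstoInDistribution_of_tendstoInMeasure_sub _ _ hclt ?_ fun n =>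
    (((measurable_empMean hW (hp n) n).sub_const _).const_mul _).aemeasurable
  rw [tendstoInMeasure_iff_measureReal_norm]
  intro δ hδ
  have hev : ∀ᶠ n : ℕ in atTop, P.real {ω | δ ≤ ‖((fun (n : ℕ) ω =>
      √(n : ℝ) * (empMean W (p n) n ω - ∫ ω, p n (W 0 ω) ∂P)) -
      (fun (n : ℕ) ω => (√(n : ℝ))⁻¹ * (∑ k ∈ Finset.range n, q (W k ω) -
        n * ∫ ω, q (W 0 ω) ∂P))) n ω - (0 : ℕ → Ω → ℝ) n ω‖} ≤
      (δ ^ 2)⁻¹ * ∫ ω, (p n (W 0 ω) - q (W 0 ω)) ^ 2 ∂P := by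
    filter_upwards [hp2, eventually_gt_atTop 0] with n hpn hn
    have hn0 : (0 : ℝ) < n := by exact_mod_cast hn
    have hd2 : MemLp (fun ω => p n (W 0 ω) - q (W 0 ω)) 2 P := hpn.sub hq2
    obtain ⟨i1, i2⟩ := integral_sq_empMean_sub_le hind hid ((hp n).sub hq) hd2 hn
    simp only [Pi.sub_apply] at i1 i2
    set D : Ω → ℝ := fun ω => empMean W (fun e => p n e - q e) n ω -
      ∫ ω, (p n (W 0 ω) - q (W 0 ω)) ∂P with hD
    have e1 : ∀ ω, √(n : ℝ) * (empMean W (p n) n ω - ∫ ω, p n (W 0 ω) ∂P) -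
        (√(n : ℝ))⁻¹ * (∑ k ∈ Finset.range n, q (W k ω) - n * ∫ ω, q (W 0 ω) ∂P) =
        √(n : ℝ) * D ω := fun ω => by
      have hsq : √(n : ℝ) * √(n : ℝ) = n := Real.mul_self_sqrt hn0.le
      have hs0 : √(n : ℝ) ≠ 0 := (Real.sqrt_pos.2 hn0).ne'
      have e2 : (√(n : ℝ))⁻¹ = √(n : ℝ) * (n : ℝ)⁻¹ := by
        nth_rewrite 3 [← hsq]
        field_simp
      simp only [hD, empMean, Finset.sum_sub_distrib]
      rw [integral_sub (hpn.integrable one_le_two) (hq2.integrable one_le_two), e2]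
      field_simp
      ring
    have hmarkov := mul_meas_ge_le_integral_of_nonneg (μ := P)
      (f := fun ω => n * D ω ^ 2) (ae_of_all _ fun ω => by positivity)
      (Integrable.const_mul i1 _) (δ ^ 2)
    have hset : {ω | δ ≤ ‖((fun (n : ℕ) ω =>
      √(n : ℝ) * (empMean W (p n) n ω - ∫ ω, p n (W 0 ω) ∂P)) -
      (fun (n : ℕ) ω => (√(n : ℝ))⁻¹ * (∑ k ∈ Finset.range n, q (W k ω) -
        n * ∫ ω, q (W 0 ω) ∂P))) n ω - (0 : ℕ → Ω → ℝ) n ω‖} = {ω | δ ^ 2 ≤ n * D ω ^ 2} := by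
      ext ω
      simp only [Set.mem_ofPred_eq, Pi.sub_apply, Pi.zero_apply, sub_zero, e1]
      have e3 : n * D ω ^ 2 = ‖√(n : ℝ) * D ω‖ ^ 2 := by
        rw [Real.norm_eq_abs, sq_abs, mul_pow, Real.sq_sqrt hn0.le]
      rw [e3]
      exact (pow_le_pow_iff_left₀ hδ.le (norm_nonneg _) two_ne_zero).symm
    rw [hset, le_inv_mul_iff₀ (by positivity)]
    refine hmarkov.trans ?_
    rw [integral_const_mul]
    calc (n : ℝ) * ∫ ω, D ω ^ 2 ∂P ≤ n * ((n : ℝ)⁻¹ *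
        ∫ ω, (p n (W 0 ω) - q (W 0 ω)) ^ 2 ∂P) := by gcongr; exact i2
      _ = _ := by rw [← mul_assoc, mul_inv_cancel₀ hn0.ne', one_mul]
  exact squeeze_zero' (Eventually.of_forall fun n => measureReal_nonneg) hev
    (by simpa using hlim.const_mul (δ ^ 2)⁻¹)

/-- A central limit theorem for empirical means at a rate slower than `√n`. -/
theorem tendstoInDistribution_sqrt_mul_empMean_of_lyapunov (hW : ∀ i, Measurable (W i))
    (hind : iIndepFun W P) (hid : ∀ i, IdentDistrib (W i) (W 0) P P)
    {p : ℕ → E → ℝ} (hp : ∀ n, Measurable (p n)) {κ : ℕ → ℝ} (hκ : ∀ n, 0 < κ n)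
    (hκ0 : Tendsto κ atTop (𝓝 0)) (hnκ : Tendsto (fun n : ℕ => n * κ n) atTop atTop)
    (h3 : ∀ᶠ n in atTop, Integrable (fun ω => |p n (W 0 ω)| ^ 3) P) {a v C : ℝ}
    (h1 : Tendsto (fun n => ∫ ω, p n (W 0 ω) ∂P) atTop (𝓝 a))
    (hv : Tendsto (fun n => κ n * ∫ ω, p n (W 0 ω) ^ 2 ∂P) atTop (𝓝 v)) (hv0 : 0 ≤ v)
    (hC : ∀ᶠ n in atTop, κ n ^ 2 * ∫ ω, |p n (W 0 ω)| ^ 3 ∂P ≤ C) :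
    TendstoInDistribution
      (fun n ω => √(n * κ n) * (empMean W (p n) n ω - ∫ ω, p n (W 0 ω) ∂P)) atTop id
      (fun _ => P) (gaussianReal 0 v.toNNReal) := by
  set b : ℕ → ℝ := fun n => ∫ ω, p n (W 0 ω) ∂P with hb
  -- With this scale `∑ c_n (p_n - b_n) = √(n κ_n) (mean - b_n)` and `n c_n² = κ_n`.
  set c : ℕ → ℝ := fun n => √(κ n / n) with hc
  have hc0 : ∀ n, 0 ≤ c n := fun n => Real.sqrt_nonneg _
  have hcsq : ∀ n : ℕ, 0 < n → n * c n ^ 2 = κ n := fun n hn => by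
    have hn0 : (0 : ℝ) < n := by exact_mod_cast hn
    rw [hc, Real.sq_sqrt (div_nonneg (hκ n).le hn0.le)]
    field_simp
  have hcu : ∀ n : ℕ, 0 < n → c n = κ n / √(n * κ n) := fun n hn => by
    have hn0 : (0 : ℝ) < n := by exact_mod_cast hn
    have := hκ n
    rw [hc, eq_div_iff (by positivity), ← Real.sqrt_mul (by positivity),
      show κ n / n * (n * κ n) = κ n ^ 2 by field_simp, Real.sqrt_sq this.le]
  have hmeas : ∀ n, Measurable fun e => c n * (p n e - b n) :=
    fun n => ((hp n).sub_const _).const_mul _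
  have hclt := tendstoInDistribution_sum_of_lyapunov (P := P)
    (ξ := fun n i ω => c n * (p n (W i ω) - b n)) (v := v)
    (fun n i => ((hmeas n).comp (hW i)).aemeasurable)
    (fun n => hind.comp (fun _ e => c n * (p n e - b n)) fun _ => hmeas n)
    (fun n i => (hid i).comp (hmeas n)) ?_ ?_ ?_ hv0 ?_
  · convert hclt using 3 with n ω
    rcases Nat.eq_zero_or_pos n with rfl | hn
    · simp
    have hn0 : (0 : ℝ) < n := by exact_mod_cast hn
    have hk := hκ n
    rw [← Finset.mul_sum, hcu n hn, Finset.sum_sub_distrib]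
    simp only [empMean, Finset.sum_const, Finset.card_range, nsmul_eq_mul]
    have hs : √(n * κ n) * √(n * κ n) = n * κ n := Real.mul_self_sqrt (by positivity)
    have hs0 : √(n * κ n) ≠ 0 := (Real.sqrt_pos.2 (by positivity)).ne'
    rw [div_mul_eq_mul_div, eq_div_iff hs0, mul_right_comm, hs]
    field_simp
    rfl
  · filter_upwards [h3] with n h3
    have hi := integrable_pow_of_integrable_cube ((hp n).comp (hW 0)).aemeasurable h3
    refine Integrable.mono' (g := fun ω => c n ^ 3 * (4 * (|p n (W 0 ω)| ^ 3 + |b n| ^ 3)))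
      (((h3.add (integrable_const _)).const_mul _).const_mul _)
      (((hmeas n).comp (hW 0)).abs.pow_const 3).aestronglyMeasurable (ae_of_all _ fun ω => ?_)
    rw [Real.norm_eq_abs, abs_of_nonneg (by positivity), abs_mul, abs_of_nonneg (hc0 n), mul_pow]
    have := hc0 n
    gcongr
    have h4 : |p n (W 0 ω) - b n| ^ 3 ≤ (|p n (W 0 ω)| + |b n|) ^ 3 := by
      gcongr; exact abs_sub _ _
    have h2 := abs_nonneg (p n (W 0 ω))
    have h3 := abs_nonneg (b n)
    nlinarith [mul_nonneg (add_nonneg h2 h3) (sq_nonneg (|p n (W 0 ω)| - |b n|))]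
  · filter_upwards [h3] with n h3
    have hi := integrable_pow_of_integrable_cube ((hp n).comp (hW 0)).aemeasurable h3
    have hi1 : Integrable (fun ω => p n (W 0 ω)) P := hi.1
    rw [integral_const_mul, integral_sub hi1 (integrable_const _)]
    simp [hb]
  · have hlim : Tendsto (fun n => κ n * ∫ ω, p n (W 0 ω) ^ 2 ∂P - κ n * b n ^ 2) atTop (𝓝 v) := by
      simpa using hv.sub (hκ0.mul (h1.pow 2))
    refine hlim.congr' ?_
    filter_upwards [h3, eventually_gt_atTop 0] with n h3 hn
    have hi := integrable_pow_of_integrable_cube ((hp n).comp (hW 0)).aemeasurable h3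
    have e : ∀ ω, (c n * (p n (W 0 ω) - b n)) ^ 2 =
        c n ^ 2 * (p n (W 0 ω) ^ 2 - (2 * b n * p n (W 0 ω) - b n ^ 2)) := fun ω => by ring
    have i1 : Integrable (fun ω => 2 * b n * p n (W 0 ω)) P := hi.1.const_mul _
    have i2 : Integrable (fun ω => 2 * b n * p n (W 0 ω) - b n ^ 2) P :=
      i1.sub (integrable_const _)
    simp_rw [e]
    have i3 : Integrable (fun ω => p n (W 0 ω) ^ 2) P := hi.2
    rw [integral_const_mul, integral_sub i3 i2, integral_sub i1 (integrable_const _),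
      integral_const_mul, ← mul_assoc, hcsq n hn]
    simp only [integral_const, probReal_univ, one_smul]
    ring
  -- Lyapunov's ratio: since `n c_n³ = κ_n² / √(n κ_n)`, boundedness of `κ_n² E|p_n|³` together with
  -- `n κ_n → ∞` is enough.
  · have hz : Tendsto (fun n : ℕ => 4 * (C + κ n ^ 2 * |b n| ^ 3) * (√(n * κ n))⁻¹) atTop
        (𝓝 0) := by
      have t1 : Tendsto (fun n => 4 * (C + κ n ^ 2 * |b n| ^ 3)) atTop
          (𝓝 (4 * (C + 0 ^ 2 * |a| ^ 3))) :=
        (((hκ0.pow 2).mul (h1.abs.pow 3)).const_add C).const_mul 4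
      have t2 := (Real.tendsto_sqrt_atTop.comp hnκ).inv_tendsto_atTop
      simpa using t1.mul t2
    refine squeeze_zero' (Eventually.of_forall fun n => mul_nonneg (by positivity)
      (integral_nonneg fun ω => by positivity)) ?_ hz
    filter_upwards [h3, hC, eventually_gt_atTop 0] with n h3 hC hn
    have hn0 : (0 : ℝ) < n := by exact_mod_cast hn
    have hk := hκ n
    have hi := integrable_pow_of_integrable_cube ((hp n).comp (hW 0)).aemeasurable h3
    have hle : ∫ ω, |c n * (p n (W 0 ω) - b n)| ^ 3 ∂P ≤
        ∫ ω, c n ^ 3 * (4 * (|p n (W 0 ω)| ^ 3 + |b n| ^ 3)) ∂P := by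
      refine integral_mono_of_nonneg (ae_of_all _ fun ω => by positivity)
        (((h3.add (integrable_const _)).const_mul _).const_mul _) (ae_of_all _ fun ω => ?_)
      simp only [abs_mul, abs_of_nonneg (hc0 n), mul_pow]
      have := hc0 n
      gcongr
      have h4 : |p n (W 0 ω) - b n| ^ 3 ≤ (|p n (W 0 ω)| + |b n|) ^ 3 := by
        gcongr; exact abs_sub _ _
      have h2 := abs_nonneg (p n (W 0 ω))
      have h3 := abs_nonneg (b n)
      nlinarith [mul_nonneg (add_nonneg h2 h3) (sq_nonneg (|p n (W 0 ω)| - |b n|))]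
    have heq : ∫ ω, c n ^ 3 * (4 * (|p n (W 0 ω)| ^ 3 + |b n| ^ 3)) ∂P =
        c n ^ 3 * (4 * (∫ ω, |p n (W 0 ω)| ^ 3 ∂P + |b n| ^ 3)) := by
      rw [integral_const_mul, integral_const_mul, integral_add h3 (integrable_const _)]
      simp
    calc (n : ℝ) * ∫ ω, |c n * (p n (W 0 ω) - b n)| ^ 3 ∂P
        ≤ n * (c n ^ 3 * (4 * (∫ ω, |p n (W 0 ω)| ^ 3 ∂P + |b n| ^ 3))) := by
          rw [← heq]; gcongr
      _ = (n * c n ^ 2) * c n * (4 * (∫ ω, |p n (W 0 ω)| ^ 3 ∂P + |b n| ^ 3)) := by ring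
      _ = 4 * (κ n ^ 2 * ∫ ω, |p n (W 0 ω)| ^ 3 ∂P + κ n ^ 2 * |b n| ^ 3) *
          (√(n * κ n))⁻¹ := by rw [hcsq n hn, hcu n hn]; ring
      _ ≤ 4 * (C + κ n ^ 2 * |b n| ^ 3) * (√(n * κ n))⁻¹ := by gcongr

/-- If `V n` tends to zero uniformly on each of the events `{R n ≤ K}` and the nonnegative
variables `R n` are bounded in mean, then `V n` tends to zero in probability. -/
lemma tendstoInMeasure_zero_of_tendsto_on {R V : ℕ → Ω → ℝ} {C : ℝ} (hR : ∀ n ω, 0 ≤ R n ω)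
    (hi : ∀ᶠ n in atTop, Integrable (R n) P) (hC : ∀ᶠ n in atTop, ∫ ω, R n ω ∂P ≤ C)
    (hV : ∀ K : ℝ, Tendsto (fun q : ℕ × Ω => V q.1 q.2)
      (comap Prod.fst atTop ⊓ 𝓟 {q | R q.1 q.2 ≤ K}) (𝓝 0)) :
    TendstoInMeasure P V atTop 0 := by
  rw [tendstoInMeasure_iff_measureReal_norm]
  intro δ hδ
  simp only [Pi.zero_apply, sub_zero]
  rw [Metric.tendsto_atTop']
  intro θ hθ
  -- Markov's inequality bounds the probability of `{R n ≥ K}` by `C / K < θ`.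
  set K : ℝ := (|C| + 1) / θ with hK
  have hK0 : 0 < K := by positivity
  have h1 : ∀ᶠ q : ℕ × Ω in comap Prod.fst atTop ⊓ 𝓟 {q | R q.1 q.2 ≤ K}, ‖V q.1 q.2‖ < δ := by
    have := (hV K).norm
    rw [norm_zero] at this
    exact this.eventually_lt_const hδ
  rw [eventually_inf_principal, eventually_comap] at h1
  have h2 : ∀ᶠ n in atTop, P.real {ω | δ ≤ ‖V n ω‖} < θ := by
    filter_upwards [h1, hi, hC] with n h1 hi hC
    have hsub : {ω | δ ≤ ‖V n ω‖} ⊆ {ω | K ≤ R n ω} := by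
      intro ω hω
      by_contra hlt
      exact absurd (h1 (n, ω) rfl (not_le.1 hlt).le) (not_lt.2 hω)
    have hm := mul_meas_ge_le_integral_of_nonneg (ae_of_all P (hR n)) hi K
    have h3 : P.real {ω | δ ≤ ‖V n ω‖} ≤ P.real {ω | K ≤ R n ω} := measureReal_mono hsub
    have h4 : K * P.real {ω | δ ≤ ‖V n ω‖} ≤ C := by
      refine le_trans ?_ (hm.trans hC)
      gcongr
    by_contra h5
    have h6 : K * θ ≤ K * P.real {ω | δ ≤ ‖V n ω‖} := by gcongr; exact not_lt.1 h5
    have h7 : K * θ = |C| + 1 := by rw [hK]; field_simp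
    linarith [le_abs_self C]
  obtain ⟨N, hN⟩ := eventually_atTop.1 h2
  refine ⟨N, fun n hn => ?_⟩
  rw [Real.dist_eq, sub_zero, abs_of_nonneg measureReal_nonneg]
  exact hN n hn.le

end limit

/-! ### The bias expansion -/

section bias

variable {fX g τsq : ℝ → ℝ} {σ lam x : ℝ} {ν : Measure ℝ}

lemma integral_mul_density (hf : Measurable fX) (hf0 : ∀ t, 0 ≤ fX t) (F : ℝ → ℝ) :
    ∫ t, F t ∂(volume.withDensity fun t => ENNReal.ofReal (fX t)) = ∫ t, fX t * F t := by
  rw [integral_withDensity_eq_integral_toReal_smul (by fun_prop)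
    (ae_of_all _ fun _ => ENNReal.ofReal_lt_top)]
  simp [ENNReal.toReal_ofReal (hf0 _)]

lemma fSm_eq (hf : Measurable fX) (hf0 : ∀ t, 0 ≤ fX t)
    (hν : ν = volume.withDensity fun t => ENNReal.ofReal (fX t)) (j : ℕ) :
    fSm fX σ j lam x = ∫ t, t ^ j * phi t x ((1 + lam) * σ ^ 2) ∂ν := by
  rw [hν, integral_mul_density hf hf0, fSm]
  congr with t
  ring

lemma gSm_eq (hf : Measurable fX) (hf0 : ∀ t, 0 ≤ fX t)
    (hν : ν = volume.withDensity fun t => ENNReal.ofReal (fX t)) (j : ℕ) :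
    gSm fX g σ j lam x = ∫ t, t ^ j * (g t * phi t x ((1 + lam) * σ ^ 2)) ∂ν := by
  rw [hν, integral_mul_density hf hf0, gSm]
  congr with t
  ring

lemma fSm_zero_eq (hf : Measurable fX) (hf0 : ∀ t, 0 ≤ fX t)
    (hν : ν = volume.withDensity fun t => ENNReal.ofReal (fX t)) :
    fSm fX σ 0 lam x = smooth ν (fun _ => 1) x ((1 + lam) * σ ^ 2) := by
  simp [fSm_eq hf hf0 hν, smooth]

lemma gSm_zero_eq (hf : Measurable fX) (hf0 : ∀ t, 0 ≤ fX t)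
    (hν : ν = volume.withDensity fun t => ENNReal.ofReal (fX t)) :
    gSm fX g σ 0 lam x = smooth ν g x ((1 + lam) * σ ^ 2) := by
  simp [gSm_eq hf hf0 hν, smooth]

lemma GSm_zero_eq (hf : Measurable fX) (hf0 : ∀ t, 0 ≤ fX t)
    (hν : ν = volume.withDensity fun t => ENNReal.ofReal (fX t)) :
    GSm fX g σ 0 lam x = smooth ν (fun t => g t ^ 2) x ((1 + lam) * σ ^ 2) := by
  rw [smooth, hν, integral_mul_density hf hf0, GSm]
  congr with t
  ring

lemma HSm_zero_eq (hf : Measurable fX) (hf0 : ∀ t, 0 ≤ fX t)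
    (hν : ν = volume.withDensity fun t => ENNReal.ofReal (fX t)) :
    HSm fX τsq σ 0 lam x = smooth ν τsq x ((1 + lam) * σ ^ 2) := by
  rw [smooth, hν, integral_mul_density hf hf0, HSm]
  congr with t
  ring

/-- The first moment of a smoothed weight about the point of estimation. -/
lemma integral_id_mul_sub {w : ℝ → ℝ} (hw : Measurable w) {s s' : ℝ}
    (hi : Integrable (fun t => w t * phi t x s') ν) (h₁ : 0 < s) (h₂ : s < s') :
    ∫ t, t * (w t * phi t x s) ∂ν - x * smooth ν w x s = s * smooth₁ ν w x s := by
  obtain ⟨i0, i1, -⟩ := integrable_smooth hw hi h₁ h₂ (y := x) (by simp)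
  have e : ∀ t, t * (w t * phi t x s) = x * (w t * phi t x s) + s * (w t * phi₁ t x s) := by
    intro t
    rw [phi₁]
    field_simp
    ring
  simp_rw [e]
  rw [integral_add (i0.const_mul _) (i1.const_mul _), integral_const_mul, integral_const_mul,
    smooth, smooth₁]
  ring

/-- The first moments of the smoothed weights about `x` equal `S` times derivatives in the centre.
The two factors `S` so produced cancel `(λ+1)²σ⁴ = S²`, leaving a formula in smoothings and their
derivatives only. -/
lemma bias_eq [IsFiniteMeasure ν] (hf : Measurable fX) (hf0 : ∀ t, 0 ≤ fX t)
    (hν : ν = volume.withDensity fun t => ENNReal.ofReal (fX t)) (hg : Measurable g)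
    (hs : 0 < (1 + lam) * σ ^ 2) {s' : ℝ} (hs' : (1 + lam) * σ ^ 2 < s')
    (hi : Integrable (fun t => g t * phi t x s') ν)
    (hF : smooth ν (fun _ => 1) x ((1 + lam) * σ ^ 2) ≠ 0) :
    bias fX g σ lam x =
      (smooth ν (fun _ => 1) x ((1 + lam) * σ ^ 2) * smooth₂ ν g x ((1 + lam) * σ ^ 2)
        - smooth₂ ν (fun _ => 1) x ((1 + lam) * σ ^ 2) * smooth ν g x ((1 + lam) * σ ^ 2))
        / (2 * smooth ν (fun _ => 1) x ((1 + lam) * σ ^ 2) ^ 2)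
      + smooth₁ ν (fun _ => 1) x ((1 + lam) * σ ^ 2) *
        (smooth ν g x ((1 + lam) * σ ^ 2) * smooth₁ ν (fun _ => 1) x ((1 + lam) * σ ^ 2)
        - smooth ν (fun _ => 1) x ((1 + lam) * σ ^ 2) * smooth₁ ν g x ((1 + lam) * σ ^ 2))
        / smooth ν (fun _ => 1) x ((1 + lam) * σ ^ 2) ^ 3 := by
  have hi1 : Integrable (fun t => (1 : ℝ) * phi t x s') ν := integrable_one_mul_phi (hs.trans hs') x
  have h1 := integral_id_mul_sub measurable_const hi1 hs hs'
  have h2 := integral_id_mul_sub hg hi hs hs'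
  have e1 : fSm fX σ 1 lam x = ∫ t, t * (1 * phi t x ((1 + lam) * σ ^ 2)) ∂ν := by
    rw [fSm_eq hf hf0 hν]; simp
  have e2 : gSm fX g σ 1 lam x = ∫ t, t * (g t * phi t x ((1 + lam) * σ ^ 2)) ∂ν := by
    rw [gSm_eq hf hf0 hν]; simp
  rw [← e1] at h1
  rw [← e2] at h2
  have e3 : (fun y => fSm fX σ 0 lam y) =
      fun y => smooth ν (fun _ => 1) y ((1 + lam) * σ ^ 2) := by
    ext y; exact fSm_zero_eq hf hf0 hν
  have e4 : (fun y => gSm fX g σ 0 lam y) = fun y => smooth ν g y ((1 + lam) * σ ^ 2) := by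
    ext y; exact gSm_zero_eq hf hf0 hν
  rw [bias, e3, e4, iteratedDeriv_two_smooth measurable_const hi1 hs hs',
    iteratedDeriv_two_smooth hg hi hs hs', fSm_zero_eq hf hf0 hν, gSm_zero_eq hf hf0 hν]
  rw [show (lam + 1) ^ 2 * σ ^ 4 = ((1 + lam) * σ ^ 2) ^ 2 by ring]
  set s := (1 + lam) * σ ^ 2
  set F := smooth ν (fun _ => 1) x s
  set G := smooth ν g x s
  have h3 : G * fSm fX σ 1 lam x - F * gSm fX g σ 1 lam x =
      s * (G * smooth₁ ν (fun _ => 1) x s - F * smooth₁ ν g x s) := by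
    linear_combination G * h1 - F * h2
  rw [h1, h3]
  congr 1
  field_simp

/-- The local linear ratio formed from the expected sums, as a function of the squared
bandwidth. -/
noncomputable def meanRatio (ν : Measure ℝ) (g : ℝ → ℝ) (x s u : ℝ) : ℝ :=
  ((smooth ν (fun _ => 1) x (s + u) + u * smooth₂ ν (fun _ => 1) x (s + u)) *
      smooth ν g x (s + u)
    - u * (smooth₁ ν (fun _ => 1) x (s + u) * smooth₁ ν g x (s + u))) /
  ((smooth ν (fun _ => 1) x (s + u) + u * smooth₂ ν (fun _ => 1) x (s + u)) *
      smooth ν (fun _ => 1) x (s + u)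
    - u * (smooth₁ ν (fun _ => 1) x (s + u) ^ 2))

/-- Terms carrying a factor `u` are differentiable at `0` as soon as the cofactor is continuous
there, so the bias expansion never differentiates `smooth₁` or `smooth₂` in the variance. -/
lemma hasDerivAt_id_mul_of_continuousAt {f : ℝ → ℝ} (hf : ContinuousAt f 0) :
    HasDerivAt (fun u => u * f u) (f 0) 0 := by
  rw [hasDerivAt_iff_tendsto_slope_zero]
  refine (hf.tendsto.mono_left nhdsWithin_le_nhds).congr' ?_
  filter_upwards [self_mem_nhdsWithin] with u hu
  have : u ≠ 0 := hu
  simp [this]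

lemma hasDerivAt_meanRatio [IsFiniteMeasure ν] (hg : Measurable g) {s s' : ℝ} (hs : 0 < s)
    (hs' : s < s') (hi : Integrable (fun t => g t * phi t x s') ν)
    (hF : smooth ν (fun _ => 1) x s ≠ 0) :
    HasDerivAt (meanRatio ν g x s)
      ((smooth ν (fun _ => 1) x s * smooth₂ ν g x s - smooth₂ ν (fun _ => 1) x s * smooth ν g x s)
        / (2 * smooth ν (fun _ => 1) x s ^ 2)
      + smooth₁ ν (fun _ => 1) x s * (smooth ν g x s * smooth₁ ν (fun _ => 1) x s
        - smooth ν (fun _ => 1) x s * smooth₁ ν g x s) / smooth ν (fun _ => 1) x s ^ 3) 0 := by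
  have hi1 : Integrable (fun t => (1 : ℝ) * phi t x s') ν := integrable_one_mul_phi (hs.trans hs') x
  have dF := (hasDerivAt_smooth_var (w := fun _ => (1 : ℝ)) measurable_const hi1 hs hs')
  have dG := hasDerivAt_smooth_var hg hi hs hs'
  have cF₂ := continuousAt_smooth₂_var (w := fun _ => (1 : ℝ)) measurable_const hi1 hs hs'
  have cF₁ := continuousAt_smooth₁_var (w := fun _ => (1 : ℝ)) measurable_const hi1 hs hs'
  have cG₁ := continuousAt_smooth₁_var hg hi hs hs'
  have hsh : ContinuousAt (fun u : ℝ => s + u) 0 := by fun_prop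
  have e0 : s + 0 = s := add_zero s
  have dF' : HasDerivAt (fun u => smooth ν (fun _ => 1) x (s + u))
      (smooth₂ ν (fun _ => 1) x s / 2) 0 := by
    rw [← e0] at dF
    simpa using dF.comp_const_add s 0
  have dG' : HasDerivAt (fun u => smooth ν g x (s + u)) (smooth₂ ν g x s / 2) 0 := by
    rw [← e0] at dG
    simpa using dG.comp_const_add s 0
  have cF₂' : ContinuousAt (fun u => smooth₂ ν (fun _ => 1) x (s + u)) 0 :=
    ContinuousAt.comp (g := fun s => smooth₂ ν (fun _ => 1) x s) (f := fun u : ℝ => s + u) (by rwa [e0]) hsh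
  have cF₁' : ContinuousAt (fun u => smooth₁ ν (fun _ => 1) x (s + u)) 0 :=
    ContinuousAt.comp (g := fun s => smooth₁ ν (fun _ => 1) x s) (f := fun u : ℝ => s + u) (by rwa [e0]) hsh
  have cG₁' : ContinuousAt (fun u => smooth₁ ν g x (s + u)) 0 :=
    ContinuousAt.comp (g := fun s => smooth₁ ν g x s) (f := fun u : ℝ => s + u) (by rwa [e0]) hsh
  -- At `u = 0`, with `F`, `F₁`, `F₂`, `G`, `G₁`, `G₂` the smoothings, the numerator has derivative
  -- `3F₂G/2 + FG₂/2 - F₁G₁` and the denominator `2FF₂ - F₁²`; the quotient rule then gives the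
  -- bias.
  have dQ := dF'.add (hasDerivAt_id_mul_of_continuousAt cF₂')
  have dN := (dQ.mul dG').sub (hasDerivAt_id_mul_of_continuousAt (cF₁'.mul cG₁'))
  have dM := (dQ.mul dF').sub (hasDerivAt_id_mul_of_continuousAt (cF₁'.pow 2))
  have dD := dN.div dM (by simpa using hF)
  refine dD.congr_deriv ?_
  simp only [Pi.add_apply, Pi.sub_apply, Pi.mul_apply, Pi.pow_apply, zero_mul, sub_zero, add_zero]
  field_simp
  ring

lemma meanRatio_isLittleO [IsFiniteMeasure ν] (hf : Measurable fX) (hf0 : ∀ t, 0 ≤ fX t)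
    (hν : ν = volume.withDensity fun t => ENNReal.ofReal (fX t)) (hg : Measurable g)
    (hs : 0 < (1 + lam) * σ ^ 2) {s' : ℝ} (hs' : (1 + lam) * σ ^ 2 < s')
    (hi : Integrable (fun t => g t * phi t x s') ν)
    (hF : smooth ν (fun _ => 1) x ((1 + lam) * σ ^ 2) ≠ 0)
    {h : ℕ → ℝ} (hh : Tendsto h atTop (𝓝 0)) :
    (fun n => gSm fX g σ 0 lam x / fSm fX σ 0 lam x + h n ^ 2 * bias fX g σ lam x
      - meanRatio ν g x ((1 + lam) * σ ^ 2) (h n ^ 2)) =o[atTop] fun n => h n ^ 2 := by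
  have hd := hasDerivAt_meanRatio hg hs hs' hi hF
  rw [← bias_eq hf hf0 hν hg hs hs' hi hF, hasDerivAt_iff_isLittleO] at hd
  have hh2 : Tendsto (fun n => h n ^ 2) atTop (𝓝 0) := by simpa using hh.pow 2
  have := (hd.comp_tendsto hh2).neg_left
  refine (this.congr (fun n => ?_) fun n => by simp)
  have e0 : meanRatio ν g x ((1 + lam) * σ ^ 2) 0 = gSm fX g σ 0 lam x / fSm fX σ 0 lam x := by
    rw [gSm_zero_eq hf hf0 hν, fSm_zero_eq hf hf0 hν, meanRatio]
    simp only [add_zero, zero_mul, sub_zero]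
    exact mul_div_mul_left _ _ hF
  simp only [Function.comp_apply, sub_zero, smul_eq_mul, e0]
  ring

end bias

/-! ### Linearization of the local linear ratio -/

section linearization

variable {ι : Type*} {l : Filter ι}

lemma tendsto_zero_mul_of_eventually_abs_le {f b : ι → ℝ} {K : ℝ} (hf : Tendsto f l (𝓝 0))
    (hb : ∀ᶠ i in l, |b i| ≤ K) : Tendsto (fun i => f i * b i) l (𝓝 0) := by
  refine squeeze_zero_norm' (a := fun i => |f i| * K) ?_ (by simpa using hf.abs.mul_const K)
  filter_upwards [hb] with i hi
  rw [Real.norm_eq_abs, abs_mul]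
  gcongr

/-- If the five sums entering the local linear ratio are within `O(1/r)` of their means, the last
two only after multiplication with `h → 0`, then the error of the ratio is asymptotically
linear. -/
lemma tendsto_ratio_sub_linear {A B q α τ F G Q a t h r D : ι → ℝ} {F₀ G₀ a₀ t₀ K : ℝ}
    (hF₀ : F₀ ≠ 0) (hF : Tendsto F l (𝓝 F₀)) (hQ : Tendsto Q l (𝓝 F₀)) (hG : Tendsto G l (𝓝 G₀))
    (ha : Tendsto a l (𝓝 a₀)) (ht : Tendsto t l (𝓝 t₀)) (hh : Tendsto h l (𝓝 0))
    (hr : Tendsto r l atTop)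
    (hD : ∀ i, D i = (Q i * G i - h i ^ 2 * (a i * t i)) / (Q i * F i - h i ^ 2 * a i ^ 2))
    (bA : ∀ᶠ i in l, |r i * (A i - F i)| ≤ K) (bq : ∀ᶠ i in l, |r i * (q i - Q i)| ≤ K)
    (bB : ∀ᶠ i in l, |r i * (B i - G i)| ≤ K)
    (bα : ∀ᶠ i in l, |r i * (h i * (α i - a i))| ≤ K)
    (bτ : ∀ᶠ i in l, |r i * (h i * (τ i - t i))| ≤ K) :
    Tendsto (fun i => r i * ((q i * B i - h i ^ 2 * (α i * τ i)) /
      (q i * A i - h i ^ 2 * α i ^ 2) - D i) -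
      F₀⁻¹ * (r i * ((B i - G i) - D i * (A i - F i)))) l (𝓝 0) := by
  set x₁ := fun i => r i * (A i - F i) with hx₁
  set x₂ := fun i => r i * (q i - Q i) with hx₂
  set x₃ := fun i => r i * (B i - G i) with hx₃
  set x₄ := fun i => r i * (h i * (α i - a i)) with hx₄
  set x₅ := fun i => r i * (h i * (τ i - t i)) with hx₅
  set u := fun i => (r i)⁻¹ with hu
  have tu : Tendsto u l (𝓝 0) := hr.inv_tendsto_atTop
  have hr0 : ∀ᶠ i in l, r i ≠ 0 := hr.eventually_ne_atTop 0
  have tux : ∀ {b : ι → ℝ}, (∀ᶠ i in l, |b i| ≤ K) → Tendsto (fun i => u i * b i) l (𝓝 0) :=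
    fun hb => tendsto_zero_mul_of_eventually_abs_le tu hb
  have tha : Tendsto (fun i => h i * a i) l (𝓝 0) := by simpa using hh.mul ha
  have tht : Tendsto (fun i => h i * t i) l (𝓝 0) := by simpa using hh.mul ht
  have tQG : Tendsto (fun i => Q i * G i - h i ^ 2 * (a i * t i)) l (𝓝 (F₀ * G₀)) := by
    have := (hQ.mul hG).sub (tha.mul tht)
    simp only [mul_zero, sub_zero] at this
    exact this.congr fun i => by ring
  have tQF : Tendsto (fun i => Q i * F i - h i ^ 2 * a i ^ 2) l (𝓝 (F₀ * F₀)) := by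
    have := (hQ.mul hF).sub (tha.mul tha)
    simp only [mul_zero, sub_zero] at this
    exact this.congr fun i => by ring
  have hFF : F₀ * F₀ ≠ 0 := mul_ne_zero hF₀ hF₀
  have tD : Tendsto D l (𝓝 (G₀ / F₀)) := by
    have := tQG.div tQF hFF
    rw [mul_div_mul_left _ _ hF₀] at this
    exact this.congr fun i => (hD i).symm
  have tq : Tendsto (fun i => Q i + u i * x₂ i) l (𝓝 F₀) := by simpa using hQ.add (tux bq)
  have tA : Tendsto (fun i => F i + u i * x₁ i) l (𝓝 F₀) := by simpa using hF.add (tux bA)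
  have tα : Tendsto (fun i => h i * a i + u i * x₄ i) l (𝓝 0) := by simpa using tha.add (tux bα)
  set M := fun i => (Q i + u i * x₂ i) * (F i + u i * x₁ i) - (h i * a i + u i * x₄ i) ^ 2 with hM
  have tM : Tendsto M l (𝓝 (F₀ * F₀)) := by
    simpa using (tq.mul tA).sub (tα.pow 2)
  have tqM : Tendsto (fun i => (Q i + u i * x₂ i) / M i - F₀⁻¹) l (𝓝 0) := by
    have := (tq.div tM hFF).sub_const F₀⁻¹
    have e : F₀ / (F₀ * F₀) - F₀⁻¹ = 0 := by field_simp; ring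
    rwa [e] at this
  -- The leading deviations `x₃ - D x₁` have coefficient `q/M`, which tends to `1/F₀`.
  have tlead : Tendsto (fun i => ((Q i + u i * x₂ i) / M i - F₀⁻¹) * (x₃ i - D i * x₁ i)) l
      (𝓝 0) := by
    have h1 := tendsto_zero_mul_of_eventually_abs_le tqM bB
    have h2 : Tendsto (fun i => ((Q i + u i * x₂ i) / M i - F₀⁻¹) * D i * x₁ i) l (𝓝 0) := by
      refine tendsto_zero_mul_of_eventually_abs_le ?_ bA
      simpa using tqM.mul tD
    have := h1.sub h2
    simp only [sub_zero] at this
    exact this.congr fun i => by simp only [hx₃]; ring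
  have tGD : Tendsto (fun i => G i - D i * F i) l (𝓝 0) := by
    have := hG.sub (tD.mul hF)
    rwa [div_mul_cancel₀ _ hF₀, sub_self] at this
  have ttD : Tendsto (fun i => h i * t i - D i * (h i * a i)) l (𝓝 0) := by
    simpa using tht.sub (tD.mul tha)
  have thaD : Tendsto (fun i => h i * a i * D i) l (𝓝 0) := by simpa using tha.mul tD
  have tux4 := tux bα
  have tux4D : Tendsto (fun i => u i * x₄ i * D i) l (𝓝 0) := by simpa using tux4.mul tD
  -- Every other deviation is bounded and has a vanishing coefficient: `G - DF` for `x₂`, terms of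
  -- order `h` for `x₄` and `x₅`, and for the products an extra factor `u = 1/r`.
  have trest : Tendsto (fun i => (M i)⁻¹ * (((G i - D i * F i) * x₂ i) -
      ((h i * t i - D i * (h i * a i)) * x₄ i + (h i * a i * x₅ i - h i * a i * D i * x₄ i) +
        (u i * x₄ i * x₅ i - u i * x₄ i * D i * x₄ i)))) l (𝓝 0) := by
    have h1 := tendsto_zero_mul_of_eventually_abs_le tGD bq
    have h2 := tendsto_zero_mul_of_eventually_abs_le ttD bα
    have h3 := tendsto_zero_mul_of_eventually_abs_le tha bτ
    have h4 := tendsto_zero_mul_of_eventually_abs_le thaD bα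
    have h5 := tendsto_zero_mul_of_eventually_abs_le tux4 bτ
    have h6 := tendsto_zero_mul_of_eventually_abs_le tux4D bα
    simpa using (tM.inv₀ hFF).mul (h1.sub ((h2.add (h3.sub h4)).add (h5.sub h6)))
  have := tlead.add trest
  rw [add_zero] at this
  refine this.congr' ?_
  filter_upwards [hr0, tM.eventually_ne hFF, tQF.eventually_ne hFF] with i hr0 hM0 hQF
  have hD' : D i * (Q i * F i - h i ^ 2 * a i ^ 2) = Q i * G i - h i ^ 2 * (a i * t i) := by
    rw [hD, div_mul_cancel₀ _ hQF]
  have hru : r i * u i = 1 := mul_inv_cancel₀ hr0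
  have e₁ : u i * x₁ i = A i - F i := by simp only [hx₁, hu]; field_simp
  have e₂ : u i * x₂ i = q i - Q i := by simp only [hx₂, hu]; field_simp
  have e₃ : u i * x₃ i = B i - G i := by simp only [hx₃, hu]; field_simp
  have e₄ : u i * x₄ i = h i * (α i - a i) := by simp only [hx₄, hu]; field_simp
  have e₅ : u i * x₅ i = h i * (τ i - t i) := by simp only [hx₅, hu]; field_simp
  have eM : M i = q i * A i - h i ^ 2 * α i ^ 2 := by
    simp only [hM, e₁, e₂, e₄]; ring
  have key : q i * B i - h i ^ 2 * (α i * τ i) - D i * M i =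
      u i * ((Q i + u i * x₂ i) * (x₃ i - D i * x₁ i) + (((G i - D i * F i) * x₂ i) -
      ((h i * t i - D i * (h i * a i)) * x₄ i + (h i * a i * x₅ i - h i * a i * D i * x₄ i) +
        (u i * x₄ i * x₅ i - u i * x₄ i * D i * x₄ i)))) := by
    have e : u i * ((Q i + u i * x₂ i) * (x₃ i - D i * x₁ i) + (((G i - D i * F i) * x₂ i) -
      ((h i * t i - D i * (h i * a i)) * x₄ i + (h i * a i * x₅ i - h i * a i * D i * x₄ i) +
        (u i * x₄ i * x₅ i - u i * x₄ i * D i * x₄ i)))) =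
      (Q i + u i * x₂ i) * (u i * x₃ i - D i * (u i * x₁ i)) + (((G i - D i * F i) * (u i * x₂ i)) -
      ((h i * t i - D i * (h i * a i)) * (u i * x₄ i) +
        (h i * a i * (u i * x₅ i) - h i * a i * D i * (u i * x₄ i)) +
        (u i * x₄ i * (u i * x₅ i) - u i * x₄ i * D i * (u i * x₄ i)))) := by ring
    rw [e, e₁, e₂, e₃, e₄, e₅, eM]
    linear_combination -hD'
  have hlead : r i * ((B i - G i) - D i * (A i - F i)) = x₃ i - D i * x₁ i := by
    simp only [hx₃, hx₁]; ring
  have hmain : r i * ((q i * B i - h i ^ 2 * (α i * τ i)) / M i - D i) =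
      (M i)⁻¹ * ((Q i + u i * x₂ i) * (x₃ i - D i * x₁ i) + (((G i - D i * F i) * x₂ i) -
      ((h i * t i - D i * (h i * a i)) * x₄ i + (h i * a i * x₅ i - h i * a i * D i * x₄ i) +
        (u i * x₄ i * x₅ i - u i * x₄ i * D i * x₄ i)))) := by
    rw [div_sub' hM0, mul_comm (M i) (D i), key, mul_div_assoc', ← mul_assoc, hru, one_mul,
      div_eq_inv_mul]
  rw [← eM, hlead, hmain]
  ring

end linearization

/-! ### The estimator as a ratio of empirical means -/

section estimator

variable {Ω : Type*} {X U ε : ℕ → Ω → ℝ} {fX g τsq μ₃ : ℝ → ℝ} {σ lam x : ℝ}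

/-- The triple `(X_i, U_i, ε_i)`. -/
def obs (X U ε : ℕ → Ω → ℝ) (i : ℕ) (ω : Ω) : ℝ × ℝ × ℝ := (X i ω, U i ω, ε i ω)

/-- `Z = X + U` as a function of the triple. -/
def zOf (e : ℝ × ℝ × ℝ) : ℝ := e.1 + e.2.1

/-- `Y = g(X) + ε` as a function of the triple. -/
def yOf (g : ℝ → ℝ) (e : ℝ × ℝ × ℝ) : ℝ := g e.1 + e.2.2

@[fun_prop]
lemma measurable_zOf : Measurable zOf := by unfold zOf; fun_prop

lemma measurable_yOf (hg : Measurable g) : Measurable (yOf g) := by unfold yOf; fun_prop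

lemma An_eq (b : ℝ) (n : ℕ) (ω : Ω) (j : ℕ) :
    An σ lam b x n (fun i => X i ω + U i ω) j = empMean (obs X U ε)
      (fun e => (zOf e - x) ^ j * phi (zOf e) x (b ^ 2 + lam * σ ^ 2)) n ω := by
  simp only [An, empMean, zOf, obs, phi_comm x]

lemma Bn_eq (b : ℝ) (n : ℕ) (ω : Ω) (j : ℕ) :
    Bn σ lam b x n (fun i => X i ω + U i ω) (fun i => g (X i ω) + ε i ω) j =
      empMean (obs X U ε)
        (fun e => yOf g e * (zOf e - x) ^ j * phi (zOf e) x (b ^ 2 + lam * σ ^ 2)) n ω := by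
  simp only [Bn, empMean, zOf, yOf, obs, phi_comm x]

lemma empMean_const_mul {E : Type*} {W : ℕ → Ω → E} (c : ℝ) (p : E → ℝ) (n : ℕ) (ω : Ω) :
    empMean W (fun e => c * p e) n ω = c * empMean W p n ω := by
  simp only [empMean, ← Finset.mul_sum]
  ring

lemma empMean_add {E : Type*} {W : ℕ → Ω → E} (p q : E → ℝ) (n : ℕ) (ω : Ω) :
    empMean W (fun e => p e + q e) n ω = empMean W p n ω + empMean W q n ω := by
  simp only [empMean, Finset.sum_add_distrib]
  ring

/-- The estimator in terms of empirical means whose expectations have limits. -/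
lemma ghat_eq {b : ℝ} (hb : 0 < b) (hlam : 0 ≤ lam) (n : ℕ) (ω : Ω) :
    ghat σ lam b x n (fun i => X i ω + U i ω) (fun i => g (X i ω) + ε i ω) =
      (empMean (obs X U ε) (fun e => phi (zOf e) x (b ^ 2 + lam * σ ^ 2) +
            b ^ 2 * phi₂ (zOf e) x (b ^ 2 + lam * σ ^ 2)) n ω *
          empMean (obs X U ε) (fun e => yOf g e * phi (zOf e) x (b ^ 2 + lam * σ ^ 2)) n ω -
        b ^ 2 * (empMean (obs X U ε) (fun e => phi₁ (zOf e) x (b ^ 2 + lam * σ ^ 2)) n ω *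
          empMean (obs X U ε) (fun e => yOf g e * phi₁ (zOf e) x (b ^ 2 + lam * σ ^ 2)) n ω)) /
      (empMean (obs X U ε) (fun e => phi (zOf e) x (b ^ 2 + lam * σ ^ 2) +
            b ^ 2 * phi₂ (zOf e) x (b ^ 2 + lam * σ ^ 2)) n ω *
          empMean (obs X U ε) (fun e => phi (zOf e) x (b ^ 2 + lam * σ ^ 2)) n ω -
        b ^ 2 * empMean (obs X U ε) (fun e => phi₁ (zOf e) x (b ^ 2 + lam * σ ^ 2)) n ω ^ 2) := by
  have hs : 0 < b ^ 2 + lam * σ ^ 2 := by positivity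
  set s := b ^ 2 + lam * σ ^ 2 with hsdef
  have hS0 : S0 σ lam b x n (fun i => X i ω + U i ω) =
      empMean (obs X U ε) (fun e => phi (zOf e) x s) n ω := by
    simp [S0, An_eq (ε := ε), hsdef]
  have hT0 : T0 σ lam b x n (fun i => X i ω + U i ω) (fun i => g (X i ω) + ε i ω) =
      empMean (obs X U ε) (fun e => yOf g e * phi (zOf e) x s) n ω := by
    simp [T0, Bn_eq, hsdef]
  have hS1 : S1 σ lam b x n (fun i => X i ω + U i ω) =
      b ^ 2 * empMean (obs X U ε) (fun e => phi₁ (zOf e) x s) n ω := by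
    rw [S1, An_eq (ε := ε), ratio, ← hsdef, ← empMean_const_mul, ← empMean_const_mul]
    congr 1
    ext e
    rw [phi₁]
    ring
  have hT1 : T1 σ lam b x n (fun i => X i ω + U i ω) (fun i => g (X i ω) + ε i ω) =
      b ^ 2 * empMean (obs X U ε) (fun e => yOf g e * phi₁ (zOf e) x s) n ω := by
    rw [T1, Bn_eq, ratio, ← hsdef, ← empMean_const_mul, ← empMean_const_mul]
    congr 1
    ext e
    rw [phi₁]
    ring
  have hS2 : S2 σ lam b x n (fun i => X i ω + U i ω) =
      b ^ 2 * empMean (obs X U ε) (fun e => phi (zOf e) x s + b ^ 2 * phi₂ (zOf e) x s) n ω := by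
    rw [S2, An_eq (ε := ε), An_eq (ε := ε), ratio, ← hsdef, ← empMean_const_mul,
      ← empMean_const_mul, ← empMean_const_mul, ← empMean_add]
    congr 1
    ext e
    -- Substituting `λσ² = s - b²` turns the second-order weight into `b² (φ + b² φ₂)`.
    have : lam * σ ^ 2 = s - b ^ 2 := by rw [hsdef]; ring
    rw [phi₂, this]
    field_simp
    ring
  rw [ghat, hS0, hS1, hS2, hT0, hT1]
  have hb2 : b ^ 2 ≠ 0 := by positivity
  refine Eq.trans ?_ (mul_div_mul_left _ _ hb2)
  congr 1 <;> ring

/-! ### Moments of the weights -/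

section moments

variable [MeasurableSpace Ω] {P : Measure Ω} [IsProbabilityMeasure P]

lemma Model.measurable_obs (m : Model P X U ε fX τsq μ₃ σ) (i : ℕ) : Measurable (obs X U ε i) :=
  (m.measurable_X i).prodMk ((m.measurable_U i).prodMk (m.measurable_ε i))

lemma Model.integrable_Y_mul_phi (m : Model P X U ε fX τsq μ₃ σ) (hg : Measurable g) {s : ℝ}
    (hs : 0 < s)
    (hi : Integrable (fun ω => (g (X 0 ω) + ε 0 ω) ^ 2 * phi (X 0 ω + U 0 ω) x s) P) :
    Integrable (fun ω => (g (X 0 ω) + ε 0 ω) * phi (X 0 ω + U 0 ω) x s) P := by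
  have h1 : Integrable (fun ω => phi (X 0 ω + U 0 ω) x s) P :=
    m.integrable_of_abs_le (p := fun z => phi z x s) (by fun_prop) (fun z => by
      rw [abs_of_nonneg (phi_nonneg _ _ _)]; exact phi_le hs z x)
  refine (h1.add hi).mono' ((m.measurable_Y hg 0).mul
    ((measurable_phi_left x s).comp (m.measurable_Z 0))).aestronglyMeasurable
    (ae_of_all _ fun ω => ?_)
  have hp := phi_nonneg (X 0 ω + U 0 ω) x s
  rw [Real.norm_eq_abs, abs_mul, abs_of_nonneg hp, Pi.add_apply]
  rw [← sq_abs (g (X 0 ω) + ε 0 ω)]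
  nlinarith [mul_nonneg hp (sq_nonneg (|g (X 0 ω) + ε 0 ω| - 1)),
    mul_nonneg hp (sq_nonneg (|g (X 0 ω) + ε 0 ω|))]

lemma Model.integral_phi (m : Model P X U ε fX τsq μ₃ σ) (hσ : 0 < σ) {s : ℝ} (hs : 0 < s) :
    Integrable (fun ω => phi (X 0 ω + U 0 ω) x s) P ∧
    ∫ ω, phi (X 0 ω + U 0 ω) x s ∂P = smooth (P.map (X 0)) (fun _ => 1) x (s + σ ^ 2) := by
  have h1 : Integrable (fun ω => phi (X 0 ω + U 0 ω) x s) P :=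
    m.integrable_of_abs_le (p := fun z => phi z x s) (by fun_prop) (fun z => by
      rw [abs_of_nonneg (phi_nonneg _ _ _)]; exact phi_le hs z x)
  refine ⟨h1, ?_⟩
  rw [m.integral_Z (p := fun z => phi z x s) (by fun_prop) h1, smooth]
  simp_rw [integral_phi_add hs hσ, one_mul]

lemma Model.integral_Y_mul_phi (m : Model P X U ε fX τsq μ₃ σ) (hσ : 0 < σ) (hg : Measurable g)
    {s : ℝ} (hs : 0 < s)
    (hi : Integrable (fun ω => (g (X 0 ω) + ε 0 ω) * phi (X 0 ω + U 0 ω) x s) P) :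
    Integrable (fun t => g t * phi t x (s + σ ^ 2)) (P.map (X 0)) ∧
    ∫ ω, (g (X 0 ω) + ε 0 ω) * phi (X 0 ω + U 0 ω) x s ∂P =
      smooth (P.map (X 0)) g x (s + σ ^ 2) := by
  have := m.integral_Y_mul hg (p := fun z => phi z x s) (by fun_prop) hi
  simp only [integral_phi_add hs hσ] at this
  exact this

/-- Second moment of the kernel weighted deviation of the response from a constant. -/
lemma Model.integral_sub_mul_phi_sq (m : Model P X U ε fX τsq μ₃ σ) (hσ : 0 < σ)
    (hg : Measurable g) (hτ : Measurable τsq) {s : ℝ} (hs : 0 < s)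
    (hi : Integrable (fun t => (g t ^ 2 + τsq t) * phi t x (s / 2 + σ ^ 2)) (P.map (X 0)))
    (D : ℝ) :
    ∫ ω, ((g (X 0 ω) + ε 0 ω - D) * phi (X 0 ω + U 0 ω) x s) ^ 2 ∂P =
      (2 * √(Real.pi * s))⁻¹ *
        (smooth (P.map (X 0)) (fun t => g t ^ 2 + τsq t) x (s / 2 + σ ^ 2)
          - 2 * D * smooth (P.map (X 0)) g x (s / 2 + σ ^ 2)
          + D ^ 2 * smooth (P.map (X 0)) (fun _ => 1) x (s / 2 + σ ^ 2)) := by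
  have hs2 := half_pos hs
  have i2 := (m.integrable_Y_sq_iff hσ hg hτ hs2 x).2 hi
  have i1 := m.integrable_Y_mul_phi hg hs2 i2
  obtain ⟨i0, h0⟩ := m.integral_phi (x := x) hσ hs2
  rw [← m.integral_Y_sq hσ hg hτ hs2 x, ← (m.integral_Y_mul_phi hσ hg hs2 i1).2, ← h0,
    ← integral_const_mul, ← integral_const_mul, ← integral_sub i2 (i1.const_mul _),
    ← integral_add (f := fun ω => (g (X 0 ω) + ε 0 ω) ^ 2 * phi (X 0 ω + U 0 ω) x (s / 2) -
        2 * D * ((g (X 0 ω) + ε 0 ω) * phi (X 0 ω + U 0 ω) x (s / 2)))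
      (i2.sub (i1.const_mul _)) (i0.const_mul _), ← integral_const_mul]
  refine integral_congr_ae (ae_of_all _ fun ω => ?_)
  dsimp only
  rw [mul_pow, phi_sq hs]
  ring

/-- Squaring the kernel halves its variance and averaging over `U` adds `σ²`. This makes the extra
assumption for large `λ` interchangeable with what the condition on derivatives provides for small
`λ`. -/
lemma Model.memLp_Y_mul_phi (m : Model P X U ε fX τsq μ₃ σ) (hσ : 0 < σ) (hg : Measurable g)
    (hτ : Measurable τsq) {s : ℝ} (hs : 0 < s) :
    MemLp (fun ω => (g (X 0 ω) + ε 0 ω) * phi (X 0 ω + U 0 ω) x s) 2 P ↔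
      Integrable (fun t => (g t ^ 2 + τsq t) * phi t x (s / 2 + σ ^ 2)) (P.map (X 0)) := by
  have hm : Measurable fun ω => (g (X 0 ω) + ε 0 ω) * phi (X 0 ω + U 0 ω) x s :=
    (m.measurable_Y hg 0).mul ((measurable_phi_left x s).comp (m.measurable_Z 0))
  rw [memLp_two_iff_integrable_sq hm.aestronglyMeasurable,
    ← m.integrable_Y_sq_iff hσ hg hτ (half_pos hs) x]
  have hc : (2 * √(Real.pi * s))⁻¹ ≠ 0 := by positivity
  rw [← integrable_const_mul_iff hc.isUnit
    (fun ω => (g (X 0 ω) + ε 0 ω) ^ 2 * phi (X 0 ω + U 0 ω) x (s / 2))]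
  refine integrable_congr (ae_of_all _ fun ω => ?_)
  dsimp only
  rw [mul_pow, phi_sq hs]
  ring

lemma Model.memLp_phi (m : Model P X U ε fX τsq μ₃ σ) {s : ℝ} (hs : 0 < s) :
    MemLp (fun ω => phi (X 0 ω + U 0 ω) x s) 2 P :=
  MemLp.of_bound ((measurable_phi_left x s).comp (m.measurable_Z 0)).aestronglyMeasurable
    (√(2 * Real.pi * s))⁻¹ (ae_of_all _ fun ω => by
      rw [Real.norm_eq_abs, abs_of_nonneg (phi_nonneg _ _ _)]; exact phi_le hs _ _)

end moments

end estimator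

/-! ### Reduction to a central limit theorem for a linear statistic -/

section deviations

variable {Ω : Type*} [MeasurableSpace Ω] {P : Measure Ω} [IsProbabilityMeasure P]
  {E : Type*} [MeasurableSpace E] {W : ℕ → Ω → E} {κ : ℕ → ℝ}

/-- To prove convergence to zero in probability one may assume that finitely many normalized
empirical means are bounded. -/
lemma tendstoInMeasure_zero_of_bounded_deviations
    (hind : iIndepFun W P) (hid : ∀ i, IdentDistrib (W i) (W 0) P P) (hκ : ∀ n, 0 < κ n)
    {J : Type*} [Fintype J] {p : J → ℕ → E → ℝ} (hp : ∀ j n, Measurable (p j n))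
    (hb : ∀ j, ∃ C, ∀ᶠ n in atTop, MemLp (fun ω => p j n (W 0 ω)) 2 P ∧
      κ n * ∫ ω, p j n (W 0 ω) ^ 2 ∂P ≤ C) {V : ℕ → Ω → ℝ}
    (hV : ∀ K : ℝ, Tendsto (fun q : ℕ × Ω => V q.1 q.2) (comap Prod.fst atTop ⊓ 𝓟 {q | ∀ j,
      |√(q.1 * κ q.1) * (empMean W (p j q.1) q.1 q.2 - ∫ ω, p j q.1 (W 0 ω) ∂P)| ≤ K}) (𝓝 0)) :
    TendstoInMeasure P V atTop 0 := by
  choose C hC using hb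
  have hterm : ∀ j, ∀ᶠ n in atTop, Integrable (fun ω =>
      n * κ n * (empMean W (p j n) n ω - ∫ ω, p j n (W 0 ω) ∂P) ^ 2) P ∧
      ∫ ω, n * κ n * (empMean W (p j n) n ω - ∫ ω, p j n (W 0 ω) ∂P) ^ 2 ∂P ≤ C j := by
    intro j
    filter_upwards [hC j, eventually_gt_atTop 0] with n hn hn0
    have hn0' : (0 : ℝ) < n := by exact_mod_cast hn0
    obtain ⟨i1, i2⟩ := integral_sq_empMean_sub_le hind hid (hp j n) hn.1 hn0
    refine ⟨i1.const_mul _, ?_⟩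
    have hk := hκ n
    rw [integral_const_mul]
    calc n * κ n * ∫ ω, (empMean W (p j n) n ω - ∫ ω, p j n (W 0 ω) ∂P) ^ 2 ∂P
        ≤ n * κ n * ((n : ℝ)⁻¹ * ∫ ω, p j n (W 0 ω) ^ 2 ∂P) := by gcongr
      _ = κ n * ∫ ω, p j n (W 0 ω) ^ 2 ∂P := by field_simp
      _ ≤ C j := hn.2
  refine tendstoInMeasure_zero_of_tendsto_on (C := ∑ j, C j) (R := fun n ω => ∑ j,
    n * κ n * (empMean W (p j n) n ω - ∫ ω, p j n (W 0 ω) ∂P) ^ 2) ?_ ?_ ?_ fun K => ?_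
  · intro n ω
    have := (hκ n).le
    exact Finset.sum_nonneg fun j _ => by positivity
  · filter_upwards [eventually_all.2 hterm] with n hn
    exact integrable_finsetSum _ fun j _ => (hn j).1
  · filter_upwards [eventually_all.2 hterm] with n hn
    rw [integral_finsetSum _ fun j _ => (hn j).1]
    exact Finset.sum_le_sum fun j _ => (hn j).2
  · refine (hV √K).mono_left (inf_le_inf_left _ (principal_mono.2 ?_))
    intro q hq j
    have hk := (hκ q.1).le
    refine Real.abs_le_sqrt ?_
    rw [mul_pow, Real.sq_sqrt (by positivity)]
    refine le_trans ?_ hq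
    exact Finset.single_le_sum (f := fun j =>
      q.1 * κ q.1 * (empMean W (p j q.1) q.1 q.2 - ∫ ω, p j q.1 (W 0 ω) ∂P) ^ 2)
      (fun j _ => by positivity) (Finset.mem_univ j)

end deviations

section reduction

variable {Ω : Type*} [MeasurableSpace Ω] {P : Measure Ω} [IsProbabilityMeasure P]
  {X U ε : ℕ → Ω → ℝ} {fX g τsq μ₃ : ℝ → ℝ} {σ lam x b₀ : ℝ} {h κ : ℕ → ℝ} {Cκ : ℝ}

/-- Squaring the kernel produces a factor of order `1/√(h² + λσ²)`, and the assumption on `κ`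
compensates exactly this. Both rates, `κ = 1` for `λ > 0` and `κ = h` for `λ = 0`, are covered. -/
lemma exists_rate_bound {ν : Measure ℝ} (hσ : 0 < σ) (hlam : 0 ≤ lam) (hb₀ : 0 < b₀)
    {w : ℝ → ℝ} (hw : Measurable w)
    (hi : Integrable (fun t => w t * phi t x ((b₀ ^ 2 + lam * σ ^ 2) / 2 + σ ^ 2)) ν)
    (hpos : ∀ n, 0 < h n) (h0 : Tendsto h atTop (𝓝 0)) (hκ : ∀ n, 0 < κ n)
    (hκC : ∀ n, κ n ≤ Cκ * √(h n ^ 2 + lam * σ ^ 2)) :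
    ∃ C, ∀ᶠ n in atTop, κ n * ((2 * √(Real.pi * (h n ^ 2 + lam * σ ^ 2 + h n ^ 2)))⁻¹ *
      smooth ν w x ((h n ^ 2 + lam * σ ^ 2 + h n ^ 2) / 2 + σ ^ 2)) ≤ C := by
  have hσ2 : 0 < σ ^ 2 := by positivity
  have hc := (hasDerivAt_smooth_var (s := lam * σ ^ 2 / 2 + σ ^ 2) hw hi (by positivity)
    (by nlinarith [sq_pos_of_pos hb₀])).continuousAt
  have ht : Tendsto (fun n => (h n ^ 2 + lam * σ ^ 2 + h n ^ 2) / 2 + σ ^ 2) atTop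
      (𝓝 (lam * σ ^ 2 / 2 + σ ^ 2)) := by
    simpa using ((((h0.pow 2).add_const (lam * σ ^ 2)).add (h0.pow 2)).div_const 2).add_const
      (σ ^ 2)
  have hS := (hc.tendsto.comp ht).abs
  have hCκ : 0 ≤ Cκ := by
    have h1 := (hκ 0).trans_le (hκC 0)
    by_contra hneg
    exact absurd h1 (not_lt.2 (mul_nonpos_of_nonpos_of_nonneg (not_le.1 hneg).le
      (Real.sqrt_nonneg _)))
  refine ⟨Cκ * (|smooth ν w x (lam * σ ^ 2 / 2 + σ ^ 2)| + 1), ?_⟩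
  filter_upwards [hS.eventually_le_const (lt_add_one _)] with n hn
  have hh := hpos n
  have hk := hκ n
  set s := h n ^ 2 + lam * σ ^ 2 with hs
  have hs0 : 0 < s := by positivity
  have hq : κ n * (2 * √(Real.pi * (s + h n ^ 2)))⁻¹ ≤ Cκ := by
    have h1 : 0 < √(Real.pi * (s + h n ^ 2)) := Real.sqrt_pos.2 (by positivity)
    rw [← div_eq_mul_inv, div_le_iff₀ (by positivity)]
    refine (hκC n).trans (mul_le_mul_of_nonneg_left ?_ hCκ)
    have h2 : √s ≤ √(Real.pi * (s + h n ^ 2)) := by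
      refine Real.sqrt_le_sqrt ?_
      nlinarith [Real.pi_gt_three, sq_nonneg (h n)]
    linarith
  rw [← mul_assoc]
  calc _ ≤ κ n * (2 * √(Real.pi * (s + h n ^ 2)))⁻¹ *
        |smooth ν w x ((s + h n ^ 2) / 2 + σ ^ 2)| := by
        gcongr; exact le_abs_self _
    _ ≤ _ := by gcongr; exact hn

lemma eventually_two_sq_lt (hb₀ : 0 < b₀) (h0 : Tendsto h atTop (𝓝 0)) :
    ∀ᶠ n in atTop, h n ^ 2 + h n ^ 2 < b₀ ^ 2 := by
  have : Tendsto (fun n => h n ^ 2 + h n ^ 2) atTop (𝓝 0) := by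
    simpa using (h0.pow 2).add (h0.pow 2)
  exact this.eventually_lt_const (by positivity)

/-- The variance `s + h²` in place of `s` is that of the one kernel dominating all weights of the
local linear fit. -/
lemma Model.exists_bound_Y (m : Model P X U ε fX τsq μ₃ σ) (hσ : 0 < σ) (hg : Measurable g)
    (hτ : Measurable τsq) (hlam : 0 ≤ lam) (hb₀ : 0 < b₀)
    (hi : Integrable (fun t => (g t ^ 2 + τsq t) *
      phi t x ((b₀ ^ 2 + lam * σ ^ 2) / 2 + σ ^ 2)) (P.map (X 0)))
    (hpos : ∀ n, 0 < h n) (h0 : Tendsto h atTop (𝓝 0)) (hκ : ∀ n, 0 < κ n)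
    (hκC : ∀ n, κ n ≤ Cκ * √(h n ^ 2 + lam * σ ^ 2)) :
    ∃ C, ∀ᶠ n in atTop, MemLp (fun ω => (g (X 0 ω) + ε 0 ω) *
        phi (X 0 ω + U 0 ω) x (h n ^ 2 + lam * σ ^ 2 + h n ^ 2)) 2 P ∧
      κ n * ∫ ω, ((g (X 0 ω) + ε 0 ω) *
        phi (X 0 ω + U 0 ω) x (h n ^ 2 + lam * σ ^ 2 + h n ^ 2)) ^ 2 ∂P ≤ C := by
  have hw : Measurable fun t => g t ^ 2 + τsq t := by fun_prop
  obtain ⟨C, hC⟩ := exists_rate_bound hσ hlam hb₀ hw hi hpos h0 hκ hκC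
  refine ⟨C, ?_⟩
  filter_upwards [hC, eventually_two_sq_lt hb₀ h0] with n hn hlt
  have hh := hpos n
  have hs : 0 < h n ^ 2 + lam * σ ^ 2 + h n ^ 2 := by positivity
  have hi' := (integrable_smooth hw hi
    (s := (h n ^ 2 + lam * σ ^ 2 + h n ^ 2) / 2 + σ ^ 2) (by positivity) (by linarith)
    (y := x) (by simp)).1
  refine ⟨(m.memLp_Y_mul_phi hσ hg hτ hs).2 hi', ?_⟩
  have := m.integral_sub_mul_phi_sq hσ hg hτ hs hi' 0
  simp only [sub_zero, mul_zero, zero_mul, ne_eq, OfNat.ofNat_ne_zero, not_false_eq_true,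
    zero_pow, add_zero] at this
  rw [this]
  exact hn

lemma Model.exists_bound_one (m : Model P X U ε fX τsq μ₃ σ) (hσ : 0 < σ)
    (hlam : 0 ≤ lam) (hpos : ∀ n, 0 < h n) (h0 : Tendsto h atTop (𝓝 0)) (hκ : ∀ n, 0 < κ n)
    (hκC : ∀ n, κ n ≤ Cκ * √(h n ^ 2 + lam * σ ^ 2)) :
    ∃ C, ∀ᶠ n in atTop, MemLp (fun ω => 1 *
        phi (X 0 ω + U 0 ω) x (h n ^ 2 + lam * σ ^ 2 + h n ^ 2)) 2 P ∧
      κ n * ∫ ω, (1 * phi (X 0 ω + U 0 ω) x (h n ^ 2 + lam * σ ^ 2 + h n ^ 2)) ^ 2 ∂P ≤ C := by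
  have : IsProbabilityMeasure (P.map (X 0)) :=
    Measure.isProbabilityMeasure_map (m.measurable_X 0).aemeasurable
  obtain ⟨C, hC⟩ := exists_rate_bound (ν := P.map (X 0)) (x := x) (w := fun _ => 1) hσ hlam one_pos
    measurable_const (integrable_one_mul_phi (by positivity) x) hpos h0 hκ hκC
  refine ⟨C, hC.mono fun n hn => ?_⟩
  have hh := hpos n
  have hs : 0 < h n ^ 2 + lam * σ ^ 2 + h n ^ 2 := by positivity
  simp only [one_mul]
  refine ⟨m.memLp_phi hs, ?_⟩
  simp_rw [phi_sq hs]
  rw [integral_const_mul, (m.integral_phi hσ (half_pos hs)).2]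
  exact hn

end reduction

/-- Bounds pass to every weight dominated by a normal density. -/
lemma exists_bound_of_abs_le {Ω : Type*} [MeasurableSpace Ω] {P : Measure Ω} {κ : ℕ → ℝ} {x : ℝ}
    {T Z : Ω → ℝ} (hT : Measurable T) (hZ : Measurable Z) {s' : ℕ → ℝ}
    (hκ : ∀ n, 0 < κ n)
    (hb : ∃ C, ∀ᶠ n in atTop, MemLp (fun ω => T ω * phi (Z ω) x (s' n)) 2 P ∧
      κ n * ∫ ω, (T ω * phi (Z ω) x (s' n)) ^ 2 ∂P ≤ C)
    {p : ℕ → ℝ → ℝ} (hp : ∀ n, Measurable (p n)) (hle : ∀ n z, |p n z| ≤ 8 * phi z x (s' n)) :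
    ∃ C, ∀ᶠ n in atTop, MemLp (fun ω => T ω * p n (Z ω)) 2 P ∧
      κ n * ∫ ω, (T ω * p n (Z ω)) ^ 2 ∂P ≤ C := by
  obtain ⟨C, hC⟩ := hb
  refine ⟨64 * C, hC.mono fun n hn => ?_⟩
  have hpt : ∀ ω, |T ω * p n (Z ω)| ≤ 8 * |T ω * phi (Z ω) x (s' n)| := fun ω => by
    have := hle n (Z ω)
    rw [abs_mul, abs_mul, abs_of_nonneg (phi_nonneg (Z ω) x (s' n))]
    nlinarith [abs_nonneg (T ω)]
  have hm : Measurable fun ω => T ω * p n (Z ω) := hT.mul ((hp n).comp hZ)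
  have hL : MemLp (fun ω => T ω * p n (Z ω)) 2 P :=
    hn.1.of_le_mul hm.aestronglyMeasurable (ae_of_all _ hpt)
  refine ⟨hL, ?_⟩
  have hk := (hκ n).le
  calc κ n * ∫ ω, (T ω * p n (Z ω)) ^ 2 ∂P
      ≤ κ n * ∫ ω, 64 * (T ω * phi (Z ω) x (s' n)) ^ 2 ∂P := by
        refine mul_le_mul_of_nonneg_left (integral_mono hL.integrable_sq
          (hn.1.integrable_sq.const_mul 64) fun ω => ?_) hk
        dsimp only
        have := pow_le_pow_left₀ (abs_nonneg _) (hpt ω) 2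
        rw [sq_abs, mul_pow (8:ℝ), sq_abs] at this
        linarith
    _ = 64 * (κ n * ∫ ω, (T ω * phi (Z ω) x (s' n)) ^ 2 ∂P) := by
        rw [integral_const_mul]; ring
    _ ≤ 64 * C := by linarith [hn.2]

section reduction

/-- The uniform bound on `b φ₁` at the largest admissible `b = √s`. -/
lemma exists_abs_phi₁_le {s : ℝ} (hs : 0 < s) (x : ℝ) : ∃ C, ∀ z, |phi₁ z x s| ≤ C := by
  refine ⟨8 * (√(2 * Real.pi * (s + √s ^ 2)))⁻¹ / √s, fun z => ?_⟩
  have hq := Real.sqrt_pos.2 hs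
  have h1 := abs_mul_phi₁_le hq (Real.sq_sqrt hs.le).le z x
  have h2 := phi_le (by positivity : 0 < s + √s ^ 2) z x
  rw [abs_mul, abs_of_pos hq] at h1
  rw [le_div_iff₀ hq]
  linarith

lemma exists_abs_phi₂_le {s : ℝ} (hs : 0 < s) (x : ℝ) : ∃ C, ∀ z, |phi₂ z x s| ≤ C := by
  refine ⟨(8 * (√(2 * Real.pi * (s + √s ^ 2)))⁻¹ + (√(2 * Real.pi * s))⁻¹) / √s ^ 2,
    fun z => ?_⟩
  have hq := Real.sqrt_pos.2 hs
  have hq2 : 0 < √s ^ 2 := by positivity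
  have h1 := abs_phi_add_mul_phi₂_le hq (Real.sq_sqrt hs.le).le z x
  have h2 := phi_le (by positivity : 0 < s + √s ^ 2) z x
  have h3 := phi_le hs z x
  have h4 := phi_nonneg z x s
  have h5 : |√s ^ 2 * phi₂ z x s| ≤ |phi z x s + √s ^ 2 * phi₂ z x s| + |phi z x s| := by
    have := abs_sub (phi z x s + √s ^ 2 * phi₂ z x s) (phi z x s)
    rwa [add_sub_cancel_left] at this
  rw [abs_mul, abs_of_pos hq2, abs_of_nonneg h4] at h5
  rw [le_div_iff₀ hq2]
  linarith

variable {Ω : Type*} [MeasurableSpace Ω] {P : Measure Ω} [IsProbabilityMeasure P]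
  {X U ε : ℕ → Ω → ℝ} {fX g τsq μ₃ : ℝ → ℝ} {σ lam x b₀ : ℝ} {h κ : ℕ → ℝ} {Cκ : ℝ}

lemma Model.integral_phi₁ (m : Model P X U ε fX τsq μ₃ σ) (hσ : 0 < σ) {s : ℝ} (hs : 0 < s) :
    ∫ ω, phi₁ (X 0 ω + U 0 ω) x s ∂P = smooth₁ (P.map (X 0)) (fun _ => 1) x (s + σ ^ 2) := by
  obtain ⟨C, hC⟩ := exists_abs_phi₁_le hs x
  rw [m.integral_Z (p := fun z => phi₁ z x s) (by fun_prop)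
    (m.integrable_of_abs_le (by fun_prop) hC), smooth₁]
  simp_rw [integral_phi₁_add hs hσ, one_mul]

lemma Model.integral_phi_add_mul_phi₂ (m : Model P X U ε fX τsq μ₃ σ) (hσ : 0 < σ) {s : ℝ}
    (hs : 0 < s) (c : ℝ) :
    ∫ ω, (phi (X 0 ω + U 0 ω) x s + c * phi₂ (X 0 ω + U 0 ω) x s) ∂P =
      smooth (P.map (X 0)) (fun _ => 1) x (s + σ ^ 2) +
        c * smooth₂ (P.map (X 0)) (fun _ => 1) x (s + σ ^ 2) := by
  obtain ⟨C, hC⟩ := exists_abs_phi₂_le hs x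
  have i2 : Integrable (fun ω => phi₂ (X 0 ω + U 0 ω) x s) P :=
    m.integrable_of_abs_le (p := fun z => phi₂ z x s) (by fun_prop) hC
  rw [integral_add (m.integral_phi hσ hs).1 (i2.const_mul c), (m.integral_phi hσ hs).2,
    integral_const_mul, m.integral_Z (p := fun z => phi₂ z x s) (by fun_prop) i2, smooth₂]
  simp_rw [integral_phi₂_add hs hσ, one_mul]

lemma Model.integral_Y_mul_phi₁ (m : Model P X U ε fX τsq μ₃ σ) (hσ : 0 < σ)
    (hg : Measurable g) {s : ℝ} (hs : 0 < s)
    (hi : Integrable (fun ω => (g (X 0 ω) + ε 0 ω) * phi₁ (X 0 ω + U 0 ω) x s) P) :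
    ∫ ω, (g (X 0 ω) + ε 0 ω) * phi₁ (X 0 ω + U 0 ω) x s ∂P =
      smooth₁ (P.map (X 0)) g x (s + σ ^ 2) := by
  rw [(m.integral_Y_mul hg (p := fun z => phi₁ z x s) (by fun_prop) hi).2, smooth₁]
  simp_rw [integral_phi₁_add hs hσ]

/-- The deterministic correction to the bias expansion. -/
noncomputable def biasError (ν : Measure ℝ) (fX g : ℝ → ℝ) (σ lam x : ℝ) (h : ℕ → ℝ) (n : ℕ) : ℝ :=
  gSm fX g σ 0 lam x / fSm fX σ 0 lam x + h n ^ 2 * bias fX g σ lam x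
    - meanRatio ν g x ((1 + lam) * σ ^ 2) (h n ^ 2)

/-- Asymptotic normality of the estimator follows from that of the empirical mean of
`(Y - D_n) φ(Z; x, h_n² + λσ²) / f_{0,λ}(x)`, where `D_n` is the ratio of the expected sums. -/
theorem Model.tendstoInDistribution_centred (m : Model P X U ε fX τsq μ₃ σ) (hσ : 0 < σ)
    (hg : Measurable g) (hτ : Measurable τsq) (hlam : 0 ≤ lam) (hb₀ : 0 < b₀)
    (hi : Integrable (fun t => (g t ^ 2 + τsq t) *
      phi t x ((b₀ ^ 2 + lam * σ ^ 2) / 2 + σ ^ 2)) (P.map (X 0)))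
    (hpos : ∀ n, 0 < h n) (h0 : Tendsto h atTop (𝓝 0)) (hκ : ∀ n, 0 < κ n)
    (hκC : ∀ n, κ n ≤ Cκ * √(h n ^ 2 + lam * σ ^ 2))
    (hnκ : Tendsto (fun n : ℕ => n * κ n) atTop atTop) {v : NNReal} {c : ℝ}
    (hc : c = (smooth (P.map (X 0)) (fun _ => 1) x ((1 + lam) * σ ^ 2))⁻¹)
    (hclt : TendstoInDistribution (fun n ω => √(n * κ n) *
      (empMean (obs X U ε) (fun e => c * ((yOf g e -
          meanRatio (P.map (X 0)) g x ((1 + lam) * σ ^ 2) (h n ^ 2)) *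
            phi (zOf e) x (h n ^ 2 + lam * σ ^ 2))) n ω -
        ∫ ω, c * ((yOf g (obs X U ε 0 ω) -
          meanRatio (P.map (X 0)) g x ((1 + lam) * σ ^ 2) (h n ^ 2)) *
            phi (zOf (obs X U ε 0 ω)) x (h n ^ 2 + lam * σ ^ 2)) ∂P)) atTop id (fun _ => P)
      (gaussianReal 0 v)) :
    TendstoInDistribution (fun n ω => √(n * κ n) *
      centred X U ε fX g σ lam x h (biasError (P.map (X 0)) fX g σ lam x h) n ω) atTop id
      (fun _ => P) (gaussianReal 0 v) := by
  set ν := P.map (X 0) with hν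
  have : IsProbabilityMeasure ν := Measure.isProbabilityMeasure_map (m.measurable_X 0).aemeasurable
  set S := (1 + lam) * σ ^ 2 with hS
  have hS0 : 0 < S := by positivity
  set D : ℕ → ℝ := fun n => meanRatio ν g x S (h n ^ 2) with hD
  set s : ℕ → ℝ := fun n => h n ^ 2 + lam * σ ^ 2 with hs
  have hs0 : ∀ n, 0 < s n := fun n => by have := hpos n; simp only [hs]; positivity
  have hsS : ∀ n, s n + σ ^ 2 = S + h n ^ 2 := fun n => by simp only [hs, hS]; ring
  have hbs : ∀ n, h n ^ 2 ≤ s n := fun n => by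
    simp only [hs]; exact le_add_of_nonneg_right (by positivity)
  have hmY := m.measurable_Y hg 0
  have hmZ := m.measurable_Z 0
  have hmy := measurable_yOf hg
  have hind : iIndepFun (obs X U ε) P := m.indep
  have hid : ∀ i, IdentDistrib (obs X U ε i) (obs X U ε 0) P P := m.ident
  -- moment bounds
  have hb1 := m.exists_bound_one (x := x) hσ hlam hpos h0 hκ hκC
  have hbY := m.exists_bound_Y hσ hg hτ hlam hb₀ hi hpos h0 hκ hκC
  have b_phi : ∀ n z, |phi z x (s n)| ≤ 8 * phi z x (s n + h n ^ 2) := fun n z => by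
    have h1 := phi_le_two_mul (hpos n) (hbs n) z x
    rw [abs_of_nonneg (phi_nonneg _ _ _)]
    linarith [phi_nonneg z x (s n + h n ^ 2)]
  have b_phi₁ : ∀ n z, |h n * phi₁ z x (s n)| ≤ 8 * phi z x (s n + h n ^ 2) :=
    fun n z => abs_mul_phi₁_le (hpos n) (hbs n) z x
  have b_phi₂ : ∀ n z, |phi z x (s n) + h n ^ 2 * phi₂ z x (s n)| ≤
    8 * phi z x (s n + h n ^ 2) := fun n z => abs_phi_add_mul_phi₂_le (hpos n) (hbs n) z x
  have m0 := exists_bound_of_abs_le measurable_const hmZ hκ hb1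
    (p := fun n z => phi z x (s n)) (fun n => by fun_prop) b_phi
  have m1 := exists_bound_of_abs_le measurable_const hmZ hκ hb1
    (p := fun n z => h n * phi₁ z x (s n)) (fun n => by fun_prop) b_phi₁
  have m2 := exists_bound_of_abs_le measurable_const hmZ hκ hb1
    (p := fun n z => phi z x (s n) + h n ^ 2 * phi₂ z x (s n)) (fun n => by fun_prop) b_phi₂
  have y0 := exists_bound_of_abs_le hmY hmZ hκ hbY
    (p := fun n z => phi z x (s n)) (fun n => by fun_prop) b_phi
  have y1 := exists_bound_of_abs_le hmY hmZ hκ hbY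
    (p := fun n z => h n * phi₁ z x (s n)) (fun n => by fun_prop) b_phi₁
  simp only [one_mul] at m0 m1 m2
  -- integrability of the weighted responses
  have iY0 : ∀ᶠ n in atTop,
      Integrable (fun ω => (g (X 0 ω) + ε 0 ω) * phi (X 0 ω + U 0 ω) x (s n)) P := by
    obtain ⟨C, hC⟩ := y0
    exact hC.mono fun n hn => hn.1.integrable one_le_two
  have iY1 : ∀ᶠ n in atTop,
      Integrable (fun ω => (g (X 0 ω) + ε 0 ω) * phi₁ (X 0 ω + U 0 ω) x (s n)) P := by
    obtain ⟨C, hC⟩ := y1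
    refine hC.mono fun n hn => ?_
    have := (hn.1.integrable one_le_two).const_mul (h n)⁻¹
    refine this.congr (ae_of_all _ fun ω => ?_)
    have := (hpos n).ne'
    field_simp
  -- the expected sums and their limits
  obtain ⟨s', hs', hig⟩ : ∃ s', S < s' ∧ Integrable (fun t => g t * phi t x s') ν := by
    have hsb : 0 < b₀ ^ 2 + lam * σ ^ 2 := by positivity
    -- Since `b₀ > 0`, the moment assumption holds at a variance strictly beyond the limit one; this
    -- room permits differentiation at `S`.
    refine ⟨b₀ ^ 2 + lam * σ ^ 2 + σ ^ 2, ?_, ?_⟩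
    · simp only [hS]; nlinarith [sq_pos_of_pos hb₀]
    · exact (m.integral_Y_mul_phi hσ hg hsb
        (((m.memLp_Y_mul_phi hσ hg hτ hsb).2 hi).integrable one_le_two)).1
  have hi1 : Integrable (fun t => (1 : ℝ) * phi t x s') ν :=
    integrable_one_mul_phi (hS0.trans hs') x
  have tS : Tendsto (fun n => S + h n ^ 2) atTop (𝓝 S) := by
    simpa using (h0.pow 2).const_add S
  have tF : Tendsto (fun n => smooth ν (fun _ => 1) x (S + h n ^ 2)) atTop
      (𝓝 (smooth ν (fun _ => 1) x S)) :=
    (hasDerivAt_smooth_var measurable_const hi1 hS0 hs').continuousAt.tendsto.comp tS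
  have tG : Tendsto (fun n => smooth ν g x (S + h n ^ 2)) atTop (𝓝 (smooth ν g x S)) :=
    (hasDerivAt_smooth_var hg hig hS0 hs').continuousAt.tendsto.comp tS
  have ta : Tendsto (fun n => smooth₁ ν (fun _ => 1) x (S + h n ^ 2)) atTop
      (𝓝 (smooth₁ ν (fun _ => 1) x S)) :=
    (continuousAt_smooth₁_var measurable_const hi1 hS0 hs').tendsto.comp tS
  have tt : Tendsto (fun n => smooth₁ ν g x (S + h n ^ 2)) atTop (𝓝 (smooth₁ ν g x S)) :=
    (continuousAt_smooth₁_var hg hig hS0 hs').tendsto.comp tS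
  have tF₂ : Tendsto (fun n => smooth₂ ν (fun _ => 1) x (S + h n ^ 2)) atTop
      (𝓝 (smooth₂ ν (fun _ => 1) x S)) :=
    (continuousAt_smooth₂_var measurable_const hi1 hS0 hs').tendsto.comp tS
  have tQ : Tendsto (fun n => smooth ν (fun _ => 1) x (S + h n ^ 2) +
      h n ^ 2 * smooth₂ ν (fun _ => 1) x (S + h n ^ 2)) atTop
      (𝓝 (smooth ν (fun _ => 1) x S)) := by
    simpa using tF.add ((h0.pow 2).mul tF₂)
  have hF0 : smooth ν (fun _ => 1) x S ≠ 0 := (smooth_one_pos hS0 x).ne'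
  -- the five empirical means
  set p : Fin 5 → ℕ → ℝ × ℝ × ℝ → ℝ := fun j n e => ![phi (zOf e) x (s n),
    phi (zOf e) x (s n) + h n ^ 2 * phi₂ (zOf e) x (s n), yOf g e * phi (zOf e) x (s n),
    h n * phi₁ (zOf e) x (s n), yOf g e * (h n * phi₁ (zOf e) x (s n))] j with hp
  have hpm : ∀ j n, Measurable (p j n) := by
    intro j n
    have e0 : Measurable fun e => phi (zOf e) x (s n) :=
      (measurable_phi_left x (s n)).comp measurable_zOf
    have e1 : Measurable fun e => phi₁ (zOf e) x (s n) :=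
      (measurable_phi₁_left x (s n)).comp measurable_zOf
    have e2 : Measurable fun e => phi₂ (zOf e) x (s n) :=
      (measurable_phi₂_left x (s n)).comp measurable_zOf
    fin_cases j
    · exact e0
    · exact e0.add (e2.const_mul _)
    · exact hmy.mul e0
    · exact e1.const_mul _
    · exact hmy.mul (e1.const_mul _)
  have hpb : ∀ j, ∃ C, ∀ᶠ n in atTop, MemLp (fun ω => p j n (obs X U ε 0 ω)) 2 P ∧
      κ n * ∫ ω, p j n (obs X U ε 0 ω) ^ 2 ∂P ≤ C := by
    intro j
    fin_cases j
    exacts [m0, m2, y0, m1, y1]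
  -- The correction `biasError` replaces the bias expansion by `D n` exactly.
  have hcent : ∀ n ω, √(n * κ n) * centred X U ε fX g σ lam x h
      (biasError ν fX g σ lam x h) n ω = √(n * κ n) *
      (ghat σ lam (h n) x n (fun i => X i ω + U i ω) (fun i => g (X i ω) + ε i ω) - D n) := by
    intro n ω
    rw [centred, biasError]
    simp only [hD, hS]
    ring
  simp_rw [hcent]
  have hghat_meas : ∀ n, Measurable fun ω =>
      ghat σ lam (h n) x n (fun i => X i ω + U i ω) (fun i => g (X i ω) + ε i ω) := by
    intro n
    simp_rw [ghat_eq (hpos n) hlam]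
    have M : ∀ j, Measurable (empMean (obs X U ε) (p j n) n) :=
      fun j => measurable_empMean m.measurable_obs (hpm j n) n
    have e1 : Measurable fun e => phi₁ (zOf e) x (s n) :=
      (measurable_phi₁_left x (s n)).comp measurable_zOf
    have M1 := measurable_empMean m.measurable_obs e1 n
    have M2 := measurable_empMean m.measurable_obs (hmy.mul e1) n
    exact (((M 1).mul (M 2)).sub ((M1.mul M2).const_mul _)).div
      (((M 1).mul (M 0)).sub ((M1.pow_const 2).const_mul _))
  refine tendstoInDistribution_of_tendstoInMeasure_sub _ _ hclt ?_
    fun n => (((hghat_meas n).sub_const _).const_mul _).aemeasurable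
  refine tendstoInMeasure_zero_of_bounded_deviations hind hid hκ hpm hpb fun K => ?_
  -- Along this filter `n → ∞` while all five normalized deviations stay bounded by `K`, so the
  -- deterministic linearization applies to pairs `(n, ω)` uniformly in `ω`.
  set l := comap (Prod.fst : ℕ × Ω → ℕ) atTop ⊓ 𝓟 {q : ℕ × Ω | ∀ j, |√(q.1 * κ q.1) *
    (empMean (obs X U ε) (p j q.1) q.1 q.2 - ∫ ω, p j q.1 (obs X U ε 0 ω) ∂P)| ≤ K} with hl
  have hfst : Tendsto (Prod.fst : ℕ × Ω → ℕ) l atTop := tendsto_comap.mono_left inf_le_left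
  have hK : ∀ᶠ q in l, ∀ j, |√(q.1 * κ q.1) *
      (empMean (obs X U ε) (p j q.1) q.1 q.2 - ∫ ω, p j q.1 (obs X U ε 0 ω) ∂P)| ≤ K :=
    mem_inf_of_right (mem_principal_self _)
  have hr : Tendsto (fun q : ℕ × Ω => √(q.1 * κ q.1)) l atTop :=
    (Real.tendsto_sqrt_atTop.comp hnκ).comp hfst
  -- the expectations
  have E0 : ∀ n, ∫ ω, p 0 n (obs X U ε 0 ω) ∂P = smooth ν (fun _ => 1) x (S + h n ^ 2) :=
    fun n => by rw [← hsS]; exact (m.integral_phi hσ (hs0 n)).2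
  have E1 : ∀ n, ∫ ω, p 1 n (obs X U ε 0 ω) ∂P = smooth ν (fun _ => 1) x (S + h n ^ 2) +
      h n ^ 2 * smooth₂ ν (fun _ => 1) x (S + h n ^ 2) :=
    fun n => by rw [← hsS]; exact m.integral_phi_add_mul_phi₂ hσ (hs0 n) _
  have E2 : ∀ᶠ n in atTop, ∫ ω, p 2 n (obs X U ε 0 ω) ∂P = smooth ν g x (S + h n ^ 2) := by
    filter_upwards [iY0] with n hn
    rw [← hsS]
    exact (m.integral_Y_mul_phi hσ hg (hs0 n) hn).2
  have E3 : ∀ n, ∫ ω, p 3 n (obs X U ε 0 ω) ∂P =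
      h n * smooth₁ ν (fun _ => 1) x (S + h n ^ 2) := fun n => by
    rw [← hsS, ← m.integral_phi₁ hσ (hs0 n), ← integral_const_mul]
    rfl
  have E4 : ∀ᶠ n in atTop, ∫ ω, p 4 n (obs X U ε 0 ω) ∂P =
      h n * smooth₁ ν g x (S + h n ^ 2) := by
    filter_upwards [iY1] with n hn
    rw [← hsS, ← m.integral_Y_mul_phi₁ hσ hg (hs0 n) hn, ← integral_const_mul]
    refine integral_congr_ae (ae_of_all _ fun ω => ?_)
    change (g (X 0 ω) + ε 0 ω) * (h n * phi₁ (X 0 ω + U 0 ω) x (s n)) = _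
    ring
  have M3 : ∀ n ω, empMean (obs X U ε) (p 3 n) n ω =
      h n * empMean (obs X U ε) (fun e => phi₁ (zOf e) x (s n)) n ω := fun n ω => by
    rw [← empMean_const_mul]; rfl
  have M4 : ∀ n ω, empMean (obs X U ε) (p 4 n) n ω =
      h n * empMean (obs X U ε) (fun e => yOf g e * phi₁ (zOf e) x (s n)) n ω := fun n ω => by
    rw [← empMean_const_mul]
    congr 1
    ext e
    change yOf g e * (h n * phi₁ (zOf e) x (s n)) = _
    ring
  have hlin := tendsto_ratio_sub_linear (l := l) (K := K) hF0
    (A := fun q => empMean (obs X U ε) (p 0 q.1) q.1 q.2)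
    (q := fun q => empMean (obs X U ε) (p 1 q.1) q.1 q.2)
    (B := fun q => empMean (obs X U ε) (p 2 q.1) q.1 q.2)
    (α := fun q => empMean (obs X U ε) (fun e => phi₁ (zOf e) x (s q.1)) q.1 q.2)
    (τ := fun q => empMean (obs X U ε) (fun e => yOf g e * phi₁ (zOf e) x (s q.1)) q.1 q.2)
    (D := fun q => D q.1) (r := fun q => √(q.1 * κ q.1))
    (tF.comp hfst) (tQ.comp hfst) (tG.comp hfst) (ta.comp hfst) (tt.comp hfst) (h0.comp hfst) hr
    (fun q => rfl) ?_ ?_ ?_ ?_ ?_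
  · refine hlin.congr' ?_
    filter_upwards [hfst.eventually E2, hfst.eventually iY0] with q hq hiq
    obtain ⟨n, ω⟩ := q
    simp only [Pi.sub_apply] at hq hiq ⊢
    congr 1
    · rw [ghat_eq (hpos n) hlam]
      rfl
    · have e1 : empMean (obs X U ε) (fun e => c * ((yOf g e - D n) * phi (zOf e) x (s n))) n ω =
          c * (empMean (obs X U ε) (p 2 n) n ω - D n * empMean (obs X U ε) (p 0 n) n ω) := by
        rw [empMean_const_mul]
        congr 1
        rw [sub_eq_add_neg, ← neg_mul, ← empMean_const_mul, ← empMean_add]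
        congr 1
        ext e
        change _ = yOf g e * phi (zOf e) x (s n) + -D n * phi (zOf e) x (s n)
        ring
      have e2 : ∫ ω, c * ((yOf g (obs X U ε 0 ω) - D n) *
          phi (zOf (obs X U ε 0 ω)) x (s n)) ∂P =
          c * (smooth ν g x (S + h n ^ 2) - D n * smooth ν (fun _ => 1) x (S + h n ^ 2)) := by
        rw [integral_const_mul]
        congr 1
        rw [← hsS, ← (m.integral_Y_mul_phi hσ hg (hs0 n) hiq).2, ← (m.integral_phi hσ (hs0 n)).2,
          ← integral_const_mul, ← integral_sub hiq ((m.integral_phi hσ (hs0 n)).1.const_mul _)]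
        refine integral_congr_ae (ae_of_all _ fun ω => ?_)
        change (g (X 0 ω) + ε 0 ω - D n) * phi (X 0 ω + U 0 ω) x (s n) = _
        ring
      change _ = √(n * κ n) * (empMean (obs X U ε)
        (fun e => c * ((yOf g e - D n) * phi (zOf e) x (s n))) n ω -
        ∫ ω, c * ((yOf g (obs X U ε 0 ω) - D n) * phi (zOf (obs X U ε 0 ω)) x (s n)) ∂P)
      rw [e1, e2, ← hc]
      simp only [Function.comp_apply]
      ring
  · filter_upwards [hK] with q hq
    simpa only [Function.comp_apply, E0] using hq 0
  · filter_upwards [hK] with q hq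
    simpa only [Function.comp_apply, E1] using hq 1
  · filter_upwards [hK, hfst.eventually E2] with q hq h2
    simpa only [Function.comp_apply, h2] using hq 2
  · filter_upwards [hK] with q hq
    have := hq 3
    rw [E3, M3, ← mul_sub] at this
    exact this
  · filter_upwards [hK, hfst.eventually E4] with q hq h4
    have := hq 4
    rw [h4, M4, ← mul_sub] at this
    exact this

end reduction

/-! ### Moments of the linearized summands and identification of the variances. -/

section limits

variable {Ω : Type*} [MeasurableSpace Ω] {P : Measure Ω} [IsProbabilityMeasure P]
  {X U ε : ℕ → Ω → ℝ} {fX g τsq μ₃ : ℝ → ℝ} {σ lam x b₀ : ℝ} {h : ℕ → ℝ}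

lemma tendsto_meanRatio {ν : Measure ℝ} [IsFiniteMeasure ν] (hg : Measurable g) {s s' : ℝ}
    (hs : 0 < s) (hs' : s < s') (hi : Integrable (fun t => g t * phi t x s') ν)
    (hF : smooth ν (fun _ => 1) x s ≠ 0) (h0 : Tendsto h atTop (𝓝 0)) :
    Tendsto (fun n => meanRatio ν g x s (h n ^ 2)) atTop
      (𝓝 (smooth ν g x s / smooth ν (fun _ => 1) x s)) := by
  have e : meanRatio ν g x s 0 = smooth ν g x s / smooth ν (fun _ => 1) x s := by
    simp only [meanRatio, add_zero, zero_mul, sub_zero]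
    rw [mul_div_mul_left _ _ hF]
  rw [← e]
  have h2 : Tendsto (fun n => h n ^ 2) atTop (𝓝 0) := by simpa using h0.pow 2
  exact (hasDerivAt_meanRatio hg hs hs' hi hF).continuousAt.tendsto.comp h2

/-- Mean square continuity of the summands away from a vanishing bandwidth. -/
lemma Model.tendsto_integral_sq_sub (m : Model P X U ε fX τsq μ₃ σ) (hg : Measurable g)
    {s : ℕ → ℝ} {D : ℕ → ℝ} {s₀ s₁ D₀ : ℝ} (hs₀ : 0 < s₀) (hss : ∀ n, s₀ ≤ s n)
    (hs : Tendsto s atTop (𝓝 s₀)) (hs₁ : s₀ < s₁) (hD : Tendsto D atTop (𝓝 D₀))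
    (hi : MemLp (fun ω => (g (X 0 ω) + ε 0 ω) * phi (X 0 ω + U 0 ω) x s₁) 2 P) (c : ℝ) :
    (∀ᶠ n in atTop, MemLp (fun ω => c * ((g (X 0 ω) + ε 0 ω - D n) *
        phi (X 0 ω + U 0 ω) x (s n))) 2 P) ∧
    MemLp (fun ω => c * ((g (X 0 ω) + ε 0 ω - D₀) * phi (X 0 ω + U 0 ω) x s₀)) 2 P ∧
    Tendsto (fun n => ∫ ω, (c * ((g (X 0 ω) + ε 0 ω - D n) * phi (X 0 ω + U 0 ω) x (s n)) -
      c * ((g (X 0 ω) + ε 0 ω - D₀) * phi (X 0 ω + U 0 ω) x s₀)) ^ 2 ∂P) atTop (𝓝 0) := by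
  set Y : Ω → ℝ := fun ω => g (X 0 ω) + ε 0 ω with hY
  set Z : Ω → ℝ := fun ω => X 0 ω + U 0 ω with hZ
  have mY : Measurable Y := m.measurable_Y hg 0
  have mZ : Measurable Z := m.measurable_Z 0
  -- `R` dominates all summands with `|d| ≤ M` and variance in `[s₀, s₁]`. Because `s₀ > 0`, passing
  -- to the wider kernel costs only the fixed factor `K`.
  set M := |D₀| + 1 with hM
  set K := √(s₁ / s₀) with hK
  set R : Ω → ℝ := fun ω => |c| * K * (|Y ω * phi (Z ω) x s₁| + M * phi (Z ω) x s₁) with hR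
  have hM0 : 0 ≤ M := by positivity
  have hRL : MemLp R 2 P :=
    (hi.abs.add ((m.memLp_phi (x := x) (hs₀.trans hs₁)).const_mul M)).const_mul (|c| * K)
  have hmeas : ∀ d r, Measurable fun ω => c * ((Y ω - d) * phi (Z ω) x r) := fun d r =>
    ((mY.sub_const d).mul ((measurable_phi_left x r).comp mZ)).const_mul c
  have key : ∀ d r, |d| ≤ M → s₀ ≤ r → r ≤ s₁ → ∀ ω,
      |c * ((Y ω - d) * phi (Z ω) x r)| ≤ R ω := by
    intro d r hd h1 h2 ω
    have hr : 0 < r := hs₀.trans_le h1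
    have p1 : phi (Z ω) x r ≤ K * phi (Z ω) x s₁ := by
      refine (phi_le_phi_of_le hr h2 _ _).trans ?_
      have hs₁0 := hs₀.trans hs₁
      exact mul_le_mul_of_nonneg_right (Real.sqrt_le_sqrt (by gcongr)) (phi_nonneg _ _ _)
    rw [abs_mul, abs_mul, abs_of_nonneg (phi_nonneg (Z ω) x r)]
    calc |c| * (|Y ω - d| * phi (Z ω) x r)
        ≤ |c| * ((|Y ω| + M) * (K * phi (Z ω) x s₁)) := by
          have h3 := phi_nonneg (Z ω) x r
          have h4 : |Y ω - d| ≤ |Y ω| + M := (abs_sub _ _).trans (by gcongr)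
          gcongr
      _ = R ω := by
          simp only [hR]
          rw [abs_mul, abs_of_nonneg (phi_nonneg (Z ω) x s₁)]
          ring
  have hL : ∀ d r, |d| ≤ M → s₀ ≤ r → r ≤ s₁ →
      MemLp (fun ω => c * ((Y ω - d) * phi (Z ω) x r)) 2 P := fun d r hd h1 h2 =>
    hRL.mono' (hmeas d r).aestronglyMeasurable (ae_of_all _ (key d r hd h1 h2))
  have hev : ∀ᶠ n in atTop, |D n| ≤ M ∧ s n ≤ s₁ := by
    filter_upwards [hD.abs.eventually_le_const (lt_add_one _), hs.eventually_le_const hs₁]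
      with n h1 h2 using ⟨h1, h2⟩
  have hD₀ : |D₀| ≤ M := (lt_add_one _).le
  refine ⟨hev.mono fun n hn => hL _ _ hn.1 (hss n) hn.2, hL _ _ hD₀ le_rfl hs₁.le, ?_⟩
  have hdom := tendsto_integral_filter_of_dominated_convergence (μ := P) (l := atTop)
    (F := fun n ω => (c * ((Y ω - D n) * phi (Z ω) x (s n)) -
      c * ((Y ω - D₀) * phi (Z ω) x s₀)) ^ 2) (f := fun _ => 0) (fun ω => (2 * R ω) ^ 2)
    (Eventually.of_forall fun n =>
      (((hmeas _ _).sub (hmeas _ _)).pow_const 2).aestronglyMeasurable) ?_ ?_ ?_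
  · simpa using hdom
  · filter_upwards [hev] with n hn
    refine ae_of_all _ fun ω => ?_
    have h1 := key _ _ hn.1 (hss n) hn.2 ω
    have h2 := key _ _ hD₀ le_rfl hs₁.le ω
    rw [Real.norm_eq_abs, abs_pow]
    refine pow_le_pow_left₀ (abs_nonneg _) ((abs_sub _ _).trans ?_) 2
    linarith
  · exact (hRL.const_mul 2).integrable_sq
  · refine ae_of_all _ fun ω => ?_
    have h1 : Tendsto (fun n => phi (Z ω) x (s n)) atTop (𝓝 (phi (Z ω) x s₀)) :=
      (hasDerivAt_phi_var hs₀ (Z ω) x).continuousAt.tendsto.comp hs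
    have := (((hD.const_sub (Y ω)).mul h1).const_mul c).sub_const
      (c * ((Y ω - D₀) * phi (Z ω) x s₀))
    simpa using this.pow 2

/-- The split needs each part to be integrable by itself; this follows from the sum because `τ² ≥ 0`
almost everywhere. -/
lemma Model.smooth_add (m : Model P X U ε fX τsq μ₃ σ) (hg : Measurable g)
    {s : ℝ} (hi : Integrable (fun t => (g t ^ 2 + τsq t) * phi t x s) (P.map (X 0))) :
    smooth (P.map (X 0)) (fun t => g t ^ 2) x s + smooth (P.map (X 0)) τsq x s =
      smooth (P.map (X 0)) (fun t => g t ^ 2 + τsq t) x s := by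
  simp only [smooth]
  have i1 : Integrable (fun t => g t ^ 2 * phi t x s) (P.map (X 0)) := by
    refine hi.mono' (by fun_prop) ?_
    filter_upwards [m.ae_τsq_nonneg] with t ht
    rw [Real.norm_eq_abs, abs_of_nonneg (mul_nonneg (sq_nonneg _) (phi_nonneg _ _ _))]
    exact mul_le_mul_of_nonneg_right (le_add_of_nonneg_right ht) (phi_nonneg _ _ _)
  have i2 : Integrable (fun t => τsq t * phi t x s) (P.map (X 0)) := by
    refine (hi.sub i1).congr (ae_of_all _ fun t => ?_)
    simp only [Pi.sub_apply]
    ring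
  rw [← integral_add i1 i2]
  simp_rw [add_mul]

/-- The third absolute moments of the response against normal densities at `Z` are bounded. -/
lemma Model.exists_bound_Y_cube (m : Model P X U ε fX τsq μ₃ σ) (hσ : 0 < σ) (hg : Measurable g)
    {s₁ : ℝ} (hi : Integrable (fun t => 4 * (|g t| ^ 3 + μ₃ t) * phi t x s₁) (P.map (X 0))) :
    ∃ C, ∀ s, 0 < s → s + σ ^ 2 ≤ s₁ →
      Integrable (fun ω => |g (X 0 ω) + ε 0 ω| ^ 3 * phi (X 0 ω + U 0 ω) x s) P ∧
      ∫ ω, |g (X 0 ω) + ε 0 ω| ^ 3 * phi (X 0 ω + U 0 ω) x s ∂P ≤ C := by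
  -- All variances `s + σ²` lie between `σ²` and `s₁`, so one constant bounds the cost of widening,
  -- also as `s → 0`.
  set K := √(s₁ / σ ^ 2) with hK
  set W := ∫⁻ t, ENNReal.ofReal (K * (4 * (|g t| ^ 3 + μ₃ t) * phi t x s₁)) ∂(P.map (X 0))
    with hW
  have hWtop : W ≠ ⊤ := (hi.const_mul K).lintegral_lt_top.ne
  refine ⟨W.toReal, fun s hs hs₁ => ?_⟩
  have hσ2 : 0 < σ ^ 2 := by positivity
  have hle : ∫⁻ ω, ENNReal.ofReal (|g (X 0 ω) + ε 0 ω| ^ 3 * phi (X 0 ω + U 0 ω) x s) ∂P ≤ W := by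
    refine (m.lintegral_Y_cube_le hσ hg hs x).trans (lintegral_mono_ae ?_)
    filter_upwards [m.response_moments g] with t ht
    have h0 : 0 ≤ 4 * (|g t| ^ 3 + μ₃ t) := by have := ht.2.2.2.2; positivity
    refine ENNReal.ofReal_le_ofReal ?_
    have h1 := phi_le_phi_of_le (by positivity : 0 < s + σ ^ 2) hs₁ t x
    have h2 : √(s₁ / (s + σ ^ 2)) ≤ K := by
      have : 0 ≤ s₁ := by linarith
      refine Real.sqrt_le_sqrt (div_le_div_of_nonneg_left this hσ2 ?_)
      linarith
    calc _ ≤ 4 * (|g t| ^ 3 + μ₃ t) * (K * phi t x s₁) :=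
          mul_le_mul_of_nonneg_left (h1.trans (mul_le_mul_of_nonneg_right h2 (phi_nonneg _ _ _))) h0
      _ = _ := by ring
  have hm : Measurable fun ω => |g (X 0 ω) + ε 0 ω| ^ 3 * phi (X 0 ω + U 0 ω) x s :=
    ((m.measurable_Y hg 0).abs.pow_const 3).mul ((measurable_phi_left x s).comp (m.measurable_Z 0))
  have hnn : ∀ ω, 0 ≤ |g (X 0 ω) + ε 0 ω| ^ 3 * phi (X 0 ω + U 0 ω) x s := fun ω =>
    mul_nonneg (by positivity) (phi_nonneg _ _ _)
  constructor
  · rw [← lintegral_ofReal_ne_top_iff_integrable hm.aestronglyMeasurable (ae_of_all _ hnn)]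
    exact (hle.trans_lt hWtop.lt_top).ne
  · rw [integral_eq_lintegral_of_nonneg_ae (ae_of_all _ hnn) hm.aestronglyMeasurable]
    exact ENNReal.toReal_mono hWtop hle

/-- The cube of the kernel is a multiple of `s⁻¹ φ(·; x, s/3)`, so third absolute moments are
`O(1/s)`. With `s = h²` this is the bound that Lyapunov's condition uses. -/
lemma Model.exists_bound_cube (m : Model P X U ε fX τsq μ₃ σ) (hσ : 0 < σ) (hg : Measurable g)
    {s₁ : ℝ} (hi : Integrable (fun t => 4 * (|g t| ^ 3 + μ₃ t) * phi t x s₁) (P.map (X 0)))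
    (M c : ℝ) :
    ∃ C, ∀ s d, 0 < s → s / 3 + σ ^ 2 ≤ s₁ → |d| ≤ M →
      Integrable (fun ω => |c * ((g (X 0 ω) + ε 0 ω - d) * phi (X 0 ω + U 0 ω) x s)| ^ 3) P ∧
      s * ∫ ω, |c * ((g (X 0 ω) + ε 0 ω - d) * phi (X 0 ω + U 0 ω) x s)| ^ 3 ∂P ≤ C := by
  have : IsProbabilityMeasure (P.map (X 0)) :=
    Measure.isProbabilityMeasure_map (m.measurable_X 0).aemeasurable
  obtain ⟨C, hC⟩ := m.exists_bound_Y_cube hσ hg hi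
  set N := (√(2 * Real.pi * σ ^ 2))⁻¹ with hN
  set L := |c| ^ 3 * 4 * (√3 * (2 * Real.pi))⁻¹ with hL
  refine ⟨L * (C + M ^ 3 * N), fun s d hs hs₁ hd => ?_⟩
  have hM : 0 ≤ M := (abs_nonneg d).trans hd
  have hs3 : 0 < s / 3 := by positivity
  obtain ⟨iY, bY⟩ := hC _ hs3 hs₁
  obtain ⟨i1, e1⟩ := m.integral_phi (x := x) hσ hs3
  have b1 : ∫ ω, phi (X 0 ω + U 0 ω) x (s / 3) ∂P ≤ N := by
    rw [e1, smooth]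
    have hpt : ∀ t, 1 * phi t x (s / 3 + σ ^ 2) ≤ N := fun t => by
      rw [one_mul]
      refine (phi_le (by positivity) t x).trans ?_
      have : √(2 * Real.pi * σ ^ 2) ≤ √(2 * Real.pi * (s / 3 + σ ^ 2)) :=
        Real.sqrt_le_sqrt (by gcongr; linarith)
      exact inv_anti₀ (by positivity) this
    calc ∫ t, 1 * phi t x (s / 3 + σ ^ 2) ∂(P.map (X 0)) ≤ ∫ _, N ∂(P.map (X 0)) :=
          integral_mono (integrable_one_mul_phi (by positivity) x) (integrable_const N) hpt
      _ = N := by simp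
  set R : Ω → ℝ := fun ω => L / s * (|g (X 0 ω) + ε 0 ω| ^ 3 * phi (X 0 ω + U 0 ω) x (s / 3) +
    M ^ 3 * phi (X 0 ω + U 0 ω) x (s / 3)) with hR
  have hRi : Integrable R P := (iY.add (i1.const_mul _)).const_mul _
  have hle : ∀ ω, |c * ((g (X 0 ω) + ε 0 ω - d) * phi (X 0 ω + U 0 ω) x s)| ^ 3 ≤ R ω := by
    intro ω
    set y := g (X 0 ω) + ε 0 ω
    have hp := phi_nonneg (X 0 ω + U 0 ω) x (s / 3)
    have h4 : |y - d| ^ 3 ≤ 4 * (|y| ^ 3 + M ^ 3) := by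
      have h1 : |y - d| ^ 3 ≤ (|y| + M) ^ 3 := by
        gcongr
        exact (abs_sub _ _).trans (by gcongr)
      have h2 := abs_nonneg y
      nlinarith [mul_nonneg (add_nonneg h2 hM) (sq_nonneg (|y| - M))]
    rw [abs_mul, abs_mul, mul_pow, mul_pow, abs_of_nonneg (phi_nonneg _ _ _), phi_cube hs]
    calc |c| ^ 3 * (|y - d| ^ 3 * ((√3 * (2 * Real.pi * s))⁻¹ * phi (X 0 ω + U 0 ω) x (s / 3)))
        ≤ |c| ^ 3 * (4 * (|y| ^ 3 + M ^ 3) *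
          ((√3 * (2 * Real.pi * s))⁻¹ * phi (X 0 ω + U 0 ω) x (s / 3))) := by gcongr
      _ = _ := by
        change _ = L / s * (|y| ^ 3 * phi (X 0 ω + U 0 ω) x (s / 3) +
          M ^ 3 * phi (X 0 ω + U 0 ω) x (s / 3))
        rw [hL]
        field_simp
  have hm : Measurable fun ω => |c * ((g (X 0 ω) + ε 0 ω - d) * phi (X 0 ω + U 0 ω) x s)| ^ 3 :=
    ((((m.measurable_Y hg 0).sub_const d).mul
      ((measurable_phi_left x s).comp (m.measurable_Z 0))).const_mul c).abs.pow_const 3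
  have hi3 := hRi.mono' hm.aestronglyMeasurable (ae_of_all _ fun ω => by
    rw [Real.norm_eq_abs, abs_of_nonneg (by positivity)]; exact hle ω)
  refine ⟨hi3, ?_⟩
  calc _ ≤ s * ∫ ω, R ω ∂P := mul_le_mul_of_nonneg_left (integral_mono hi3 hRi hle) hs.le
    _ = L * (∫ ω, |g (X 0 ω) + ε 0 ω| ^ 3 * phi (X 0 ω + U 0 ω) x (s / 3) ∂P +
        M ^ 3 * ∫ ω, phi (X 0 ω + U 0 ω) x (s / 3) ∂P) := by
      rw [integral_const_mul, integral_add iY (i1.const_mul _), integral_const_mul]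
      field_simp
    _ ≤ _ := by gcongr

/-- The subtracted products in `DeltaPos` add up to `(c₀ F + d₀ G)²`, where `G` is the smoothed `g`.
This vanishes because `c₀ = -D/F`, `d₀ = 1/F` and `G = DF`; what is left is a second moment. -/
lemma Model.DeltaPos_eq (m : Model P X U ε fX τsq μ₃ σ) (hσ : 0 < σ) (hlam : 0 < lam)
    (hf : Measurable fX) (hg : Measurable g)
    (hi : Integrable (fun t => (g t ^ 2 + τsq t) * phi t x (lam * σ ^ 2 / 2 + σ ^ 2)) (P.map (X 0)))
    {F D : ℝ} (hF : F = smooth (P.map (X 0)) (fun _ => 1) x ((1 + lam) * σ ^ 2)) (hF0 : F ≠ 0)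
    (hD : D = smooth (P.map (X 0)) g x ((1 + lam) * σ ^ 2) / F) :
    DeltaPos fX g τsq σ lam x = F⁻¹ ^ 2 * ((2 * √(Real.pi * (lam * σ ^ 2)))⁻¹ *
      (smooth (P.map (X 0)) (fun t => g t ^ 2 + τsq t) x (lam * σ ^ 2 / 2 + σ ^ 2)
        - 2 * D * smooth (P.map (X 0)) g x (lam * σ ^ 2 / 2 + σ ^ 2)
        + D ^ 2 * smooth (P.map (X 0)) (fun _ => 1) x (lam * σ ^ 2 / 2 + σ ^ 2))) := by
  have e : (1 + lam / 2) * σ ^ 2 = lam * σ ^ 2 / 2 + σ ^ 2 := by ring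
  have hf0 := m.density_nonneg
  have hν := m.law_X
  have hG : smooth (P.map (X 0)) g x ((1 + lam) * σ ^ 2) = D * F := by rw [hD]; field_simp
  rw [DeltaPos, c0, d0, fSm_zero_eq hf hf0 hν, fSm_zero_eq hf hf0 hν, gSm_zero_eq hf hf0 hν,
    gSm_zero_eq hf hf0 hν, GSm_zero_eq hf hf0 hν, HSm_zero_eq hf hf0 hν, e,
    m.smooth_add hg hi, ← hF, hG, mul_assoc Real.pi]
  have : 0 < √(Real.pi * (lam * σ ^ 2)) := by positivity
  field_simp
  ring

/-- With `G = DF`, the terms `-2DG + D²F` collapse to `-G²/F`. -/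
lemma Model.DeltaZero_eq (m : Model P X U ε fX τsq μ₃ σ)
    (hf : Measurable fX) (hg : Measurable g)
    (hi : Integrable (fun t => (g t ^ 2 + τsq t) * phi t x (σ ^ 2)) (P.map (X 0)))
    {F D : ℝ} (hF : F = smooth (P.map (X 0)) (fun _ => 1) x (σ ^ 2)) (hF0 : F ≠ 0)
    (hD : D = smooth (P.map (X 0)) g x (σ ^ 2) / F) :
    DeltaZero fX g τsq σ x = F⁻¹ ^ 2 * ((2 * √Real.pi)⁻¹ *
      (smooth (P.map (X 0)) (fun t => g t ^ 2 + τsq t) x (σ ^ 2)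
        - 2 * D * smooth (P.map (X 0)) g x (σ ^ 2)
        + D ^ 2 * smooth (P.map (X 0)) (fun _ => 1) x (σ ^ 2))) := by
  have e : (1 + 0) * σ ^ 2 = σ ^ 2 := by ring
  have hf0 := m.density_nonneg
  have hν := m.law_X
  have hG : smooth (P.map (X 0)) g x (σ ^ 2) = D * F := by rw [hD]; field_simp
  rw [DeltaZero, fSm_zero_eq hf hf0 hν, gSm_zero_eq hf hf0 hν, GSm_zero_eq hf hf0 hν,
    HSm_zero_eq hf hf0 hν, e, m.smooth_add hg hi, ← hF, hG]
  have : 0 < √Real.pi := by positivity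
  field_simp
  ring

end limits

/-! ### Asymptotic normality in the two regimes. -/

section main

variable {Ω : Type*} [MeasurableSpace Ω] {P : Measure Ω} [IsProbabilityMeasure P]
  {X U ε : ℕ → Ω → ℝ} {fX g τsq μ₃ : ℝ → ℝ} {σ lam x b₀ : ℝ} {h : ℕ → ℝ}

lemma Model.integrable_g_mul_phi (m : Model P X U ε fX τsq μ₃ σ) (hσ : 0 < σ)
    (hg : Measurable g) (hτ : Measurable τsq) (hlam : 0 ≤ lam) (hb₀ : 0 < b₀)
    (hi : Integrable (fun t => (g t ^ 2 + τsq t) *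
      phi t x ((b₀ ^ 2 + lam * σ ^ 2) / 2 + σ ^ 2)) (P.map (X 0))) :
    Integrable (fun t => g t * phi t x (b₀ ^ 2 + (1 + lam) * σ ^ 2)) (P.map (X 0)) := by
  have hsb : 0 < b₀ ^ 2 + lam * σ ^ 2 := by positivity
  have := (m.integral_Y_mul_phi hσ hg hsb
    (((m.memLp_Y_mul_phi hσ hg hτ hsb).2 hi).integrable one_le_two)).1
  rwa [show b₀ ^ 2 + lam * σ ^ 2 + σ ^ 2 = b₀ ^ 2 + (1 + lam) * σ ^ 2 by ring] at this

lemma Model.biasError_isLittleO (m : Model P X U ε fX τsq μ₃ σ) (hσ : 0 < σ)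
    (hf : Measurable fX) (hg : Measurable g) (hτ : Measurable τsq) (hlam : 0 ≤ lam) (hb₀ : 0 < b₀)
    (hi : Integrable (fun t => (g t ^ 2 + τsq t) *
      phi t x ((b₀ ^ 2 + lam * σ ^ 2) / 2 + σ ^ 2)) (P.map (X 0)))
    (h0 : Tendsto h atTop (𝓝 0)) :
    biasError (P.map (X 0)) fX g σ lam x h =o[atTop] fun n => h n ^ 2 := by
  have : IsProbabilityMeasure (P.map (X 0)) :=
    Measure.isProbabilityMeasure_map (m.measurable_X 0).aemeasurable
  have hS : 0 < (1 + lam) * σ ^ 2 := by positivity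
  exact meanRatio_isLittleO hf m.density_nonneg m.law_X hg hS
    (lt_add_of_pos_left _ (by positivity)) (m.integrable_g_mul_phi hσ hg hτ hlam hb₀ hi)
    (smooth_one_pos hS x).ne' h0

/-- Asymptotic normality of the estimator for `λ > 0`. -/
theorem Model.asymptotic_normality_pos (m : Model P X U ε fX τsq μ₃ σ) (hσ : 0 < σ)
    (hf : Measurable fX) (hg : Measurable g) (hτ : Measurable τsq) (hlam : 0 < lam) (hb₀ : 0 < b₀)
    (hi : Integrable (fun t => (g t ^ 2 + τsq t) *
      phi t x ((b₀ ^ 2 + lam * σ ^ 2) / 2 + σ ^ 2)) (P.map (X 0)))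
    (hpos : ∀ n, 0 < h n) (h0 : Tendsto h atTop (𝓝 0)) :
    0 ≤ DeltaPos fX g τsq σ lam x ∧
    TendstoInDistribution (fun (n : ℕ) ω => √(n : ℝ) *
      centred X U ε fX g σ lam x h (biasError (P.map (X 0)) fX g σ lam x h) n ω) atTop id
      (fun _ => P) (gaussianReal 0 (DeltaPos fX g τsq σ lam x).toNNReal) := by
  have : IsProbabilityMeasure (P.map (X 0)) :=
    Measure.isProbabilityMeasure_map (m.measurable_X 0).aemeasurable
  set ν := P.map (X 0) with hν
  set S := (1 + lam) * σ ^ 2 with hSdef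
  have hS : 0 < S := by positivity
  set F := smooth ν (fun _ => 1) x S with hF
  have hF0 : F ≠ 0 := (smooth_one_pos hS x).ne'
  set D := smooth ν g x S / F with hD
  have hlσ : 0 < lam * σ ^ 2 := by positivity
  have hlt : lam * σ ^ 2 < b₀ ^ 2 + lam * σ ^ 2 := lt_add_of_pos_left _ (by positivity)
  have hig := m.integrable_g_mul_phi hσ hg hτ hlam.le hb₀ hi
  have hi₀ : Integrable (fun t => (g t ^ 2 + τsq t) * phi t x (lam * σ ^ 2 / 2 + σ ^ 2)) ν :=
    (integrable_smooth (by fun_prop) hi (by positivity) (by linarith) (y := x) (by simp)).1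
  have tD := tendsto_meanRatio hg hS (lt_add_of_pos_left _ (by positivity)) hig hF0 h0
  have ts : Tendsto (fun n => h n ^ 2 + lam * σ ^ 2) atTop (𝓝 (lam * σ ^ 2)) := by
    simpa using (h0.pow 2).add_const (lam * σ ^ 2)
  obtain ⟨hp2, hq2, hlim⟩ := m.tendsto_integral_sq_sub hg hlσ
    (fun n => le_add_of_nonneg_left (sq_nonneg (h n))) ts hlt tD
    ((m.memLp_Y_mul_phi hσ hg hτ (by positivity)).2 hi) F⁻¹
  have hmy := measurable_yOf hg
  have hpm : ∀ d s, Measurable fun e => F⁻¹ * ((yOf g e - d) * phi (zOf e) x s) := fun d s =>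
    ((hmy.sub_const d).mul ((measurable_phi_left x s).comp measurable_zOf)).const_mul _
  have hclt := tendstoInDistribution_sqrt_mul_empMean m.measurable_obs m.indep m.ident
    (p := fun n e => F⁻¹ * ((yOf g e - meanRatio ν g x S (h n ^ 2)) *
      phi (zOf e) x (h n ^ 2 + lam * σ ^ 2)))
    (q := fun e => F⁻¹ * ((yOf g e - D) * phi (zOf e) x (lam * σ ^ 2)))
    (fun n => hpm _ _) (hpm _ _) hp2 hq2 hlim
  -- The limiting summand is centred by the choice `D = g₀/f₀`, so its variance is its second
  -- moment.
  have hmean : ∫ ω, F⁻¹ * ((yOf g (obs X U ε 0 ω) - D) *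
      phi (zOf (obs X U ε 0 ω)) x (lam * σ ^ 2)) ∂P = 0 := by
    have iY : Integrable (fun ω => (g (X 0 ω) + ε 0 ω) * phi (X 0 ω + U 0 ω) x (lam * σ ^ 2)) P :=
      ((m.memLp_Y_mul_phi hσ hg hτ hlσ).2 hi₀).integrable one_le_two
    have e1 := (m.integral_Y_mul_phi hσ hg hlσ iY).2
    obtain ⟨i2, e2⟩ := m.integral_phi (x := x) hσ hlσ
    have hSe : lam * σ ^ 2 + σ ^ 2 = S := by rw [hSdef]; ring
    rw [hSe] at e1 e2
    have : ∫ ω, (yOf g (obs X U ε 0 ω) - D) * phi (zOf (obs X U ε 0 ω)) x (lam * σ ^ 2) ∂P =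
        smooth ν g x S - D * F := by
      rw [hF, ← e1, ← e2, ← integral_const_mul, ← integral_sub iY (i2.const_mul _)]
      refine integral_congr_ae (ae_of_all _ fun ω => ?_)
      change (g (X 0 ω) + ε 0 ω - D) * phi (X 0 ω + U 0 ω) x (lam * σ ^ 2) = _
      ring
    rw [integral_const_mul, this, hD, div_mul_cancel₀ _ hF0]
    simp
  have hvar : Var[fun ω => F⁻¹ * ((yOf g (obs X U ε 0 ω) - D) *
      phi (zOf (obs X U ε 0 ω)) x (lam * σ ^ 2)); P] = DeltaPos fX g τsq σ lam x := by
    have hqm : Measurable fun ω => F⁻¹ * ((yOf g (obs X U ε 0 ω) - D) *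
        phi (zOf (obs X U ε 0 ω)) x (lam * σ ^ 2)) := (hpm _ _).comp (m.measurable_obs 0)
    rw [variance_of_integral_eq_zero hqm.aemeasurable hmean,
      m.DeltaPos_eq hσ hlam hf hg hi₀ hF hF0 hD, ← m.integral_sub_mul_phi_sq hσ hg hτ hlσ hi₀,
      ← integral_const_mul]
    refine integral_congr_ae (ae_of_all _ fun ω => ?_)
    change (F⁻¹ * ((g (X 0 ω) + ε 0 ω - D) * phi (X 0 ω + U 0 ω) x (lam * σ ^ 2))) ^ 2 = _
    ring
  rw [hvar] at hclt
  refine ⟨hvar ▸ variance_nonneg _ _, ?_⟩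
  have := m.tendstoInDistribution_centred (κ := fun _ => 1) (Cκ := (√(lam * σ ^ 2))⁻¹) hσ hg hτ
    hlam.le hb₀ hi hpos h0 (fun _ => one_pos) ?_ ?_ (c := F⁻¹) rfl
    (v := (DeltaPos fX g τsq σ lam x).toNNReal) ?_
  · simpa only [mul_one] using this
  · intro n
    rw [← div_eq_inv_mul, le_div_iff₀ (Real.sqrt_pos.2 hlσ), one_mul]
    exact Real.sqrt_le_sqrt (le_add_of_nonneg_left (sq_nonneg _))
  · simpa using tendsto_natCast_atTop_atTop (R := ℝ)
  · simpa only [mul_one] using hclt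

/-- Asymptotic normality of the naive estimator. -/
theorem Model.asymptotic_normality_zero (m : Model P X U ε fX τsq μ₃ σ) (hσ : 0 < σ)
    (hf : Measurable fX) (hg : Measurable g) (hτ : Measurable τsq) (hb₀ : 0 < b₀)
    (hi : Integrable (fun t => (g t ^ 2 + τsq t) * phi t x (b₀ ^ 2 / 2 + σ ^ 2)) (P.map (X 0)))
    {s₁ : ℝ} (hs₁ : σ ^ 2 < s₁)
    (hi3 : Integrable (fun t => 4 * (|g t| ^ 3 + μ₃ t) * phi t x s₁) (P.map (X 0)))
    (hpos : ∀ n, 0 < h n) (h0 : Tendsto h atTop (𝓝 0))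
    (hnh : Tendsto (fun n : ℕ => n * h n) atTop atTop) :
    0 ≤ DeltaZero fX g τsq σ x ∧
    TendstoInDistribution (fun (n : ℕ) ω => √(n * h n) *
      centred X U ε fX g σ 0 x h (biasError (P.map (X 0)) fX g σ 0 x h) n ω) atTop id
      (fun _ => P) (gaussianReal 0 (DeltaZero fX g τsq σ x).toNNReal) := by
  have : IsProbabilityMeasure (P.map (X 0)) :=
    Measure.isProbabilityMeasure_map (m.measurable_X 0).aemeasurable
  set ν := P.map (X 0) with hν
  have hS : 0 < σ ^ 2 := by positivity
  set F := smooth ν (fun _ => 1) x (σ ^ 2) with hF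
  have hF0 : F ≠ 0 := (smooth_one_pos hS x).ne'
  set D₀ := smooth ν g x (σ ^ 2) / F with hD₀
  have hi' : Integrable (fun t => (g t ^ 2 + τsq t) *
      phi t x ((b₀ ^ 2 + 0 * σ ^ 2) / 2 + σ ^ 2)) ν := by simpa using hi
  have hig := m.integrable_g_mul_phi hσ hg hτ le_rfl hb₀ hi'
  simp only [add_zero, one_mul] at hig
  have hw : Measurable fun t => g t ^ 2 + τsq t := by fun_prop
  have hlt : σ ^ 2 < b₀ ^ 2 + σ ^ 2 := lt_add_of_pos_left _ (by positivity)
  have hlt2 : σ ^ 2 < b₀ ^ 2 / 2 + σ ^ 2 := lt_add_of_pos_left _ (by positivity)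
  have hi₀ : Integrable (fun t => (g t ^ 2 + τsq t) * phi t x (σ ^ 2)) ν :=
    (integrable_smooth hw hi hS hlt2 (y := x) (by simp)).1
  set D : ℕ → ℝ := fun n => meanRatio ν g x (σ ^ 2) (h n ^ 2) with hD
  have tD : Tendsto D atTop (𝓝 D₀) := tendsto_meanRatio hg hS hlt hig hF0 h0
  have hh2 : ∀ n, 0 < h n ^ 2 := fun n => pow_pos (hpos n) 2
  have th2 : Tendsto (fun n => h n ^ 2) atTop (𝓝 0) := by simpa using h0.pow 2
  have tlim : ∀ r : ℝ, Tendsto (fun n => h n ^ 2 / r + σ ^ 2) atTop (𝓝 (σ ^ 2)) := fun r => by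
    simpa using (th2.div_const r).add_const (σ ^ 2)
  have hig2 : Integrable (fun t => (1 : ℝ) * phi t x (b₀ ^ 2 + σ ^ 2)) ν :=
    integrable_one_mul_phi (by positivity) x
  have tG : ∀ r : ℝ, Tendsto (fun n => smooth ν g x (h n ^ 2 / r + σ ^ 2)) atTop
      (𝓝 (smooth ν g x (σ ^ 2))) := fun r =>
    (hasDerivAt_smooth_var hg hig hS hlt).continuousAt.tendsto.comp (tlim r)
  have tF : ∀ r : ℝ, Tendsto (fun n => smooth ν (fun _ => 1) x (h n ^ 2 / r + σ ^ 2)) atTop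
      (𝓝 F) := fun r =>
    (hasDerivAt_smooth_var measurable_const hig2 hS hlt).continuousAt.tendsto.comp (tlim r)
  have tQ : Tendsto (fun n => smooth ν (fun t => g t ^ 2 + τsq t) x (h n ^ 2 / 2 + σ ^ 2)) atTop
      (𝓝 (smooth ν (fun t => g t ^ 2 + τsq t) x (σ ^ 2))) :=
    (hasDerivAt_smooth_var hw hi hS hlt2).continuousAt.tendsto.comp (tlim 2)
  have ev2 : ∀ᶠ n in atTop, Integrable (fun t => (g t ^ 2 + τsq t) *
      phi t x (h n ^ 2 / 2 + σ ^ 2)) ν := by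
    filter_upwards [(tlim 2).eventually_lt_const hlt2] with n hn
    exact (integrable_smooth hw hi (by positivity) hn (y := x) (by simp)).1
  set p : ℕ → ℝ × ℝ × ℝ → ℝ := fun n e => F⁻¹ * ((yOf g e - D n) * phi (zOf e) x (h n ^ 2)) with hp
  have hpm : ∀ n, Measurable (p n) := fun n =>
    (((measurable_yOf hg).sub_const _).mul
      ((measurable_phi_left x _).comp measurable_zOf)).const_mul _
  have h1 : Tendsto (fun n => ∫ ω, p n (obs X U ε 0 ω) ∂P) atTop
      (𝓝 (F⁻¹ * (smooth ν g x (σ ^ 2) - D₀ * F))) := by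
    have := ((tG 1).sub (tD.mul (tF 1))).const_mul F⁻¹
    refine this.congr' ?_
    filter_upwards [ev2] with n hn
    have iY : Integrable (fun ω => (g (X 0 ω) + ε 0 ω) * phi (X 0 ω + U 0 ω) x (h n ^ 2)) P :=
      ((m.memLp_Y_mul_phi hσ hg hτ (hh2 n)).2 hn).integrable one_le_two
    obtain ⟨i2, e2⟩ := m.integral_phi (x := x) hσ (hh2 n)
    rw [div_one, ← (m.integral_Y_mul_phi hσ hg (hh2 n) iY).2, ← e2, ← integral_const_mul,
      ← integral_sub iY (i2.const_mul _), ← integral_const_mul]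
    refine integral_congr_ae (ae_of_all _ fun ω => ?_)
    change _ = F⁻¹ * ((g (X 0 ω) + ε 0 ω - D n) * phi (X 0 ω + U 0 ω) x (h n ^ 2))
    ring
  -- The factor `κ = h` cancels the `√(h²)` in the constant of the squared kernel. The squared mean
  -- is negligible after multiplication with `h`, so the raw second moment already gives the
  -- variance.
  have hv : Tendsto (fun n => h n * ∫ ω, p n (obs X U ε 0 ω) ^ 2 ∂P) atTop
      (𝓝 (DeltaZero fX g τsq σ x)) := by
    rw [m.DeltaZero_eq hf hg hi₀ hF hF0 hD₀]
    have := ((((tQ.sub ((tD.const_mul 2).mul (tG 2))).add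
      ((tD.pow 2).mul (tF 2))).const_mul (2 * √Real.pi)⁻¹)).const_mul (F⁻¹ ^ 2)
    refine this.congr' ?_
    filter_upwards [ev2] with n hn
    have e : ∫ ω, p n (obs X U ε 0 ω) ^ 2 ∂P = F⁻¹ ^ 2 *
        ∫ ω, ((g (X 0 ω) + ε 0 ω - D n) * phi (X 0 ω + U 0 ω) x (h n ^ 2)) ^ 2 ∂P := by
      rw [← integral_const_mul]
      refine integral_congr_ae (ae_of_all _ fun ω => ?_)
      change (F⁻¹ * ((g (X 0 ω) + ε 0 ω - D n) * phi (X 0 ω + U 0 ω) x (h n ^ 2))) ^ 2 = _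
      ring
    rw [e, m.integral_sub_mul_phi_sq hσ hg hτ (hh2 n) hn, Real.sqrt_mul Real.pi_pos.le,
      Real.sqrt_sq (hpos n).le]
    have h1 := hpos n
    have h2 : 0 < √Real.pi := Real.sqrt_pos.2 Real.pi_pos
    field_simp
    ring
  have hv0 : 0 ≤ DeltaZero fX g τsq σ x :=
    ge_of_tendsto' hv fun n => mul_nonneg (hpos n).le (integral_nonneg fun _ => sq_nonneg _)
  refine ⟨hv0, ?_⟩
  obtain ⟨C, hC⟩ := m.exists_bound_cube hσ hg hi3 (|D₀| + 1) F⁻¹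
  have hev : ∀ᶠ n in atTop, h n ^ 2 / 3 + σ ^ 2 ≤ s₁ ∧ |D n| ≤ |D₀| + 1 := by
    filter_upwards [(tlim 3).eventually_le_const hs₁, tD.abs.eventually_le_const (lt_add_one _)]
      with n h1 h2 using ⟨h1, h2⟩
  have hclt := tendstoInDistribution_sqrt_mul_empMean_of_lyapunov m.measurable_obs m.indep m.ident
    hpm hpos h0 hnh (hev.mono fun n hn => (hC _ _ (hh2 n) hn.1 hn.2).1) h1 hv hv0
    (hev.mono fun n hn => (hC _ _ (hh2 n) hn.1 hn.2).2)
  have hS' : (1 + 0) * σ ^ 2 = σ ^ 2 := by ring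
  refine m.tendstoInDistribution_centred (κ := h) (Cκ := 1) hσ hg hτ le_rfl hb₀ hi' hpos h0 hpos
    ?_ hnh (c := F⁻¹) (by rw [hS']) ?_
  · intro n
    rw [zero_mul, add_zero, Real.sqrt_sq (hpos n).le, one_mul]
  · simp only [add_zero, one_mul, zero_mul]
    exact hclt

end main

end EXEstimation

theorem theorem2 {Ω : Type*} [MeasurableSpace Ω] (P : Measure Ω) [IsProbabilityMeasure P]
    (X U ε : ℕ → Ω → ℝ) (fX g τsq μ₃ : ℝ → ℝ) (σ : ℝ) (hσ : 0 < σ)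
    (hmodel : Model P X U ε fX τsq μ₃ σ)
    (hC1 : CondC1 (P.map (X 0)).support fX g τsq μ₃ σ)
    (h : ℕ → ℝ) (hC2 : CondC2 h) (x : ℝ) :
    (∀ lam : ℝ, 0 < lam →
      -- for large `lam`: some bandwidth at which the summands of `T0` have a finite variance
      (2 ≤ lam → ∃ b : ℝ, 0 < b ∧
        MemLp (fun ω => (g (X 0 ω) + ε 0 ω) *
          phi x (X 0 ω + U 0 ω) (b ^ 2 + lam * σ ^ 2)) 2 P) →
      0 ≤ DeltaPos fX g τsq σ lam x ∧
      ∃ ρ : ℕ → ℝ, ρ =o[atTop] (fun n => h n ^ 2) ∧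
        TendstoInDistribution
          (fun (n : ℕ) ω => √(n : ℝ) * centred X U ε fX g σ lam x h ρ n ω)
          atTop id (fun _ => P) (gaussianReal 0 (DeltaPos fX g τsq σ lam x).toNNReal)) ∧
    (0 ≤ DeltaZero fX g τsq σ x ∧
      ∃ ρ : ℕ → ℝ, ρ =o[atTop] (fun n => h n ^ 2) ∧
        TendstoInDistribution
          (fun (n : ℕ) ω => √((n : ℝ) * h n) * centred X U ε fX g σ 0 x h ρ n ω)
          atTop id (fun _ => P) (gaussianReal 0 (DeltaZero fX g τsq σ x).toNNReal)) := by
  have : IsProbabilityMeasure (P.map (X 0)) :=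
    Measure.isProbabilityMeasure_map (hmodel.measurable_X 0).aemeasurable
  have hf : Measurable fX := hC1.smooth_fX.continuous.measurable
  have hg : Measurable g := hC1.smooth_g.continuous.measurable
  have hτ : Measurable τsq := hC1.smooth_τsq.continuous.measurable
  have hσ2 : 0 < σ ^ 2 := by positivity
  have hsecond : ∀ lam : ℝ, 0 ≤ lam → lam < 2 → ∃ b₀ : ℝ, 0 < b₀ ∧
      Integrable (fun t => (g t ^ 2 + τsq t) *
        phi t x ((b₀ ^ 2 + lam * σ ^ 2) / 2 + σ ^ 2)) (P.map (X 0)) := by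
    intro lam h1 h2
    have h3 : 0 < (2 - lam) * σ ^ 2 / 2 := by
      have : 0 < 2 - lam := by linarith
      positivity
    -- This `b₀` makes the variance `σ² + (2 + λ)σ²/4`, which is below `2σ²` exactly when `λ < 2`.
    refine ⟨√((2 - lam) * σ ^ 2 / 2), Real.sqrt_pos.2 h3,
      hC1.integrable_second_moment hσ (by positivity) ?_ x⟩
    rw [Real.sq_sqrt h3.le]
    nlinarith
  constructor
  · intro lam hlam hlarge
    obtain ⟨b₀, hb₀, hi⟩ : ∃ b₀ : ℝ, 0 < b₀ ∧ Integrable (fun t => (g t ^ 2 + τsq t) *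
        phi t x ((b₀ ^ 2 + lam * σ ^ 2) / 2 + σ ^ 2)) (P.map (X 0)) := by
      rcases lt_or_ge lam 2 with hl | hl
      · exact hsecond lam hlam.le hl
      · obtain ⟨b, hb, hL⟩ := hlarge hl
        simp only [phi_comm x] at hL
        exact ⟨b, hb, (hmodel.memLp_Y_mul_phi hσ hg hτ (by positivity)).1 hL⟩
    obtain ⟨h1, h2⟩ := hmodel.asymptotic_normality_pos hσ hf hg hτ hlam hb₀ hi hC2.pos
      hC2.tendsto_zero
    exact ⟨h1, _, hmodel.biasError_isLittleO hσ hf hg hτ hlam.le hb₀ hi hC2.tendsto_zero, h2⟩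
  · obtain ⟨b₀, hb₀, hi⟩ := hsecond 0 le_rfl two_pos
    obtain ⟨h1, h2⟩ := hmodel.asymptotic_normality_zero hσ hf hg hτ hb₀ (by simpa using hi)
      -- Any variance strictly between `σ²` and the third-moment threshold `4σ²/3` would do.
      (s₁ := 7 / 6 * σ ^ 2) (by linarith)
      (hC1.integrable_third_moment hσ (by positivity) (by linarith) x) hC2.pos hC2.tendsto_zero
      hC2.tendsto_mul
    exact ⟨h1, _, hmodel.biasError_isLittleO hσ hf hg hτ le_rfl hb₀ hi hC2.tendsto_zero, h2⟩
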